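/- Let $n\ge 1$ and $k=n+1$. Let $\mathcal P=\mathbb C[x_{il}:1\le i\le k,\,1\le l\le n]$, and let $O(n)$ be the complex orthogonal group of the form $(u,v)=\sum_{l}u_lv_{n+1-l}$ with Gram matrix $J_n$, acting on $\mathcal P$ by $P(x)\mapsto P(xg)$. Let $\mathcal I=\mathcal P^{O(n)}$, let $r_{ij}=\sum_l x_{il}x_{j,n+1-l}\in\mathcal I$, and for $1\le i,j\le k$ put $$\Delta_{ij}=\sum_l\partial_{x_{il}}\partial_{x_{j,n+1-l}},\qquad h_{ij}=\sum_l x_{il}\partial_{x_{jl}}+\tfrac n2\delta_{ij}.$$ Let $\mathcal H\subset\mathcal P$ be the common kernel of the $\Delta_{ij}$. The spans $\mathfrak p^-=\langle r_{ij}\rangle$, $\mathfrak k=\langle h_{ij}\rangle\cong\mathfrak{gl}(k)$ and $\mathfrak p^+=\langle\Delta_{ij}\rangle$ add up to $\mathfrak g\cong\mathfrak{sp}(2k,\mathbb C)$. Weights are written in the basis $\varepsilon_1,\dots,\varepsilon_k$ dual to $-h_{11},\dots,-h_{kk}$. The positive roots are $\varepsilon_i-\varepsilon_j$ for $i<j$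 (compact, root vector $h_{ji}$) and $\varepsilon_i+\varepsilon_j$ for $i\le j$ (non-compact, root vector $\Delta_{ij}$), and $\rho$ is half their sum. Let $\sigma$ be a Young diagram of depth at most $k$ with at most two columns and at most $n$ boxes. It is of type $(t,d)$ if its first column has length $d$ and its second column has length $t$. Put $\sigma^\sharp=(-\sigma_k-\frac n2,\dots,-\sigma_1-\frac n2)$. For a weight $\lambda$, let $\Psi_\lambda$ be the set of roots orthogonal to $\lambda+\rho$, and let $\Gamma_\lambda$ be the set of positive non-compact roots $\alpha$ such that (i) $\langle\lambda+\rho,\alpha^\vee\rangle$ is a positive integer, (ii) $\alpha$ is orthogonal to $\Psi_\lambda$, and (iii) $\alpha$ is short if $\Psi_\lambda$ contains a long root. If $\gamma$ is the minimum of $\Gamma_{\sigma^\sharp}$ in the usual order on roots, put $\lambda'_{(k)}(\sigma)=(s_\gamma(\sigma^\sharp+\rho))^+-\rho$, where $\mu^+$ is the weakly decreasing rearrangement of $\mu$. Write $\sigma\in\Omega^0_{n,n+1}$ if $\Gamma_{\sigma^\sharp}\neq\emptyset$. Let $\delta_j$ be the bottom right $j\times j$ minor of $x=(x_{il})$, put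 $\delta_\sigma=\prod_j\delta_j^{\sigma_j-\sigma_{j+1}}$, and let $F_{\sigma^\sharp}\subset\mathcal P$ be the $\mathfrak k$-module generated by $\delta_\sigma$. Let $\phi_\sigma:\mathcal I\otimes F_{\sigma^\sharp}\to\mathcal P$, $I\otimes H\mapsto IH$. The algebra $\mathfrak k$ acts on $\mathcal I\otimes F_{\sigma^\sharp}$ by $h(I\otimes H)=[h,I]\otimes H+I\otimes hH$. Let $N(\sigma^\sharp)=S(\mathfrak p^-)\otimes F_{\sigma^\sharp}$ be the generalized Verma module of $\mathfrak g$ induced from $F_{\sigma^\sharp}$, on which $\mathfrak p^+$ acts by zero, and let $\pi_\sigma:N(\sigma^\sharp)\to\mathcal I\otimes F_{\sigma^\sharp}$ be the $\mathfrak k$-linear map induced by the projection $S(\mathfrak p^-)\to\mathcal I$. Let $$M=M^{(n,n+1)}=\begin{pmatrix} (r_{ij}) & xJ_n\\ J_nx^T & J_n\end{pmatrix},$$ and let $M_{a,b}$ be the submatrix of order $n+1$ formed by the consecutive rows and columns of $M$ starting with row $a$ and column $b$. A product of symbols $r_{ij}$ and $x_{il}$ is read as (product of the $r_{ij}$) $\otimes$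 (product of the $x_{il}$). **Theorem.** Let $\sigma\in\Omega^0_{n,n+1}$ be of type $(t,d)$ with $d>0$. Then: 1. $$M_{d+1,t+1}=\begin{pmatrix} r_{d+1,t+1}&\dots&r_{d+1,n+1}&x_{d+1,n}&\dots&x_{d+1,n+1-t}\\ \vdots&&\vdots&\vdots&&\vdots\\ r_{n+1,t+1}&\dots&r_{n+1,n+1}&x_{n+1,n}&\dots&x_{n+1,n+1-t}\\ x_{t+1,n}&\dots&x_{n+1,n}&0&\dots&0\\ \vdots&&\vdots&\vdots&&\vdots\\ x_{t+1,n+1-d}&\dots&x_{n+1,n+1-d}&0&\dots&0\end{pmatrix}.$$ 2. $F_{\sigma^\sharp}\subset\mathcal H$, and $D_\sigma=\det M_{d+1,t+1}$ is an element of $\mathcal I\otimes F_{\sigma^\sharp}\subset\mathcal I\otimes\mathcal H$ that lies in $\operatorname{Ker}\phi_\sigma$. 3. The minimum $\gamma$ of $\Gamma_{\sigma^\sharp}$ exists, and $D_\sigma$ is a highest weight vector of weight $\lambda'_{(n+1)}(\sigma)$: it is non-zero, $-h_{ii}D_\sigma=\lambda'_{(n+1)}(\sigma)_i\,D_\sigma$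 for all $i$, and $h_{ji}D_\sigma=0$ for $i<j$. Moreover, the same determinant, formed with the generators $r_{ij}$ of $S(\mathfrak p^-)$, is an element $\widetilde D_\sigma$ of $N(\sigma^\sharp)$ with $\pi_\sigma(\widetilde D_\sigma)=D_\sigma$, and it is a highest weight vector for $\mathfrak g$ of the same weight; in particular $\Delta_{ij}\widetilde D_\sigma=0$ for all $i,j$. -/

import Mathlib

open scoped TensorProduct

noncomputable section

namespace SeparationOfVariables

/-! ### Polynomials, invariants and harmonics -/

/-- Complex polynomials on `k × n` matrices; `X (i, l)` is the coordinate function `x_{il}`. -/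
abbrev Poly (n k : ℕ) : Type := MvPolynomial (Fin k × Fin n) ℂ

/-- The antidiagonal matrix `J_n` of the form `(u, v) = u₁ vₙ + ⋯ + uₙ v₁`. -/
def antidiag (n : ℕ) (A : Type*) [CommRing A] : Matrix (Fin n) (Fin n) A :=
  Matrix.of fun i j => if j = i.rev then 1 else 0

/-- The complex orthogonal group of the form `J_n`. -/
def orthogonalSet (n : ℕ) : Set (Matrix (Fin n) (Fin n) ℂ) :=
  {g | g.transpose * antidiag n ℂ * g = antidiag n ℂ}

/-- The substitution `P(x) ↦ P(x g)`. -/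
def substAction {n k : ℕ} (g : Matrix (Fin n) (Fin n) ℂ) : Poly n k →ₐ[ℂ] Poly n k :=
  MvPolynomial.aeval fun p => ∑ l, MvPolynomial.X (p.1, l) * MvPolynomial.C (g l p.2)

/-- The algebra `𝓘` of `O(n)`-invariant polynomials. -/
def invariants (n k : ℕ) : Subalgebra ℂ (Poly n k) where
  carrier := {P | ∀ g ∈ orthogonalSet n, substAction g P = P}
  mul_mem' hp hq g hg := by rw [map_mul, hp g hg, hq g hg]
  add_mem' hp hq g hg := by rw [map_add, hp g hg, hq g hg]
  algebraMap_mem' c g _ := by simp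

/-- The quadratic invariant `r_{ij} = x_{i1} x_{jn} + ⋯ + x_{in} x_{j1}`. -/
def quad {n k : ℕ} (i j : Fin k) : Poly n k :=
  ∑ l : Fin n, MvPolynomial.X (i, l) * MvPolynomial.X (j, l.rev)

/-- The Laplace operator `Δ_{ij} = ∂_{i1} ∂_{jn} + ⋯ + ∂_{in} ∂_{j1}`. -/
def laplace {n k : ℕ} (i j : Fin k) : Module.End ℂ (Poly n k) :=
  ∑ l : Fin n, (MvPolynomial.pderiv (R := ℂ) (i, l)).toLinearMap ∘ₗ
    (MvPolynomial.pderiv (R := ℂ) (j, l.rev)).toLinearMap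

/-- The space `𝓗` of harmonic polynomials. -/
def harmonics (n k : ℕ) : Submodule ℂ (Poly n k) :=
  ⨅ i : Fin k, ⨅ j : Fin k, LinearMap.ker (laplace i j)

/-- The derivation `∑ₗ x_{il} ∂_{jl}`. -/
def polarization {n k : ℕ} (i j : Fin k) : Derivation ℂ (Poly n k) (Poly n k) :=
  ∑ l : Fin n, (MvPolynomial.X (i, l) : Poly n k) • MvPolynomial.pderiv (R := ℂ) (j, l)

/-- The mixed operator `h_{ij} = ∑ₗ x_{il} ∂_{jl} + (n/2) δ_{ij}`. -/
def mixed {n k : ℕ} (i j : Fin k) : Module.End ℂ (Poly n k) :=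
  (polarization i j).toLinearMap + if i = j then ((n : ℂ) / 2) • LinearMap.id else 0

theorem quad_comm {n k : ℕ} (i j : Fin k) : (quad i j : Poly n k) = quad j i := by
  unfold quad
  rw [← Equiv.sum_comp Fin.revPerm]
  refine Finset.sum_congr rfl fun l _ => ?_
  simp [mul_comm]

theorem antidiag_mul_self (n : ℕ) : antidiag n ℂ * antidiag n ℂ = 1 := by
  ext i j
  rw [Matrix.mul_apply, Finset.sum_eq_single i.rev]
  · simp [antidiag, Matrix.one_apply, eq_comm]
  · intro l _ hl
    simp [antidiag, hl]
  · simp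

theorem orthogonalSet_transpose {n : ℕ} {g : Matrix (Fin n) (Fin n) ℂ}
    (hg : g ∈ orthogonalSet n) : g * antidiag n ℂ * g.transpose = antidiag n ℂ := by
  have hJ := antidiag_mul_self n
  have h1 : (antidiag n ℂ * g.transpose * antidiag n ℂ) * g = 1 := by
    have := congrArg (antidiag n ℂ * ·) hg
    simp only [hJ] at this
    simpa only [Matrix.mul_assoc] using this
  have h2 := mul_eq_one_comm.mp h1
  calc g * antidiag n ℂ * g.transpose
      = (g * (antidiag n ℂ * g.transpose * antidiag n ℂ)) * antidiag n ℂ := by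
        simp only [Matrix.mul_assoc, hJ, Matrix.mul_one]
    _ = antidiag n ℂ := by rw [h2, Matrix.one_mul]

theorem quad_mem_invariants {n k : ℕ} (i j : Fin k) : (quad i j : Poly n k) ∈ invariants n k := by
  intro g hg
  have h := orthogonalSet_transpose hg
  have key : ∀ a b : Fin n, ∑ l, g a l * g b l.rev = if b = a.rev then 1 else 0 := by
    intro a b
    have := congrFun (congrFun h a) b
    simp only [antidiag, Matrix.mul_apply, Matrix.of_apply, Matrix.transpose_apply, mul_ite,
      mul_one, mul_zero] at this
    rw [← this, ← Equiv.sum_comp Fin.revPerm]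
    refine Finset.sum_congr rfl fun l _ => ?_
    simp only [Fin.revPerm_apply, Fin.rev_rev]
    congr 1
    rw [Finset.sum_eq_single l.rev]
    · simp
    · intro c _ hc
      refine if_neg fun h => hc ?_
      rw [h, Fin.rev_rev]
    · simp
  unfold quad substAction
  simp only [map_sum, map_mul, MvPolynomial.aeval_X]
  calc _ = ∑ a : Fin n, ∑ b : Fin n, MvPolynomial.X (i, a) * MvPolynomial.X (j, b) *
        MvPolynomial.C (∑ l, g a l * g b l.rev) := by
        simp_rw [Finset.sum_mul_sum, map_sum, Finset.mul_sum, map_mul]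
        rw [Finset.sum_comm]
        refine Finset.sum_congr rfl fun a _ => ?_
        rw [Finset.sum_comm]
        refine Finset.sum_congr rfl fun b _ => Finset.sum_congr rfl fun l _ => by ring
    _ = _ := by
        refine Finset.sum_congr rfl fun a _ => ?_
        simp only [key]
        rw [Finset.sum_eq_single a.rev] <;> simp +contextual

theorem polarization_X {n k : ℕ} (i j : Fin k) (p : Fin k × Fin n) :
    polarization i j (MvPolynomial.X p) =
      if p.1 = j then (MvPolynomial.X (i, p.2) : Poly n k) else 0 := by
  obtain ⟨a, b⟩ := p
  have h0 : polarization i j (MvPolynomial.X (a, b)) =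
      ∑ l : Fin n, (MvPolynomial.X (i, l) : Poly n k) *
        MvPolynomial.pderiv (R := ℂ) (j, l) (MvPolynomial.X (a, b)) := by
    change Derivation.coeFnAddMonoidHom (polarization i j) _ = _
    rw [polarization, map_sum, Finset.sum_apply]
    rfl
  rw [h0]
  by_cases h : a = j
  · subst h
    rw [Finset.sum_eq_single b]
    · simp
    · intro c _ hc
      rw [MvPolynomial.pderiv_X_of_ne (by simpa using fun h => hc h.symm), mul_zero]
    · simp
  · rw [if_neg h]
    refine Finset.sum_eq_zero fun c _ => ?_
    rw [MvPolynomial.pderiv_X_of_ne (by simp [h]), mul_zero]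

theorem polarization_subst {n k : ℕ} (i j : Fin k) (g : Matrix (Fin n) (Fin n) ℂ)
    (P : Poly n k) : substAction g (polarization i j P) = polarization i j (substAction g P) := by
  induction P using MvPolynomial.induction_on with
  | C c => simp [← MvPolynomial.algebraMap_eq]
  | add p q hp hq => simp [hp, hq]
  | mul_X p v hp =>
    simp only [Derivation.leibniz, map_add, map_mul, smul_eq_mul, hp]
    congr 2
    simp only [polarization_X, substAction, MvPolynomial.aeval_X, map_sum, Derivation.leibniz,
      ← MvPolynomial.algebraMap_eq, Derivation.map_algebraMap, smul_eq_mul, mul_zero, zero_add]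
    by_cases h : v.1 = j <;> simp [h, MvPolynomial.algebraMap_eq, mul_comm]

/-- The invariants are stable under the derivations `∑ₗ x_{il} ∂_{jl}`. -/
theorem polarization_mem_invariants {n k : ℕ} (i j : Fin k) {P : Poly n k}
    (hP : P ∈ invariants n k) : polarization i j P ∈ invariants n k := fun g hg => by
  rw [polarization_subst, hP g hg]

/-- `r_{ij}` as an element of `𝓘`. -/
def quadInv {n k : ℕ} (i j : Fin k) : invariants n k := ⟨quad i j, quad_mem_invariants i j⟩

/-! ### Young diagrams and weights -/

/-- `Σ_{n,k}`: Young diagrams of depth at most `k` with at most `n` boxes in the first two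
columns. -/
def diagrams (n k : ℕ) : Set YoungDiagram :=
  {σ | σ.colLen 0 ≤ k ∧ σ.colLen 0 + σ.colLen 1 ≤ n}

/-- Coordinates of a weight with respect to `ε₁, …, ε_k`, where `ε_i (-h_{jj}) = δ_{ij}`. -/
abbrev Weight (k : ℕ) : Type := Fin k → ℚ

/-- The weight `ε_i`. -/
def eps {k : ℕ} (i : Fin k) : Weight k := Pi.single i 1

/-- Positive non-compact roots `ε_i + ε_j`, `i ≤ j`. -/
def posNoncompactRoots (k : ℕ) : Set (Weight k) := {α | ∃ i j, i ≤ j ∧ α = eps i + eps j}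

/-- Positive compact roots `ε_i - ε_j`, `i < j`. -/
def posCompactRoots (k : ℕ) : Set (Weight k) := {α | ∃ i j, i < j ∧ α = eps i - eps j}

/-- Positive roots of `𝔰𝔭(2k)`. -/
def posRoots (k : ℕ) : Set (Weight k) := posCompactRoots k ∪ posNoncompactRoots k

/-- Roots of `𝔰𝔭(2k)`. -/
def roots (k : ℕ) : Set (Weight k) := {α | α ∈ posRoots k ∨ -α ∈ posRoots k}

/-- Half the sum of the positive roots. -/
def rho (k : ℕ) : Weight k :=
  (1 / 2 : ℚ) • ((∑ p : Fin k × Fin k with p.1 < p.2, (eps p.1 - eps p.2)) +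
    ∑ p : Fin k × Fin k with p.1 ≤ p.2, (eps p.1 + eps p.2))

/-- The number `⟨μ, α^∨⟩ = 2 (μ, α) / (α, α)`. The Killing form is proportional to the dot product
in the coordinates used here. -/
def corootPairing {k : ℕ} (μ α : Weight k) : ℚ := 2 * (μ ⬝ᵥ α) / (α ⬝ᵥ α)

/-- The root reflection `s_α`. -/
def reflect {k : ℕ} (α μ : Weight k) : Weight k := μ - corootPairing μ α • α

/-- The set `Ψ_λ` of roots orthogonal to `λ + ρ`. -/
def singularRoots {k : ℕ} (lam : Weight k) : Set (Weight k) :=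
  {α | α ∈ roots k ∧ α ⬝ᵥ (lam + rho k) = 0}

/-- The set `Γ_λ` of positive non-compact roots `α` with
(i) `⟨λ + ρ, α^∨⟩` a positive integer, (ii) `α` orthogonal to `Ψ_λ`, (iii) `α` short if `Ψ_λ`
contains a long root. Long roots `± 2 ε_i` have square length `4`, short roots `2`. -/
def gammaSet {k : ℕ} (lam : Weight k) : Set (Weight k) :=
  {α | α ∈ posNoncompactRoots k ∧
    (∃ m : ℕ, 0 < m ∧ corootPairing (lam + rho k) α = m) ∧
    (∀ β ∈ singularRoots lam, α ⬝ᵥ β = 0) ∧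
    ((∃ β ∈ singularRoots lam, β ⬝ᵥ β = 4) → α ⬝ᵥ α = 2)}

/-- `γ` is the minimum of `S` in the usual order: `α ≤ β` when `β - α` is a sum of positive
roots. -/
def IsLeastRoot {k : ℕ} (S : Set (Weight k)) (γ : Weight k) : Prop :=
  γ ∈ S ∧ ∀ β ∈ S, β - γ ∈ AddSubmonoid.closure (posRoots k)

/-- `μ⁺`: the weakly decreasing rearrangement of `μ`. -/
def dominantRep {k : ℕ} (μ : Weight k) : Weight k := μ ∘ Tuple.sort (-μ)

/-- `σ^♯ = (-σ_k - n/2, …, -σ_1 - n/2)`. -/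
def sharp (n k : ℕ) (σ : YoungDiagram) : Weight k :=
  fun i => -(σ.rowLen i.rev : ℚ) - (n : ℚ) / 2

/-- `ν = λ'_{(k)}(σ)`, that is, `ν = (s_γ(σ^♯ + ρ))⁺ - ρ` for the minimum `γ` of `Γ_{σ^♯}`. -/
def IsLambdaPrime (n k : ℕ) (σ : YoungDiagram) (ν : Weight k) : Prop :=
  ∃ γ, IsLeastRoot (gammaSet (sharp n k σ)) γ ∧
    ν = dominantRep (reflect γ (sharp n k σ + rho k)) - rho k

/-- `Ω⁰_{n,k}`: diagrams in `Σ_{n,k}` with at most two columns and `Γ_{σ^♯} ≠ ∅`. -/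
def narrowDiagrams (n k : ℕ) : Set YoungDiagram :=
  {σ | σ ∈ diagrams n k ∧ σ.rowLen 0 ≤ 2 ∧ (gammaSet (sharp n k σ)).Nonempty}

/-! ### The `𝔤𝔩(k)`-module `F_{σ^♯}` -/

/-- The bottom right minor of order `j + 1` of the variable matrix. -/
def cornerMinor (n k : ℕ) (j : Fin (min n k)) : Poly n k :=
  (Matrix.of fun a b : Fin (j + 1) => (MvPolynomial.X
    (⟨k - (j + 1) + a, by omega⟩, ⟨n - (j + 1) + b, by omega⟩) : Poly n k)).det

/-- The highest weight harmonic `δ_σ = ∏_j δ_j ^ (σ_j - σ_{j+1})`. -/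
def hwHarmonic (n k : ℕ) (σ : YoungDiagram) : Poly n k :=
  ∏ j : Fin (min n k), cornerMinor n k j ^ (σ.rowLen j - σ.rowLen (j + 1))

/-- `F_{σ^♯}`: the `𝔤𝔩(k)`-submodule of polynomials generated by `δ_σ`. -/
def glModule (n k : ℕ) (σ : YoungDiagram) : Submodule ℂ (Poly n k) :=
  sInf {W | hwHarmonic n k σ ∈ W ∧ ∀ i j, ∀ P ∈ W, mixed i j P ∈ W}

theorem mixed_mem_glModule {n k : ℕ} (σ : YoungDiagram) (i j : Fin k) :
    ∀ P ∈ glModule n k σ, mixed i j P ∈ glModule n k σ := by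
  intro P hP
  refine Submodule.mem_sInf.mpr fun W hW => hW.2 i j P (Submodule.mem_sInf.mp hP W hW)

/-- The action of `h_{ij}` on `F_{σ^♯}`. -/
def mixedF {n k : ℕ} (σ : YoungDiagram) (i j : Fin k) : Module.End ℂ (glModule n k σ) :=
  (mixed i j).restrict (mixed_mem_glModule σ i j)

/-! ### `𝓘 ⊗ F_{σ^♯}`, the multiplication map and the action of `𝔤𝔩(k)` -/

/-- The multiplication map `𝓘 ⊗ W → 𝓟`, `I ⊗ H ↦ I H`, for a space `W` of polynomials. For
`W = 𝓗` it is `φ`, for `W = F_{σ^♯}` it is `φ_σ`. -/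
def mulMap {n k : ℕ} (W : Submodule ℂ (Poly n k)) : invariants n k ⊗[ℂ] W →ₗ[ℂ] Poly n k :=
  LinearMap.mul' ℂ (Poly n k) ∘ₗ TensorProduct.map (invariants n k).val.toLinearMap W.subtype

/-- The operator `I ↦ [h_{ij}, I] = ∑ₗ x_{il} ∂_{jl} I` on `𝓘`. -/
def polarizationInv {n k : ℕ} (i j : Fin k) : Module.End ℂ (invariants n k) where
  toFun P := ⟨polarization i j (P : Poly n k), polarization_mem_invariants i j P.2⟩
  map_add' P Q := Subtype.ext (by simp)
  map_smul' c P := Subtype.ext (by simp)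

/-- The action of `h_{ij}` on `𝓘 ⊗ F_{σ^♯}`: `h (I ⊗ H) = [h, I] ⊗ H + I ⊗ h H`. -/
def glAction {n k : ℕ} (σ : YoungDiagram) (i j : Fin k) :
    Module.End ℂ (invariants n k ⊗[ℂ] glModule n k σ) :=
  TensorProduct.map (polarizationInv i j) LinearMap.id +
    TensorProduct.map LinearMap.id (mixedF σ i j)

/-- Highest weight vectors of weight `ν` for `𝔤𝔩(k)` (`h i j` is the action of `h_{ij}`): non-zero
vectors on which `-h_{ii}` acts by `ν_i` and which are killed by the root vectors `h_{ji}` of the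
positive compact roots `ε_i - ε_j`, `i < j`. -/
structure IsGLHighestWeightVector {k : ℕ} {V : Type*} [AddCommGroup V] [Module ℂ V]
    (h : Fin k → Fin k → Module.End ℂ V) (ν : Weight k) (v : V) : Prop where
  ne_zero : v ≠ 0
  weight : ∀ i, -(h i i v) = (ν i : ℂ) • v
  raising : ∀ i j, i < j → h j i v = 0

/-- Highest weight vectors of weight `ν` for `𝔰𝔭(2k)`: in addition, the root vectors `Δ_{ij}` of
the positive non-compact roots `ε_i + ε_j` kill `v`. -/
structure IsSPHighestWeightVector {k : ℕ} {V : Type*} [AddCommGroup V] [Module ℂ V]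
    (h lap : Fin k → Fin k → Module.End ℂ V) (ν : Weight k) (v : V) : Prop where
  gl : IsGLHighestWeightVector h ν v
  noncompact : ∀ i j, lap i j v = 0

/-! ### The generalized Verma module `N(σ^♯) = S(𝔭⁻) ⊗ F_{σ^♯}` -/

/-- `S(𝔭⁻)`, the polynomial ring in symmetric variables `s_{ij}`, one for each `r_{ij}`. -/
abbrev SymPMinus (k : ℕ) : Type := MvPolynomial (Sym2 (Fin k)) ℂ

/-- The variable `s_{ij}`. -/
def symVar {k : ℕ} (i j : Fin k) : SymPMinus k := MvPolynomial.X s(i, j)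

/-- The natural projection `S(𝔭⁻) → 𝓘`, `s_{ij} ↦ r_{ij}`. -/
def toInvariants (n k : ℕ) : SymPMinus k →ₐ[ℂ] invariants n k :=
  MvPolynomial.aeval (Sym2.lift ⟨quadInv, fun i j => Subtype.ext (quad_comm i j)⟩)

/-- The derivation `ad h_{ij}` of `S(𝔭⁻)`: `[h_{ij}, r_{ab}] = δ_{ja} r_{ib} + δ_{jb} r_{ia}`. -/
def adMixed {k : ℕ} (i j : Fin k) : Derivation ℂ (SymPMinus k) (SymPMinus k) :=
  MvPolynomial.mkDerivation ℂ (Sym2.lift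
    ⟨fun a b => (if j = a then symVar i b else 0) + if j = b then symVar i a else 0,
      fun _ _ => add_comm _ _⟩)

/-- The expression `δ_{ja} T_{bi} + δ_{jb} T_{ai} + δ_{ia} T_{bj} + δ_{ib} T_{aj}`, symmetric in
`a, b`. For `T = h` it is the commutator `[Δ_{ij}, r_{ab}]`. -/
def lapBracket {k : ℕ} {V : Type*} [AddCommGroup V] (T : Fin k → Fin k → V) (i j : Fin k)
    (z : Sym2 (Fin k)) : V :=
  Sym2.lift ⟨fun a b => (if j = a then T b i else 0) + (if j = b then T a i else 0) +
    (if i = a then T b j else 0) + (if i = b then T a j else 0), fun _ _ => by dsimp only; abel⟩ z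

theorem map_lapBracket {k : ℕ} {V W : Type*} [AddCommGroup V] [AddCommGroup W] (g : V →+ W)
    (T : Fin k → Fin k → V) (i j : Fin k) (z : Sym2 (Fin k)) :
    g (lapBracket T i j z) = lapBracket (fun a b => g (T a b)) i j z := by
  induction z with | _ a b
  simp only [lapBracket, Sym2.lift_mk, map_add, apply_ite g, map_zero]

theorem pderiv_quad {n k : ℕ} (i a b : Fin k) (l : Fin n) :
    MvPolynomial.pderiv (i, l) (quad a b : Poly n k) =
      (if i = a then MvPolynomial.X (b, l.rev) else 0) +
        if i = b then MvPolynomial.X (a, l.rev) else 0 := by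
  have h : ∀ m : Fin n, MvPolynomial.pderiv (R := ℂ) (i, l)
      (MvPolynomial.X (a, m) * MvPolynomial.X (b, m.rev)) =
      (if l = m then if i = a then MvPolynomial.X (b, l.rev) else 0 else 0) +
        if l.rev = m then if i = b then MvPolynomial.X (a, l.rev) else 0 else 0 := by
    intro m
    have h1 : (MvPolynomial.pderiv (R := ℂ) (i, l) (MvPolynomial.X (b, m.rev)) : Poly n k) =
        if l.rev = m then if i = b then 1 else 0 else 0 := by
      rw [MvPolynomial.pderiv_X, Pi.single_apply]
      simp only [Prod.mk.injEq, ← ite_and]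
      refine if_congr ⟨fun h => ⟨?_, h.1.symm⟩, fun h => ⟨h.2.symm, ?_⟩⟩ rfl rfl
      · rw [← h.2, Fin.rev_rev]
      · rw [← h.1, Fin.rev_rev]
    have h2 : (MvPolynomial.pderiv (R := ℂ) (i, l) (MvPolynomial.X (a, m)) : Poly n k) =
        if l = m then if i = a then 1 else 0 else 0 := by
      rw [MvPolynomial.pderiv_X, Pi.single_apply]
      simp only [Prod.mk.injEq, ← ite_and]
      exact if_congr ⟨fun h => ⟨h.2.symm, h.1.symm⟩, fun h => ⟨h.2.symm, h.1.symm⟩⟩ rfl rfl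
    rw [Derivation.leibniz, h1, h2, smul_eq_mul, smul_eq_mul, add_comm]
    congr 1
    · by_cases hm : l = m
      · subst hm; simp
      · simp [hm]
    · by_cases hm : l.rev = m
      · subst hm; simp
      · simp [hm]
  rw [quad, map_sum]
  simp only [h, Finset.sum_add_distrib, Finset.sum_ite_eq, Finset.mem_univ, if_true]

theorem laplace_quad_mul {n k : ℕ} (i j a b : Fin k) (P : Poly n k) :
    laplace i j (quad a b * P) =
      quad a b * laplace i j P + lapBracket mixed i j s(a, b) P := by
  have hlap : ∀ Q : Poly n k, laplace i j Q = ∑ l : Fin n,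
      MvPolynomial.pderiv (i, l) (MvPolynomial.pderiv (j, l.rev) Q) := fun Q => by
    simp [laplace, LinearMap.sum_apply]
  have hpol : ∀ c e : Fin k, (polarization c e) P =
      ∑ l : Fin n, MvPolynomial.X (c, l) * MvPolynomial.pderiv (e, l) P := fun c e => by
    change Derivation.coeFnAddMonoidHom (polarization c e) P = _
    rw [polarization, map_sum, Finset.sum_apply]
    rfl
  have hrev : ∀ c e : Fin k, (polarization c e) P =
      ∑ l : Fin n, MvPolynomial.X (c, l.rev) * MvPolynomial.pderiv (e, l.rev) P := fun c e => by
    rw [hpol, ← Equiv.sum_comp Fin.revPerm]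
    rfl
  have hX : ∀ (c e : Fin k) (l : Fin n), (MvPolynomial.pderiv (R := ℂ) (c, l)
      (MvPolynomial.X (e, l)) : Poly n k) = if e = c then 1 else 0 := fun c e l => by
    rw [MvPolynomial.pderiv_X, Pi.single_apply]
    simp
  have hterm : ∀ l : Fin n,
      MvPolynomial.pderiv (i, l) (MvPolynomial.pderiv (j, l.rev) (quad a b * P)) =
      quad a b * MvPolynomial.pderiv (i, l) (MvPolynomial.pderiv (j, l.rev) P) +
      ((if j = a then MvPolynomial.X (b, l) * MvPolynomial.pderiv (i, l) P +
          (if b = i then P else 0) else 0) +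
        (if j = b then MvPolynomial.X (a, l) * MvPolynomial.pderiv (i, l) P +
          (if a = i then P else 0) else 0) +
        (if i = a then MvPolynomial.X (b, l.rev) * MvPolynomial.pderiv (j, l.rev) P else 0) +
        (if i = b then MvPolynomial.X (a, l.rev) * MvPolynomial.pderiv (j, l.rev) P else 0)) := by
    intro l
    rw [Derivation.leibniz, map_add, smul_eq_mul, smul_eq_mul, Derivation.leibniz,
      Derivation.leibniz, pderiv_quad, pderiv_quad, Fin.rev_rev, map_add]
    simp only [smul_eq_mul, apply_ite (MvPolynomial.pderiv (R := ℂ) (i, l)), map_zero, hX]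
    split_ifs <;> ring
  have hmix : ∀ c e : Fin k, mixed c e P = polarization c e P +
      if c = e then ((n : ℂ) / 2) • P else 0 := fun c e => by
    by_cases h : c = e <;> simp [mixed, h]
  have hbr : lapBracket (mixed (n := n)) i j s(a, b) P =
      lapBracket (fun c e => mixed c e P) i j s(a, b) := by
    simp only [lapBracket, Sym2.lift_mk, LinearMap.add_apply]
    split_ifs <;> rfl
  have hn : (n : Poly n k) * P = ((n : ℂ) / 2) • P + ((n : ℂ) / 2) • P := by
    rw [← add_smul, add_halves, ← nsmul_eq_mul, Nat.cast_smul_eq_nsmul]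
  have hs1 : ∀ (p : Prop) [Decidable p] (F : Fin n → Poly n k),
      ∑ l, (if p then F l else 0) = if p then ∑ l, F l else 0 := fun p _ F => by
    split_ifs <;> simp
  rw [hlap, Finset.sum_congr rfl fun l _ => hterm l, hbr, hlap]
  simp only [Finset.sum_add_distrib, ← Finset.mul_sum, hs1, ← hpol, ← hrev, Finset.sum_const,
    Finset.card_univ, Fintype.card_fin, nsmul_eq_mul, hn, lapBracket, Sym2.lift_mk, hmix]
  congr 1
  simp only [eq_comm (a := i), eq_comm (a := j)]
  split_ifs <;> abel

/-- The action of `h_{ij}` on `S(𝔭⁻) ⊗ F_{σ^♯}`. -/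
def vermaMixed {n k : ℕ} (σ : YoungDiagram) (i j : Fin k) :
    Module.End ℂ (SymPMinus k ⊗[ℂ] glModule n k σ) :=
  TensorProduct.map (adMixed i j).toLinearMap LinearMap.id +
    TensorProduct.map LinearMap.id (mixedF σ i j)

/-- The action of `Δ_{ij}` on `S(𝔭⁻) ⊗ F_{σ^♯}`. In the enveloping algebra, for a polynomial `s` in
the commuting elements `r_z`,
`Δ s = s Δ + ∑_z (∂_z s) [Δ, r_z] + 1/2 ∑_{z,w} (∂_z ∂_w s) [[Δ, r_z], r_w]`,
and `Δ` annihilates `F_{σ^♯}`. See `vermaLaplace_one_tmul` and `vermaLaplace_symVar_mul`, which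
determine this operator uniquely. -/
def vermaLaplace {n k : ℕ} (σ : YoungDiagram) (i j : Fin k) :
    Module.End ℂ (SymPMinus k ⊗[ℂ] glModule n k σ) :=
  ∑ z : Sym2 (Fin k), TensorProduct.map (MvPolynomial.pderiv (R := ℂ) z).toLinearMap
      (lapBracket (mixedF σ) i j z) +
    (1 / 2 : ℂ) • ∑ z : Sym2 (Fin k), ∑ w : Sym2 (Fin k), TensorProduct.map
      (LinearMap.mulLeft ℂ (lapBracket (fun a b => adMixed a b (MvPolynomial.X w)) i j z) ∘ₗ
        (MvPolynomial.pderiv (R := ℂ) z).toLinearMap ∘ₗ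
        (MvPolynomial.pderiv (R := ℂ) w).toLinearMap) LinearMap.id

/-- The action of `r_{ab}` on `S(𝔭⁻) ⊗ F_{σ^♯}`. -/
def vermaQuad {n k : ℕ} (σ : YoungDiagram) (a b : Fin k) :
    Module.End ℂ (SymPMinus k ⊗[ℂ] glModule n k σ) :=
  TensorProduct.map (LinearMap.mulLeft ℂ (symVar a b)) LinearMap.id

theorem vermaLaplace_one_tmul {n k : ℕ} (σ : YoungDiagram) (i j : Fin k) (f : glModule n k σ) :
    vermaLaplace σ i j (1 ⊗ₜ f) = 0 := by
  simp [vermaLaplace, LinearMap.sum_apply]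

theorem lapBracket_adMixed_comm {k : ℕ} (i j : Fin k) (z w : Sym2 (Fin k)) :
    lapBracket (fun a b => adMixed a b (MvPolynomial.X w)) i j z =
      lapBracket (fun a b => adMixed a b (MvPolynomial.X z)) i j w := by
  induction z with | _ a b
  induction w with | _ c e
  have hs : ∀ p q : Fin k, symVar p q = symVar q p := fun p q => by
    simp only [symVar, Sym2.eq_swap]
  simp only [lapBracket, adMixed, MvPolynomial.mkDerivation_X, Sym2.lift_mk]
  rw [hs c a, hs c b, hs e a, hs e b]
  split_ifs <;> abel

theorem sum_derivation_X_mul_pderiv {ι : Type*} [Fintype ι]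
    (D : Derivation ℂ (MvPolynomial ι ℂ) (MvPolynomial ι ℂ)) (s : MvPolynomial ι ℂ) :
    ∑ w, D (MvPolynomial.X w) * MvPolynomial.pderiv w s = D s := by
  classical
  induction s using MvPolynomial.induction_on with
  | C c => simp [← MvPolynomial.algebraMap_eq]
  | add p q hp hq => simp only [map_add, mul_add, Finset.sum_add_distrib, hp, hq]
  | mul_X p v hp =>
    have h : ∀ w, D (MvPolynomial.X w) * MvPolynomial.pderiv w (p * MvPolynomial.X v) =
        (if w = v then p * D (MvPolynomial.X v) else 0) +
          MvPolynomial.X v * (D (MvPolynomial.X w) * MvPolynomial.pderiv w p) := by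
      intro w
      rw [Derivation.leibniz, smul_eq_mul, smul_eq_mul]
      by_cases hw : w = v
      · subst hw
        rw [if_pos rfl, MvPolynomial.pderiv_X_self]
        ring
      · rw [MvPolynomial.pderiv_X_of_ne (Ne.symm hw), if_neg hw]
        ring
    rw [Finset.sum_congr rfl fun w _ => h w, Finset.sum_add_distrib, ← Finset.mul_sum, hp,
      Derivation.leibniz, smul_eq_mul, smul_eq_mul]
    simp

theorem pderiv_X_mul {ι : Type*} [DecidableEq ι] (z c : ι) (s : MvPolynomial ι ℂ) :
    MvPolynomial.pderiv z (MvPolynomial.X c * s) =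
      (if z = c then s else 0) + MvPolynomial.X c * MvPolynomial.pderiv z s := by
  rw [Derivation.leibniz, smul_eq_mul, smul_eq_mul]
  by_cases h : z = c
  · subst h
    rw [if_pos rfl, MvPolynomial.pderiv_X_self]
    ring
  · rw [MvPolynomial.pderiv_X_of_ne (Ne.symm h), if_neg h]
    ring

theorem sum_pderiv_pderiv_X_mul {ι : Type*} [Fintype ι] (B : ι → ι → MvPolynomial ι ℂ)
    (hB : ∀ z w, B z w = B w z) (c : ι) (s : MvPolynomial ι ℂ) :
    ∑ z, ∑ w, B z w * MvPolynomial.pderiv z (MvPolynomial.pderiv w (MvPolynomial.X c * s)) =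
      (2 : ℂ) • ∑ w, B c w * MvPolynomial.pderiv w s + MvPolynomial.X c *
        ∑ z, ∑ w, B z w * MvPolynomial.pderiv z (MvPolynomial.pderiv w s) := by
  classical
  have h : ∀ z w, B z w * MvPolynomial.pderiv z (MvPolynomial.pderiv w (MvPolynomial.X c * s)) =
      (if w = c then B c z * MvPolynomial.pderiv z s else 0) +
      (if z = c then B c w * MvPolynomial.pderiv w s else 0) +
      MvPolynomial.X c * (B z w * MvPolynomial.pderiv z (MvPolynomial.pderiv w s)) := by
    intro z w
    rw [pderiv_X_mul, map_add, pderiv_X_mul]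
    by_cases hw : w = c
    · subst hw
      by_cases hz : z = w
      · subst hz
        simp only [if_true]
        ring
      · simp only [if_true, if_neg hz, hB z w]
        ring
    · by_cases hz : z = c
      · subst hz
        simp only [if_true, if_neg hw, map_zero]
        ring
      · simp only [if_neg hz, if_neg hw, map_zero]
        ring
  simp only [h, Finset.sum_add_distrib, ← Finset.mul_sum]
  congr 1
  rw [two_smul]
  congr 1
  · exact Finset.sum_congr rfl fun z _ => by simp
  · rw [Finset.sum_comm]
    exact Finset.sum_congr rfl fun z _ => by simp

theorem lapBracket_add {k : ℕ} {V : Type*} [AddCommGroup V] (T U : Fin k → Fin k → V)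
    (i j : Fin k) (z : Sym2 (Fin k)) :
    lapBracket (fun a b => T a b + U a b) i j z = lapBracket T i j z + lapBracket U i j z := by
  induction z with | _ a b
  simp only [lapBracket, Sym2.lift_mk]
  split_ifs <;> abel

theorem lapBracket_sum {k : ℕ} {ι V : Type*} [AddCommGroup V] (S : Finset ι)
    (T : ι → Fin k → Fin k → V) (i j : Fin k) (z : Sym2 (Fin k)) :
    lapBracket (fun a b => ∑ w ∈ S, T w a b) i j z = ∑ w ∈ S, lapBracket (T w) i j z := by
  classical
  induction S using Finset.induction_on with
  | empty =>
    induction z with | _ a b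
    simp [lapBracket]
  | insert w S hw ih => simp only [Finset.sum_insert hw, lapBracket_add, ih]

theorem lapBracket_sum_pderiv {k : ℕ} (i j : Fin k) (z : Sym2 (Fin k)) (s : SymPMinus k) :
    ∑ w : Sym2 (Fin k), lapBracket (fun a b => adMixed a b (MvPolynomial.X w)) i j z *
      MvPolynomial.pderiv w s = lapBracket (fun a b => adMixed a b s) i j z := by
  refine (Finset.sum_congr rfl fun w _ => map_lapBracket
    (AddMonoidHom.mulRight (MvPolynomial.pderiv w s)) _ i j z).trans ?_
  rw [← lapBracket_sum]
  congr 1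
  funext a b
  exact sum_derivation_X_mul_pderiv (adMixed a b) s

theorem vermaLaplace_symVar_mul {n k : ℕ} (σ : YoungDiagram) (i j a b : Fin k)
    (u : SymPMinus k ⊗[ℂ] glModule n k σ) :
    vermaLaplace σ i j (vermaQuad σ a b u) =
      vermaQuad σ a b (vermaLaplace σ i j u) + lapBracket (vermaMixed σ) i j s(a, b) u := by
  set c : Sym2 (Fin k) := s(a, b) with hc
  induction u using TensorProduct.induction_on with
  | zero => simp
  | add u v hu hv =>
    have hadd : lapBracket (vermaMixed σ) i j c (u + v) =
        lapBracket (vermaMixed σ) i j c u + lapBracket (vermaMixed σ) i j c v := map_add _ _ _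
    rw [map_add, map_add, hu, hv, map_add, map_add, hadd]
    abel
  | tmul s f =>
    have hL : lapBracket (vermaMixed σ) i j c (s ⊗ₜ[ℂ] f) =
        lapBracket (fun a b => adMixed a b s) i j c ⊗ₜ f +
          s ⊗ₜ lapBracket (mixedF σ) i j c f := by
      have e1 := map_lapBracket (LinearMap.applyₗ (s ⊗ₜ[ℂ] f) :
        Module.End ℂ (SymPMinus k ⊗[ℂ] glModule n k σ) →ₗ[ℂ] _).toAddMonoidHom (vermaMixed σ) i j c
      have e2 := map_lapBracket ((TensorProduct.mk ℂ (SymPMinus k) (glModule n k σ)).flip f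
        ).toAddMonoidHom (fun a b => adMixed a b s) i j c
      have e3 := map_lapBracket (TensorProduct.mk ℂ (SymPMinus k) (glModule n k σ) s ∘ₗ
        LinearMap.applyₗ f).toAddMonoidHom (mixedF σ) i j c
      refine Eq.trans e1 (Eq.trans ?_ (congrArg₂ (fun p q => p + q) e2 e3).symm)
      exact lapBracket_add (fun x y => adMixed x y s ⊗ₜ[ℂ] f)
        (fun x y => s ⊗ₜ[ℂ] mixedF σ x y f) i j c
    have hV : ∀ q : SymPMinus k, vermaLaplace σ i j (q ⊗ₜ f) =
        ∑ z, MvPolynomial.pderiv z q ⊗ₜ lapBracket (mixedF σ) i j z f +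
        (1 / 2 : ℂ) • (∑ z, ∑ w, lapBracket (fun a b => adMixed a b (MvPolynomial.X w)) i j z *
          MvPolynomial.pderiv z (MvPolynomial.pderiv w q)) ⊗ₜ f := by
      intro q
      simp [vermaLaplace, LinearMap.sum_apply, TensorProduct.sum_tmul]
    have hQ : ∀ q : SymPMinus k, ∀ g : glModule n k σ,
        vermaQuad σ a b (q ⊗ₜ[ℂ] g) = (MvPolynomial.X c * q) ⊗ₜ g := fun _ _ => rfl
    have h1 : ∑ z, MvPolynomial.pderiv z (MvPolynomial.X c * s) ⊗ₜ[ℂ]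
          lapBracket (mixedF σ) i j z f =
        s ⊗ₜ lapBracket (mixedF σ) i j c f + vermaQuad σ a b
          (∑ z, MvPolynomial.pderiv z s ⊗ₜ lapBracket (mixedF σ) i j z f) := by
      simp only [pderiv_X_mul, TensorProduct.add_tmul, Finset.sum_add_distrib, map_sum, hQ]
      congr 1
      rw [Finset.sum_eq_single c]
      · rw [if_pos rfl]
      · intro z _ hz
        rw [if_neg hz, TensorProduct.zero_tmul]
      · simp
    have h2 := sum_pderiv_pderiv_X_mul
      (fun z w => lapBracket (fun a b => adMixed a b (MvPolynomial.X w)) i j z)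
      (lapBracket_adMixed_comm i j) c s
    rw [lapBracket_sum_pderiv] at h2
    rw [hQ, hV, h1, h2, hL, hV s, map_add, map_smul, hQ, TensorProduct.add_tmul, smul_add,
      TensorProduct.smul_tmul', smul_smul]
    norm_num
    abel

/-- The projection `π_σ : S(𝔭⁻) ⊗ F_{σ^♯} → 𝓘 ⊗ F_{σ^♯}`. -/
def vermaProj {n k : ℕ} (σ : YoungDiagram) :
    SymPMinus k ⊗[ℂ] glModule n k σ →ₗ[ℂ] invariants n k ⊗[ℂ] glModule n k σ :=
  TensorProduct.map (toInvariants n k).toLinearMap LinearMap.id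

/-! ### The minors -/

/-- The matrix `M^{(n,k)}` with blocks `r`, `x J`, `J xᵀ`, `J`, over a commutative ring in which
values `r i j` and `x i l` of the symbols `r_{ij}` and `x_{il}` are given. -/
def bigMatrix {n k : ℕ} {A : Type*} [CommRing A] (r : Matrix (Fin k) (Fin k) A)
    (x : Matrix (Fin k) (Fin n) A) : Matrix (Fin (k + n)) (Fin (k + n)) A :=
  Matrix.reindex finSumFinEquiv finSumFinEquiv
    (Matrix.fromBlocks r (x * antidiag n A) (antidiag n A * x.transpose) (antidiag n A))

/-- The submatrix `M_{a+1,b+1}` of order `n + 1`. -/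
def windowMatrix {n k : ℕ} {A : Type*} [CommRing A] (r : Matrix (Fin k) (Fin k) A)
    (x : Matrix (Fin k) (Fin n) A) (a b : Fin k) : Matrix (Fin (n + 1)) (Fin (n + 1)) A :=
  (bigMatrix r x).submatrix (fun i => ⟨a + i, by omega⟩) (fun j => ⟨b + j, by omega⟩)

/-- The matrix with first rows `r_{i,t+1}, …, r_{i,n+1}, x_{i,n}, …, x_{i,n+1-t}` for
`i = d+1, …, n+1` and last rows `x_{t+1,l}, …, x_{n+1,l}, 0, …, 0` for `l = n, …, n+1-d`. -/
def displayedMatrix {n : ℕ} {A : Type*} [CommRing A] (r : Matrix (Fin (n + 1)) (Fin (n + 1)) A)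
    (x : Matrix (Fin (n + 1)) (Fin n) A) (d t : Fin (n + 1)) :
    Matrix (Fin (n + 1)) (Fin (n + 1)) A :=
  Matrix.of fun i j =>
    if hi : (d : ℕ) + i < n + 1 then
      if hj : (t : ℕ) + j < n + 1 then r ⟨d + i, hi⟩ ⟨t + j, hj⟩
      else x ⟨d + i, hi⟩ (Fin.rev ⟨t + j - (n + 1), by omega⟩)
    else
      if hj : (t : ℕ) + j < n + 1 then x ⟨t + j, hj⟩ (Fin.rev ⟨d + i - (n + 1), by omega⟩)
      else 0

/-- The symbols `r_{ij} ⊗ 1` in `𝓘 ⊗ 𝓟`. -/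
def rTensor (n k : ℕ) : Matrix (Fin k) (Fin k) (invariants n k ⊗[ℂ] Poly n k) :=
  Matrix.of fun i j => quadInv i j ⊗ₜ 1

/-- The symbols `1 ⊗ x_{il}` in `𝓘 ⊗ 𝓟`. -/
def xTensor (n k : ℕ) : Matrix (Fin k) (Fin n) (invariants n k ⊗[ℂ] Poly n k) :=
  Matrix.of fun i l => 1 ⊗ₜ MvPolynomial.X (i, l)

/-- The symbols `s_{ij} ⊗ 1` in `S(𝔭⁻) ⊗ 𝓟`. -/
def sTensor (n k : ℕ) : Matrix (Fin k) (Fin k) (SymPMinus k ⊗[ℂ] Poly n k) :=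
  Matrix.of fun i j => symVar i j ⊗ₜ 1

/-- The symbols `1 ⊗ x_{il}` in `S(𝔭⁻) ⊗ 𝓟`. -/
def xTensorSym (n k : ℕ) : Matrix (Fin k) (Fin n) (SymPMinus k ⊗[ℂ] Poly n k) :=
  Matrix.of fun i l => 1 ⊗ₜ MvPolynomial.X (i, l)

end SeparationOfVariables

end

noncomputable section

namespace SeparationOfVariables

/-! ### First and second order operators on determinants -/

section Determinants

variable {ι A : Type*} [DecidableEq ι] [CommRing A] [Algebra ℂ A]

/-! Under multiplication `r` becomes `x J xᵀ`, and `M` factors as the column `(x, 1)` times `J`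
times the row `(xᵀ, 1)`, with inner size `n`. So all minors of order `n + 1` go to zero
(`det_windowMatrix_eq_zero`), which puts `D_σ` in the kernel of `φ_σ`. Because `d + t ≤ n`, the
window misses the ones of the block `J`, so this block may be replaced by `0`
(`windowMatrix_eq_hollowMatrix`).

Membership in `𝓘 ⊗ F`: averaging the Leibniz formula over permutations of the last `t` columns and
last `d` rows of the window turns each term into a product of `r`'s, a `t`-minor in the last `t`
columns of `x` and a `d`-minor in the last `d` columns (`det_fromBlocks_mem`). All such products of
minors lie in `F`, since the polarizations move the row indices around (`edgeMinor_mul_mem`). They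
are harmonic because `d + t ≤ n` keeps dual columns apart.

Highest weight: `h_{ij}` acts on the symbols by a simultaneous row and column operation, and windows
are final segments of the indices, so a raising operator duplicates a row or a column. The operator
`Δ_{ij}` has order two on `S(𝔭⁻) ⊗ 𝓟`. In its symbol on two matrix entries, some terms are symmetric
and cancel in the determinant; the others exchange indices and sum to minus the order less one times
a first order expression. The scalar part `n` of `[Δ, r]` compensates this exactly for order `n + 1`
(`secondOrder_det_eq_zero`). The computation is made in the Verma module and carried to `𝓘 ⊗ F` by
the equivariant projection.

Non-vanishing: the two tensor factors can be evaluated at different points, chosen so that the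
window becomes a monomial matrix (`det_window_ne_zero`).

Weight: after adding `n / 2`, the coordinates of `σ^♯ + ρ` are the integers from `-1` to `n + 1`
without `t - 1` and `d`. The map `y ↦ n - y` pairs all positions except `t` and one further `w`
(with `w = t` if `2 d = n`). Hence `Γ` consists of `γ = ε_t + ε_w` alone, and `s_γ` turns `μ = σ^♯ +
ρ` into a permutation of `-μ` (`dominantRep_reflect`). -/

theorem derivation_prod (D : Derivation ℂ A A) (s : Finset ι) (m : ι → A) :
    D (∏ i ∈ s, m i) = ∑ i ∈ s, D (m i) * ∏ j ∈ s.erase i, m j := by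
  induction s using Finset.induction_on with
  | empty => simp
  | insert a s ha ih =>
    rw [Finset.prod_insert ha, Derivation.leibniz, smul_eq_mul, smul_eq_mul, ih,
      Finset.sum_insert ha, Finset.erase_insert ha, Finset.mul_sum, add_comm, mul_comm]
    congr 1
    refine Finset.sum_congr rfl fun i hi => ?_
    have hia : a ≠ i := fun h => ha (h ▸ hi)
    rw [Finset.erase_insert_of_ne hia, Finset.prod_insert (by simp [ha])]
    ring

/-- A second order operator applied to a product. -/
theorem secondOrder_prod {L : A →ₗ[ℂ] A} {B : A → Derivation ℂ A A}
    (hL : ∀ f g, L (f * g) = f * L g + g * L f + B f g) (s : Finset ι) (m : ι → A) :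
    2 * L (∏ i ∈ s, m i) = 2 * ∑ i ∈ s, L (m i) * ∏ j ∈ s.erase i, m j +
      ∑ i ∈ s, ∑ j ∈ s.erase i, B (m i) (m j) * ∏ l ∈ (s.erase i).erase j, m l := by
  have hB : ∀ f g, B f g = B g f := fun f g => by
    have h := hL g f
    rw [mul_comm g f, hL f g] at h
    linear_combination h
  induction s using Finset.induction_on with
  | empty =>
    -- The product rule at `1 · 1` forces `L 1 = 0`: there is no term of order zero.
    have h := hL 1 1
    simp only [mul_one, one_mul, Derivation.map_one_eq_zero, add_zero] at h
    have : L 1 = 0 := by linear_combination -h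
    simp [this]
  | insert a s ha ih =>
    have h1 : ∑ i ∈ s, L (m i) * ∏ j ∈ (insert a s).erase i, m j =
        m a * ∑ i ∈ s, L (m i) * ∏ j ∈ s.erase i, m j := by
      rw [Finset.mul_sum]
      refine Finset.sum_congr rfl fun i hi => ?_
      have hia : a ≠ i := fun h => ha (h ▸ hi)
      rw [Finset.erase_insert_of_ne hia, Finset.prod_insert (by simp [ha])]
      ring
    have h2 : ∑ i ∈ s, ∑ j ∈ (insert a s).erase i,
          B (m i) (m j) * ∏ l ∈ ((insert a s).erase i).erase j, m l =
        ∑ i ∈ s, B (m a) (m i) * ∏ j ∈ s.erase i, m j + m a * ∑ i ∈ s, ∑ j ∈ s.erase i,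
          B (m i) (m j) * ∏ l ∈ (s.erase i).erase j, m l := by
      rw [Finset.mul_sum, ← Finset.sum_add_distrib]
      refine Finset.sum_congr rfl fun i hi => ?_
      have hia : a ≠ i := fun h => ha (h ▸ hi)
      have ha' : a ∉ s.erase i := by simp [ha]
      rw [Finset.erase_insert_of_ne hia, Finset.sum_insert ha', Finset.erase_insert ha', hB,
        Finset.mul_sum]
      congr 1
      refine Finset.sum_congr rfl fun j hj => ?_
      have hja : a ≠ j := fun h => ha' (h ▸ hj)
      rw [Finset.erase_insert_of_ne hja, Finset.prod_insert (by simp [ha])]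
      ring
    rw [Finset.prod_insert ha, hL, Finset.sum_insert ha, Finset.sum_insert ha, h1, h2,
      Finset.erase_insert ha, derivation_prod]
    linear_combination m a * ih

variable [Fintype ι]

theorem derivation_det_updateCol (D : Derivation ℂ A A) (W : Matrix ι ι A) :
    D W.det = ∑ c, (W.updateCol c fun a => D (W a c)).det := by
  simp only [Matrix.det_apply', map_sum]
  rw [Finset.sum_comm]
  refine Finset.sum_congr rfl fun π _ => ?_
  have hs : D ((((Equiv.Perm.sign π : ℤˣ) : ℤ) : A)) = 0 := by
    rw [← map_intCast (algebraMap ℂ A), Derivation.map_algebraMap]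
  rw [Derivation.leibniz, hs, smul_zero, add_zero, smul_eq_mul, derivation_prod, Finset.mul_sum]
  refine Finset.sum_congr rfl fun c _ => ?_
  rw [← Finset.mul_prod_erase _ _ (Finset.mem_univ c), Matrix.updateCol_self]
  congr 2
  refine Finset.prod_congr rfl fun x hx => ?_
  rw [Matrix.updateCol_ne (Finset.ne_of_mem_erase hx)]

/-- A derivation applied to a determinant. -/
theorem derivation_det (D : Derivation ℂ A A) (W : Matrix ι ι A) :
    D W.det = (W.adjugate * W.map D).trace := by
  have h : ∀ c, (W.adjugate * W.map D) c c = (W.updateCol c fun a => D (W a c)).det := by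
    intro c
    rw [← Matrix.cramer_apply, Matrix.cramer_eq_adjugate_mulVec]
    rfl
  simp only [Matrix.trace, Matrix.diag_apply, h, derivation_det_updateCol]

/-- By Jacobi's formula and cyclicity of the trace, an infinitesimal row operation `P` together with
a column operation `Q` scales the determinant by the sum of the traces. -/
theorem derivation_det_of_eq (D : Derivation ℂ A A) (W P Q : Matrix ι ι A)
    (h : W.map D = P * W + W * Q) : D W.det = (P.trace + Q.trace) * W.det := by
  rw [derivation_det, h, Matrix.mul_add, Matrix.trace_add, ← Matrix.mul_assoc, ← Matrix.mul_assoc,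
    Matrix.trace_mul_comm, ← Matrix.mul_assoc, Matrix.mul_adjugate, Matrix.adjugate_mul]
  simp
  ring

/-- The sum over permutations and ordered pairs of columns in which the two entries of `W` in these
columns are replaced by a function of their positions. -/
def detPairSum (W : Matrix ι ι A) (G : ι → ι → ι → ι → A) : A :=
  ∑ π : Equiv.Perm ι, ∑ c, ∑ c' ∈ Finset.univ.erase c, ((Equiv.Perm.sign π : ℤ) : A) *
    (G (π c) c (π c') c' * ∏ x ∈ (Finset.univ.erase c).erase c', W (π x) x)

omit [Algebra ℂ A] in
theorem detPairSum_add (W : Matrix ι ι A) (G H : ι → ι → ι → ι → A) :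
    detPairSum W (fun a b c d => G a b c d + H a b c d) = detPairSum W G + detPairSum W H := by
  simp only [detPairSum, add_mul, mul_add, Finset.sum_add_distrib]

omit [Algebra ℂ A] in
theorem detPairSum_flip (W : Matrix ι ι A) (G : ι → ι → ι → ι → A) :
    detPairSum W G = detPairSum W fun a b c d => G c d a b := by
  unfold detPairSum
  refine Finset.sum_congr rfl fun π _ => ?_
  rw [Finset.sum_comm' (s' := fun c => Finset.univ.erase c) (t' := Finset.univ)
    (by simp [eq_comm])]
  simp only [Finset.erase_right_comm]

omit [Algebra ℂ A] in
-- Composing `π` with the transposition of `c` and `c'` changes the sign, exchanges the rows met by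
-- these two columns and leaves the other factors alone.
theorem detPairSum_rowSwap (W : Matrix ι ι A) (G : ι → ι → ι → ι → A) :
    detPairSum W G = -detPairSum W fun a b c d => G c b a d := by
  unfold detPairSum
  rw [Finset.sum_comm, Finset.sum_comm (s := Finset.univ (α := Equiv.Perm ι)),
    ← Finset.sum_neg_distrib]
  refine Finset.sum_congr rfl fun c _ => ?_
  rw [Finset.sum_comm, Finset.sum_comm (s := Finset.univ (α := Equiv.Perm ι)),
    ← Finset.sum_neg_distrib]
  refine Finset.sum_congr rfl fun c' hc' => ?_
  have hne : c' ≠ c := Finset.ne_of_mem_erase hc'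
  rw [← Equiv.sum_comp (Equiv.mulRight (Equiv.swap c c')), ← Finset.sum_neg_distrib]
  refine Finset.sum_congr rfl fun π _ => ?_
  have hp : ∏ x ∈ (Finset.univ.erase c).erase c', W ((π * Equiv.swap c c') x) x =
      ∏ x ∈ (Finset.univ.erase c).erase c', W (π x) x := by
    refine Finset.prod_congr rfl fun x hx => ?_
    simp only [Finset.mem_erase] at hx
    rw [Equiv.Perm.mul_apply, Equiv.swap_apply_of_ne_of_ne hx.2.1 hx.1]
  rw [Equiv.coe_mulRight, hp, Equiv.Perm.sign_mul, Equiv.Perm.sign_swap hne.symm,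
    Equiv.Perm.mul_apply, Equiv.Perm.mul_apply, Equiv.swap_apply_left, Equiv.swap_apply_right]
  push_cast
  ring

theorem detPairSum_eq_zero_of_rowSwap {W : Matrix ι ι A} {G : ι → ι → ι → ι → A}
    (h : ∀ a b c d, G a b c d = G c b a d) : detPairSum W G = 0 := by
  have h1 := detPairSum_rowSwap W G
  rw [show (fun a b c d => G c b a d) = G by funext a b c d; exact (h a b c d).symm] at h1
  have h2 : (2 : ℂ) • detPairSum W G = 0 := by
    rw [two_smul]
    linear_combination h1
  exact (smul_eq_zero_iff_right (two_ne_zero)).mp h2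

/-- A column exchange is a row exchange followed by a relabelling of the ordered pair, so it
reverses the sign too. -/
theorem detPairSum_eq_zero_of_colSwap {W : Matrix ι ι A} {G : ι → ι → ι → ι → A}
    (h : ∀ a b c d, G a b c d = G a d c b) : detPairSum W G = 0 := by
  have h1 := (detPairSum_rowSwap W G).trans (congrArg Neg.neg (detPairSum_flip W _))
  rw [show (fun a b c d => G a d c b) = G by funext a b c d; exact (h a b c d).symm] at h1
  have h2 : (2 : ℂ) • detPairSum W G = 0 := by
    rw [two_smul]
    linear_combination h1
  exact (smul_eq_zero_iff_right (two_ne_zero)).mp h2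

/-- The sum over permutations and columns in which the entry of `W` at `(a, b)` in this column is
replaced by `p a * q b`. -/
def detSingleSum (W : Matrix ι ι A) (p q : ι → A) : A :=
  ∑ π : Equiv.Perm ι, ∑ c, ((Equiv.Perm.sign π : ℤ) : A) *
    (p (π c) * q c * ∏ x ∈ Finset.univ.erase c, W (π x) x)

omit [Algebra ℂ A] in
-- Once the rows are swapped back, the factor `W` is the original entry of its column and completes
-- the product. The summand then no longer depends on that column, for which one less than the order
-- many choices remain.
theorem detPairSum_exchange (W : Matrix ι ι A) (p q : ι → A) :
    detPairSum W (fun a b c d => p a * q d * W c b) =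
      -((Fintype.card ι - 1 : ℕ) * detSingleSum W p q) := by
  rw [detPairSum_rowSwap, detPairSum_flip]
  congr 1
  unfold detPairSum detSingleSum
  rw [Finset.mul_sum]
  refine Finset.sum_congr rfl fun π _ => ?_
  rw [Finset.mul_sum]
  refine Finset.sum_congr rfl fun c _ => ?_
  have h : ∀ c' ∈ Finset.univ.erase c, ((Equiv.Perm.sign π : ℤ) : A) *
      (p (π c) * q c * W (π c') c' * ∏ x ∈ (Finset.univ.erase c).erase c', W (π x) x) =
      ((Equiv.Perm.sign π : ℤ) : A) *
        (p (π c) * q c * ∏ x ∈ Finset.univ.erase c, W (π x) x) := by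
    intro c' hc'
    rw [← Finset.mul_prod_erase _ _ hc']
    ring
  rw [Finset.sum_congr rfl h, Finset.sum_const, Finset.card_erase_of_mem (Finset.mem_univ c),
    Finset.card_univ, nsmul_eq_mul]

/-- A second order operator whose symbol has the given exchange form kills the determinant if its
first order part is adapted to the size of the matrix. -/
theorem secondOrder_det_eq_zero {L : A →ₗ[ℂ] A} {B : A → Derivation ℂ A A}
    (hL : ∀ f g, L (f * g) = f * L g + g * L f + B f g) (W S T : Matrix ι ι A)
    (hS : ∀ a b, S a b = S b a) (hT : ∀ a b, T a b = T b a) (ri rj ci cj : ι → A)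
    (h1 : ∀ a b, L (W a b) = (Fintype.card ι - 1 : ℕ) * (rj a * ci b + ri a * cj b))
    (h2 : ∀ a b c d, B (W a b) (W c d) =
      (rj a * ri c + ri a * rj c) * S b d + (cj b * ci d + ci b * cj d) * T a c +
      rj a * ci d * W c b + cj b * ri c * W a d + ri a * cj d * W c b + ci b * rj c * W a d) :
    L W.det = 0 := by
  -- The factor 2 is there because ordered pairs of columns count every mixed term twice.
  have key : 2 * L W.det = 2 * ((Fintype.card ι - 1 : ℕ) *
      (detSingleSum W rj ci + detSingleSum W ri cj)) +
      detPairSum W fun a b c d => B (W a b) (W c d) := by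
    have hs : ∀ π : Equiv.Perm ι, ∀ f : A, L (((Equiv.Perm.sign π : ℤ) : A) * f) =
        ((Equiv.Perm.sign π : ℤ) : A) * L f := fun π f => by
      rw [← zsmul_eq_mul, map_zsmul, zsmul_eq_mul]
    simp only [Matrix.det_apply', map_sum, hs, detSingleSum, detPairSum]
    rw [← Finset.sum_add_distrib, Finset.mul_sum, Finset.mul_sum, Finset.mul_sum,
      ← Finset.sum_add_distrib]
    refine Finset.sum_congr rfl fun π _ => ?_
    rw [mul_left_comm, secondOrder_prod hL, mul_add, mul_left_comm, ← Finset.sum_add_distrib]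
    simp only [Finset.mul_sum]
    congr 1
    refine Finset.sum_congr rfl fun c _ => ?_
    rw [h1]
    ring
  have hpair : detPairSum W (fun a b c d => B (W a b) (W c d)) = -(2 *
      ((Fintype.card ι - 1 : ℕ) * (detSingleSum W rj ci + detSingleSum W ri cj))) := by
    simp only [h2]
    -- The term with `S` is symmetric in the columns and the term with `T` in the rows, so both
    -- vanish. The four exchange terms form two equal pairs.
    rw [detPairSum_add, detPairSum_add, detPairSum_add, detPairSum_add, detPairSum_add,
      detPairSum_eq_zero_of_colSwap, detPairSum_eq_zero_of_rowSwap,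
      detPairSum_flip W (fun a b c d => cj b * ri c * W a d),
      detPairSum_flip W (fun a b c d => ci b * rj c * W a d)]
    · simp only [mul_comm (cj _) (ri _), mul_comm (ci _) (rj _), detPairSum_exchange]
      ring
    · intro a b c d
      rw [hT]
    · intro a b c d
      rw [hS]
  rw [hpair, add_neg_cancel] at key
  have h3 : (2 : ℂ) • L W.det = 0 := by
    rw [two_smul]
    linear_combination key
  exact (smul_eq_zero_iff_right (two_ne_zero)).mp h3

end Determinants

/-! ### Minors in the last columns -/

section EdgeMinors

variable {n k m t d : ℕ}

/-- The matrix with columns `(x_{a_p, n}, x_{a_p, n-1}, …, x_{a_p, n+1-m})`. -/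
def edgeMatrix (k : ℕ) (hm : m ≤ n) (a : Fin m → Fin k) : Matrix (Fin m) (Fin m) (Poly n k) :=
  Matrix.of fun q p => MvPolynomial.X (a p, (Fin.castLE hm q).rev)

/-- The minor formed by the rows `a` and the last `m` columns of the variable matrix. -/
def edgeMinor (hm : m ≤ n) (a : Fin m → Fin k) : Poly n k := (edgeMatrix k hm a).det

theorem edgeMatrix_updateCol (hm : m ≤ n) (a : Fin m → Fin k) (p : Fin m) (i : Fin k) :
    (edgeMatrix k hm a).updateCol p (fun q => MvPolynomial.X (i, (Fin.castLE hm q).rev)) =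
      edgeMatrix k hm (Function.update a p i) := by
  ext q c : 1
  by_cases h : c = p
  · subst h
    simp [edgeMatrix]
  · simp [edgeMatrix, Matrix.updateCol_ne h, Function.update_of_ne h]

theorem edgeMinor_eq_zero (hm : m ≤ n) {a : Fin m → Fin k} (ha : ¬ Function.Injective a) :
    edgeMinor hm a = 0 := by
  simp only [Function.Injective, not_forall] at ha
  obtain ⟨p, q, h, hpq⟩ := ha
  exact Matrix.det_zero_of_column_eq hpq fun l => by simp [edgeMatrix, h]

theorem edgeMinor_perm (hm : m ≤ n) (a : Fin m → Fin k) (τ : Equiv.Perm (Fin m)) :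
    edgeMinor hm (a ∘ τ) = ((Equiv.Perm.sign τ : ℤ) : Poly n k) * edgeMinor hm a :=
  Matrix.det_permute' τ (edgeMatrix k hm a)

theorem polarization_edgeMinor (hm : m ≤ n) (a : Fin m → Fin k) (i j : Fin k) :
    polarization i j (edgeMinor hm a) =
      ∑ p, if a p = j then edgeMinor hm (Function.update a p i) else 0 := by
  rw [edgeMinor, derivation_det_updateCol]
  refine Finset.sum_congr rfl fun p _ => ?_
  simp only [edgeMatrix, Matrix.of_apply, polarization_X]
  by_cases h : a p = j
  · simp only [h, if_true]
    rw [edgeMinor, ← edgeMatrix_updateCol]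
    rfl
  · simp only [h, if_false]
    exact Matrix.det_eq_zero_of_column_eq_zero p fun q => by simp

theorem polarization_edgeMinor_apply (hm : m ≤ n) {a : Fin m → Fin k}
    (ha : Function.Injective a) (i : Fin k) (p : Fin m) :
    polarization i (a p) (edgeMinor hm a) = edgeMinor hm (Function.update a p i) := by
  rw [polarization_edgeMinor, Finset.sum_eq_single p]
  · simp
  · intro q _ hq
    rw [if_neg (ha.ne hq)]
  · simp

theorem polarization_edgeMinor_of_notMem (hm : m ≤ n) {a : Fin m → Fin k} (i : Fin k) {j : Fin k}
    (hj : j ∉ Set.range a) : polarization i j (edgeMinor hm a) = 0 := by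
  rw [polarization_edgeMinor]
  exact Finset.sum_eq_zero fun p _ => if_neg fun h => hj ⟨p, h⟩

/-- The exchange relation for two minors. -/
theorem edgeMinor_exchange (ht : t ≤ n) (hd : d ≤ n) (htd : t ≤ d) (a : Fin t → Fin k)
    (b : Fin d → Fin k) (p : Fin t) :
    edgeMinor ht a * edgeMinor hd b = ∑ q, edgeMinor ht (Function.update a p (b q)) *
      edgeMinor hd (Function.update b q (a p)) := by
  set U := edgeMatrix k ht a with hU
  set V := edgeMatrix k hd b with hV
  have hc : ∀ q, edgeMinor hd (Function.update b q (a p)) =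
      V.cramer (fun l => MvPolynomial.X (a p, (Fin.castLE hd l).rev)) q := fun q => by
    rw [Matrix.cramer_apply, hV, edgeMatrix_updateCol, edgeMinor]
  have hu : ∀ i, edgeMinor ht (Function.update a p i) =
      U.cramer (fun l => MvPolynomial.X (i, (Fin.castLE ht l).rev)) p := fun i => by
    rw [Matrix.cramer_apply, hU, edgeMatrix_updateCol, edgeMinor]
  have ha : edgeMinor ht a = edgeMinor ht (Function.update a p (a p)) := by
    rw [Function.update_eq_self]
  have hV' := Matrix.mulVec_cramer V fun l => MvPolynomial.X (a p, (Fin.castLE hd l).rev)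
  -- Cramer's rule for `V` expands the vector of the row `a p` in those of the rows `b q`. As `t ≤
  -- d`, the identity restricts to the coordinates of the smaller minor and can be substituted into
  -- column `p` of `U`.
  have key : V.det • (fun l : Fin t => (MvPolynomial.X (a p, (Fin.castLE ht l).rev) : Poly n k)) =
      ∑ q, V.cramer (fun l => MvPolynomial.X (a p, (Fin.castLE hd l).rev)) q •
        fun l : Fin t => (MvPolynomial.X (b q, (Fin.castLE ht l).rev) : Poly n k) := by
    funext l
    have := congrFun hV' (Fin.castLE htd l)
    simp only [Pi.smul_apply, smul_eq_mul] at this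
    simp only [Pi.smul_apply, smul_eq_mul, Finset.sum_apply]
    refine this.symm.trans ?_
    rw [Matrix.mulVec, dotProduct]
    exact Finset.sum_congr rfl fun q _ => mul_comm _ _
  have h2 := congrFun (congrArg U.cramer key) p
  simp only [map_smul, map_sum, Pi.smul_apply, Finset.sum_apply, smul_eq_mul] at h2
  rw [ha, hu, mul_comm]
  refine h2.trans (Finset.sum_congr rfl fun q _ => ?_)
  rw [hc, hu, mul_comm]

variable {W : Submodule ℂ (Poly n k)}

/-- For `p ≥ t` only the larger minor contains the row `b p`, and one polarization replaces it by
`i`. For `p < t` both minors contain it; the square of the polarization replaces it in both and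
produces the factor 2, the other terms being zero. -/
theorem edgeMinor_mul_mem_update (hW : ∀ i j, ∀ P ∈ W, polarization i j P ∈ W) (ht : t ≤ n)
    (hd : d ≤ n) (htd : t ≤ d) {b : Fin d → Fin k} (hb : Function.Injective b) {i : Fin k}
    (hi : i ∉ Set.range b) (p : Fin d)
    (h : edgeMinor ht (b ∘ Fin.castLE htd) * edgeMinor hd b ∈ W) :
    edgeMinor ht (Function.update b p i ∘ Fin.castLE htd) *
      edgeMinor hd (Function.update b p i) ∈ W := by
  have hb' : Function.Injective (b ∘ Fin.castLE htd) := hb.comp (Fin.castLE_injective htd)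
  have hip : b p ≠ i := fun h => hi ⟨p, h⟩
  have hnot : b p ∉ Set.range (Function.update b p i) := by
    rintro ⟨q, hq⟩
    by_cases hqp : q = p
    · subst hqp
      rw [Function.update_self] at hq
      exact hip hq.symm
    · rw [Function.update_of_ne hqp] at hq
      exact hqp (hb hq)
  have hE := hW i (b p) _ h
  rw [Derivation.leibniz, polarization_edgeMinor_apply hd hb, smul_eq_mul, smul_eq_mul] at hE
  by_cases hp : (p : ℕ) < t
  · have hpp : p = Fin.castLE htd ⟨p, hp⟩ := rfl
    have hup : Function.update b p i ∘ Fin.castLE htd =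
        Function.update (b ∘ Fin.castLE htd) ⟨p, hp⟩ i := by
      funext q
      by_cases hq : q = ⟨p, hp⟩
      · subst hq
        simp
      · have : Fin.castLE htd q ≠ p := fun h => hq (by ext; simp [← h])
        simp [Function.update_of_ne hq, Function.update_of_ne this]
    have e1 : polarization i (b p) (edgeMinor ht (b ∘ Fin.castLE htd)) =
        edgeMinor ht (Function.update b p i ∘ Fin.castLE htd) := by
      rw [hup, ← polarization_edgeMinor_apply ht hb']
      rfl
    have e2 : polarization i (b p) (edgeMinor ht (Function.update b p i ∘ Fin.castLE htd)) = 0 :=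
      polarization_edgeMinor_of_notMem ht i fun h => hnot (Set.range_comp_subset_range _ _ h)
    rw [e1] at hE
    have hE2 := hW i (b p) _ hE
    rw [map_add, Derivation.leibniz, Derivation.leibniz, polarization_edgeMinor_apply hd hb, e1, e2,
      polarization_edgeMinor_of_notMem hd i hnot] at hE2
    have h3 := W.smul_mem (1 / 2 : ℂ) hE2
    convert h3 using 1
    simp only [smul_eq_mul, mul_zero, zero_add]
    rw [mul_comm (edgeMinor hd _), ← two_smul ℂ, smul_smul]
    norm_num
  · have hup : Function.update b p i ∘ Fin.castLE htd = b ∘ Fin.castLE htd := by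
      funext q
      have : Fin.castLE htd q ≠ p := fun h => hp (by rw [← h]; exact q.2)
      simp [Function.update_of_ne this]
    have e1 : polarization i (b p) (edgeMinor ht (b ∘ Fin.castLE htd)) = 0 := by
      refine polarization_edgeMinor_of_notMem ht i ?_
      rintro ⟨q, hq⟩
      exact hp (by rw [← hb hq]; exact q.2)
    rw [e1, mul_zero, add_zero] at hE
    rwa [hup]

/-- Replacing an entry by an unused row is reversible, so `b` can be transformed into `b₀` step by
step. The induction is on the number of positions where they differ; `d < k` guarantees an unused
row. -/
theorem edgeMinor_mul_mem_of_injective (hW : ∀ i j, ∀ P ∈ W, polarization i j P ∈ W) (ht : t ≤ n)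
    (hd : d ≤ n) (htd : t ≤ d) (hdk : d < k) {b₀ : Fin d → Fin k} (hb₀ : Function.Injective b₀)
    (h₀ : edgeMinor ht (b₀ ∘ Fin.castLE htd) * edgeMinor hd b₀ ∈ W) :
    ∀ b : Fin d → Fin k, Function.Injective b →
      edgeMinor ht (b ∘ Fin.castLE htd) * edgeMinor hd b ∈ W := by
  have hinj : ∀ (b : Fin d → Fin k) (p : Fin d) (i : Fin k), Function.Injective b →
      i ∉ Set.range b → Function.Injective (Function.update b p i) := by
    intro b p i hb hi q r hqr
    by_cases hq : q = p <;> by_cases hr : r = p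
    · rw [hq, hr]
    · subst hq
      rw [Function.update_self, Function.update_of_ne hr] at hqr
      exact absurd ⟨r, hqr.symm⟩ hi
    · subst hr
      rw [Function.update_self, Function.update_of_ne hq] at hqr
      exact absurd ⟨q, hqr⟩ hi
    · rw [Function.update_of_ne hq, Function.update_of_ne hr] at hqr
      exact hb hqr
  have hback : ∀ (b : Fin d → Fin k) (p : Fin d) (i : Fin k), Function.Injective b →
      i ∉ Set.range b → edgeMinor ht (Function.update b p i ∘ Fin.castLE htd) *
        edgeMinor hd (Function.update b p i) ∈ W →
      edgeMinor ht (b ∘ Fin.castLE htd) * edgeMinor hd b ∈ W := by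
    intro b p i hb hi h
    have hnot : b p ∉ Set.range (Function.update b p i) := by
      rintro ⟨q, hq⟩
      by_cases hqp : q = p
      · subst hqp
        rw [Function.update_self] at hq
        exact hi ⟨q, hq.symm⟩
      · rw [Function.update_of_ne hqp] at hq
        exact hqp (hb hq)
    have := edgeMinor_mul_mem_update hW ht hd htd (hinj b p i hb hi) hnot p h
    simpa using this
  have main : ∀ (N : ℕ) (b : Fin d → Fin k), Function.Injective b →
      (Finset.univ.filter fun p => b p ≠ b₀ p).card = N →
      edgeMinor ht (b ∘ Fin.castLE htd) * edgeMinor hd b ∈ W := by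
    intro N
    induction N using Nat.strong_induction_on with
    | _ N ih =>
      intro b hb hN
      by_cases hall : b = b₀
      · rwa [hall]
      obtain ⟨p, hp⟩ := Function.ne_iff.mp hall
      have hcard : ∀ c : Fin d → Fin k, (∀ q, b q = b₀ q → c q = b₀ q) → c p = b₀ p →
          (Finset.univ.filter fun p => c p ≠ b₀ p).card < N := by
        intro c hc hcp
        rw [← hN]
        refine Finset.card_lt_card (Finset.ssubset_iff_of_subset ?_ |>.mpr ⟨p, ?_, ?_⟩)
        · intro q
          simp only [Finset.mem_filter, Finset.mem_univ, true_and]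
          exact fun h h' => h (hc q h')
        · simpa using hp
        · simpa using hcp
      by_cases hr : b₀ p ∈ Set.range b
      · obtain ⟨q, hq⟩ := hr
        have hqp : q ≠ p := fun h => hp (h ▸ hq)
        -- The wanted value `b₀ p` is occupied at position `q`. That entry is parked at the unused
        -- row `e`; no agreement with `b₀` is lost, since `b₀ q ≠ b₀ p`.
        obtain ⟨e, he⟩ : ∃ e, e ∉ Set.range b := by
          by_contra! hsurj
          have := Fintype.card_le_of_surjective b hsurj
          simp at this
          omega
        have hne : e ≠ b₀ p := fun h => he ⟨q, hq.trans h.symm⟩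
        refine hback b q e hb he ?_
        have hb1 := hinj b q e hb he
        have hnot : b₀ p ∉ Set.range (Function.update b q e) := by
          rintro ⟨r, hr⟩
          by_cases hrq : r = q
          · subst hrq
            rw [Function.update_self] at hr
            exact hne hr
          · rw [Function.update_of_ne hrq] at hr
            exact hrq (hb (hr.trans hq.symm))
        refine hback _ p (b₀ p) hb1 hnot (ih _ (hcard _ ?_ ?_) _ (hinj _ p _ hb1 hnot) rfl)
        · intro r hr
          by_cases hrp : r = p
          · subst hrp
            exact Function.update_self ..
          have hrq : r ≠ q := by
            rintro rfl
            exact hqp (hb₀ (hr.symm.trans hq))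
          rw [Function.update_of_ne hrp, Function.update_of_ne hrq, hr]
        · exact Function.update_self ..
      · refine hback b p (b₀ p) hb hr (ih _ (hcard _ ?_ ?_) _ (hinj b p _ hb hr) rfl)
        · intro r hr
          by_cases hrp : r = p
          · subst hrp
            exact Function.update_self ..
          rw [Function.update_of_ne hrp, hr]
        · exact Function.update_self ..
  exact fun b hb => main _ b hb rfl

/-- Reordering `b` so that it begins with `a` changes the larger minor only by a sign. -/
theorem edgeMinor_mul_mem_of_range_subset (ht : t ≤ n) (hd : d ≤ n) (htd : t ≤ d)
    (h : ∀ b : Fin d → Fin k, Function.Injective b →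
      edgeMinor ht (b ∘ Fin.castLE htd) * edgeMinor hd b ∈ W)
    {a : Fin t → Fin k} {b : Fin d → Fin k} (ha : Function.Injective a)
    (hb : Function.Injective b) (hab : ∀ p, a p ∈ Set.range b) :
    edgeMinor ht a * edgeMinor hd b ∈ W := by
  choose f hf using hab
  have hfi : Function.Injective f := fun p q hpq => ha (by rw [← hf p, ← hf q, hpq])
  obtain ⟨τ, hτ⟩ : ∃ τ : Equiv.Perm (Fin d), ∀ p, τ (Fin.castLE htd p) = f p := by
    let e : {x // x ∈ Set.range (Fin.castLE htd)} ≃ {x // x ∈ Set.range f} :=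
      (Equiv.ofInjective _ (Fin.castLE_injective htd)).symm.trans (Equiv.ofInjective f hfi)
    classical
    refine ⟨e.extendSubtype, fun p => ?_⟩
    rw [e.extendSubtype_apply_of_mem _ ⟨p, rfl⟩]
    change ((Equiv.ofInjective f hfi) ((Equiv.ofInjective _ (Fin.castLE_injective htd)).symm
      ⟨Fin.castLE htd p, ⟨p, rfl⟩⟩) : Fin d) = f p
    have : (Equiv.ofInjective _ (Fin.castLE_injective htd)).symm
      ⟨Fin.castLE htd p, ⟨p, rfl⟩⟩ = p := by
      rw [Equiv.symm_apply_eq]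
      rfl
    rw [this]
    rfl
  have h1 := h (b ∘ τ) (hb.comp τ.injective)
  have h2 : (b ∘ τ) ∘ Fin.castLE htd = a := by
    funext p
    simp [hτ, hf]
  rw [h2, edgeMinor_perm] at h1
  rcases Int.units_eq_one_or (Equiv.Perm.sign τ) with hs | hs <;> rw [hs] at h1
  · simpa using h1
  · simpa using h1

/-- Induction on the number of entries of `a` outside `b`. Let `a p` be one of them. For each `q`
with `b q` not in `a`, the induction hypothesis applies after replacing `a p` by `b q`; polarizing
back gives the `q`-th term of the exchange relation plus the product itself. For the other `q` the
exchange term is zero. Summing over `q`, a positive integer multiple of the product lies in `W`. -/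
theorem edgeMinor_mul_mem (hW : ∀ i j, ∀ P ∈ W, polarization i j P ∈ W) (ht : t ≤ n)
    (hd : d ≤ n) (htd : t ≤ d) (hdk : d < k) {b₀ : Fin d → Fin k} (hb₀ : Function.Injective b₀)
    (h₀ : edgeMinor ht (b₀ ∘ Fin.castLE htd) * edgeMinor hd b₀ ∈ W) (a : Fin t → Fin k)
    (b : Fin d → Fin k) : edgeMinor ht a * edgeMinor hd b ∈ W := by
  by_cases hb : Function.Injective b
  swap
  · rw [edgeMinor_eq_zero hd hb, mul_zero]
    exact W.zero_mem
  classical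
  have main : ∀ (N : ℕ) (a : Fin t → Fin k),
      (Finset.univ.filter fun p => a p ∉ Set.range b).card = N →
      edgeMinor ht a * edgeMinor hd b ∈ W := by
    intro N
    induction N using Nat.strong_induction_on with
    | _ N ih =>
      intro a hN
      by_cases ha : Function.Injective a
      swap
      · rw [edgeMinor_eq_zero ht ha, zero_mul]
        exact W.zero_mem
      by_cases hall : ∀ p, a p ∈ Set.range b
      · exact edgeMinor_mul_mem_of_range_subset ht hd htd
          (edgeMinor_mul_mem_of_injective hW ht hd htd hdk hb₀ h₀) ha hb hall
      push Not at hall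
      obtain ⟨p, hp⟩ := hall
      have hq : ∀ q, edgeMinor ht (Function.update a p (b q)) *
          edgeMinor hd (Function.update b q (a p)) +
          (if b q ∈ Set.range a then 0 else 1 : ℂ) • (edgeMinor ht a * edgeMinor hd b) ∈ W := by
        intro q
        by_cases hqa : b q ∈ Set.range a
        · obtain ⟨r, hr⟩ := hqa
          have hrp : r ≠ p := by
            rintro rfl
            exact hp ⟨q, hr.symm⟩
          rw [edgeMinor_eq_zero ht, zero_mul, if_pos ⟨r, hr⟩, zero_smul, add_zero]
          · exact W.zero_mem
          · intro hinj
            refine hrp (hinj ?_)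
            rw [Function.update_self, Function.update_of_ne hrp, hr]
        · have hinj : Function.Injective (Function.update a p (b q)) := by
            intro x y hxy
            by_cases hx : x = p <;> by_cases hy : y = p
            · rw [hx, hy]
            · subst hx
              rw [Function.update_self, Function.update_of_ne hy] at hxy
              exact absurd ⟨y, hxy.symm⟩ hqa
            · subst hy
              rw [Function.update_self, Function.update_of_ne hx] at hxy
              exact absurd ⟨x, hxy⟩ hqa
            · rw [Function.update_of_ne hx, Function.update_of_ne hy] at hxy
              exact ha hxy
          have hlt : (Finset.univ.filter fun r =>
              Function.update a p (b q) r ∉ Set.range b).card < N := by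
            rw [← hN]
            refine Finset.card_lt_card (Finset.ssubset_iff_of_subset ?_ |>.mpr ⟨p, ?_, ?_⟩)
            · intro r
              simp only [Finset.mem_filter, Finset.mem_univ, true_and]
              by_cases hrp : r = p
              · subst hrp
                exact fun _ => hp
              · rw [Function.update_of_ne hrp]
                exact id
            · simpa using hp
            · simp
          have h1 := hW (a p) (b q) _ (ih _ hlt _ rfl)
          have e1 : polarization (a p) (b q) (edgeMinor ht (Function.update a p (b q))) =
              edgeMinor ht a := by
            have := polarization_edgeMinor_apply ht hinj (a p) p
            simpa using this
          rw [Derivation.leibniz, e1, polarization_edgeMinor_apply hd hb, smul_eq_mul, smul_eq_mul,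
            mul_comm (edgeMinor hd b)] at h1
          rwa [if_neg hqa, one_smul]
      have hsum := W.sum_mem fun q (_ : q ∈ Finset.univ) => hq q
      rw [Finset.sum_add_distrib, ← edgeMinor_exchange ht hd htd a b p, ← Finset.sum_smul,
        show ∀ (c : ℂ) (P : Poly n k), P + c • P = (1 + c) • P from fun c P => by
          rw [add_smul, one_smul]] at hsum
      refine (W.smul_mem_iff ?_).mp hsum
      have : (∑ q, if b q ∈ Set.range a then 0 else 1 : ℂ) =
          ((∑ q, if b q ∈ Set.range a then 0 else 1 : ℕ) : ℂ) := by
        push_cast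
        rfl
      rw [this, add_comm]
      exact Nat.cast_add_one_ne_zero _
  exact main _ a rfl

end EdgeMinors

/-! ### The module `F_{σ^♯}` is spanned by products of minors -/

section GlModule

variable {n k m t d : ℕ}

theorem laplace_apply (i j : Fin k) (P : Poly n k) : laplace i j P = ∑ l : Fin n,
    MvPolynomial.pderiv (i, l) (MvPolynomial.pderiv (j, l.rev) P) := by
  simp [laplace, LinearMap.sum_apply]

/-- The bilinear symbol of `Δ_{ij}`. -/
def laplaceSymbol (i j : Fin k) (f : Poly n k) : Derivation ℂ (Poly n k) (Poly n k) :=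
  ∑ l : Fin n, (MvPolynomial.pderiv (i, l) f • MvPolynomial.pderiv (R := ℂ) (j, l.rev) +
    MvPolynomial.pderiv (j, l.rev) f • MvPolynomial.pderiv (R := ℂ) (i, l))

theorem laplaceSymbol_apply (i j : Fin k) (f g : Poly n k) : laplaceSymbol i j f g =
    ∑ l : Fin n, (MvPolynomial.pderiv (i, l) f * MvPolynomial.pderiv (j, l.rev) g +
      MvPolynomial.pderiv (j, l.rev) f * MvPolynomial.pderiv (i, l) g) := by
  change Derivation.coeFnAddMonoidHom (laplaceSymbol i j f) g = _
  rw [laplaceSymbol, map_sum, Finset.sum_apply]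
  rfl

theorem laplace_mul (i j : Fin k) (f g : Poly n k) :
    laplace i j (f * g) = f * laplace i j g + g * laplace i j f + laplaceSymbol i j f g := by
  simp only [laplace_apply, laplaceSymbol_apply, Finset.mul_sum, ← Finset.sum_add_distrib]
  refine Finset.sum_congr rfl fun l _ => ?_
  simp only [Derivation.leibniz, map_add, smul_eq_mul]
  ring

theorem pderiv_X_eq (p q : Fin k × Fin n) :
    (MvPolynomial.pderiv (R := ℂ) p (MvPolynomial.X q) : Poly n k) =
      if p.1 = q.1 ∧ p.2 = q.2 then 1 else 0 := by
  rw [MvPolynomial.pderiv_X, Pi.single_apply]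
  exact if_congr (by rw [Prod.ext_iff, eq_comm, @eq_comm _ q.2]) rfl rfl

/-- A degenerate case of the determinant criterion: there is no first order part, and the symbol
only contains the form `J` on two columns of `x`, which is symmetric. -/
theorem laplace_edgeMinor (hm : m ≤ n) (a : Fin m → Fin k) (i j : Fin k) :
    laplace i j (edgeMinor hm a) = 0 := by
  refine secondOrder_det_eq_zero (B := laplaceSymbol i j) (laplace_mul i j) _ 0
    (Matrix.of fun p q : Fin m => if (Fin.castLE hm p).rev = Fin.castLE hm q then 1 else 0)
    (fun _ _ => rfl) (fun p q => ?_) 0 0 (fun p => if i = a p then 1 else 0)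
    (fun p => if j = a p then 1 else 0) (fun p q => ?_) (fun p q p' q' => ?_)
  · simp only [Matrix.of_apply]
    refine if_congr ⟨fun h => ?_, fun h => ?_⟩ rfl rfl
    · rw [← h, Fin.rev_rev]
    · rw [← h, Fin.rev_rev]
  · rw [edgeMatrix, Matrix.of_apply, laplace_apply]
    rw [Finset.sum_eq_zero fun l _ => ?_]
    · simp
    · rw [pderiv_X_eq]
      split_ifs <;> simp
  · simp only [edgeMatrix, Matrix.of_apply, laplaceSymbol_apply, pderiv_X_eq, Finset.sum_add_distrib,
      ite_and, Pi.zero_apply, zero_mul, mul_zero, add_zero, zero_add, add_mul]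
    rw [Finset.sum_eq_single (Fin.castLE hm p).rev, Finset.sum_eq_single (Fin.castLE hm p)]
    · simp only [Fin.rev_rev, if_true]
      have e : (Fin.castLE hm p = (Fin.castLE hm p').rev) =
          ((Fin.castLE hm p).rev = Fin.castLE hm p') := by
        rw [← Fin.rev_eq_iff]
      simp only [e]
      split_ifs <;> simp_all
    · intro l _ hl
      simp [Fin.rev_inj, hl]
    · simp
    · intro l _ hl
      simp [hl]
    · simp

theorem pderiv_edgeMinor_eq_zero (hm : m ≤ n) (a : Fin m → Fin k) (i : Fin k) {l : Fin n}
    (hl : ∀ q, (Fin.castLE hm q).rev ≠ l) : MvPolynomial.pderiv (i, l) (edgeMinor hm a) = 0 := by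
  rw [edgeMinor, derivation_det_updateCol]
  refine Finset.sum_eq_zero fun p _ => Matrix.det_eq_zero_of_column_eq_zero p fun q => ?_
  rw [Matrix.updateCol_self, edgeMatrix, Matrix.of_apply, pderiv_X_eq, if_neg]
  exact fun h => hl q h.2.symm

/-- The cross terms pair column `l` of one minor with column `l.rev` of the other. The minors
involve only the last `t` and the last `d` columns, and dual columns cannot both occur when `d + t ≤
n`. -/
theorem laplace_edgeMinor_mul (ht : t ≤ n) (hd : d ≤ n) (h : d + t ≤ n) (a : Fin t → Fin k)
    (b : Fin d → Fin k) (i j : Fin k) : laplace i j (edgeMinor ht a * edgeMinor hd b) = 0 := by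
  have key : ∀ (l : Fin n) (i j : Fin k), MvPolynomial.pderiv (i, l) (edgeMinor ht a) *
      MvPolynomial.pderiv (j, l.rev) (edgeMinor hd b) = 0 := by
    intro l i j
    by_cases hl : (l.rev : ℕ) < t
    · rw [pderiv_edgeMinor_eq_zero hd, mul_zero]
      intro q hq
      have h1 := Fin.rev_injective hq
      have h2 := q.2
      have h3 := congrArg Fin.val h1
      have h4 := Fin.val_rev l
      simp only [Fin.val_castLE] at h3
      omega
    · rw [pderiv_edgeMinor_eq_zero ht, zero_mul]
      rintro q rfl
      rw [Fin.rev_rev] at hl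
      exact hl q.2
  rw [laplace_mul, laplace_edgeMinor, laplace_edgeMinor, mul_zero, mul_zero, add_zero, zero_add,
    laplaceSymbol_apply]
  refine Finset.sum_eq_zero fun l _ => ?_
  have h2 := key l.rev j i
  rw [Fin.rev_rev] at h2
  rw [key, h2, add_zero]

theorem prod_cornerMinor_pow (hm : m ≤ n) (hk : m ≤ k) :
    ∏ j : Fin (min n k), cornerMinor n k j ^ (if (j : ℕ) + 1 = m then 1 else 0) =
      edgeMinor hm fun p => (Fin.castLE hk p).rev := by
  rcases m with _ | m
  · simp [edgeMinor]
  have hmin : m < min n k := by omega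
  rw [Finset.prod_eq_single (⟨m, hmin⟩ : Fin (min n k))]
  -- The corner minor lists rows and columns upwards and the edge minor lists them downwards,
  -- transposed; reversing both orders leaves the determinant unchanged.
  · rw [if_pos rfl, pow_one, cornerMinor, edgeMinor, ← Matrix.det_transpose,
      ← Matrix.det_submatrix_equiv_self Fin.revPerm]
    congr 1
    ext p q : 1
    simp only [Matrix.submatrix_apply, Matrix.transpose_apply, Matrix.of_apply, edgeMatrix,
      Fin.revPerm_apply]
    refine congrArg (MvPolynomial.X (R := ℂ)) (Prod.ext (Fin.ext ?_) (Fin.ext ?_)) <;>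
      simp only [Fin.val_rev, Fin.val_castLE] <;> omega
  · intro j _ hj
    rw [if_neg, pow_zero]
    exact fun h => hj (Fin.ext (by simpa using h))
  · simp

theorem rowLen_eq {σ : YoungDiagram} (h2 : σ.rowLen 0 ≤ 2) (ht : σ.colLen 1 = t)
    (hd : σ.colLen 0 = d) (j : ℕ) :
    σ.rowLen j = (if j < t then 1 else 0) + if j < d then 1 else 0 := by
  have h0 : 0 < σ.rowLen j ↔ j < d := by
    rw [← YoungDiagram.mem_iff_lt_rowLen, YoungDiagram.mem_iff_lt_colLen, hd]
  have h1 : 1 < σ.rowLen j ↔ j < t := by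
    rw [← YoungDiagram.mem_iff_lt_rowLen, YoungDiagram.mem_iff_lt_colLen, ht]
  have h3 := σ.rowLen_anti 0 j (Nat.zero_le j)
  split_ifs <;> omega

/-- The rows `k, k - 1, …, k + 1 - m`. -/
def lastRows (hk : m ≤ k) : Fin m → Fin k := fun p => (Fin.castLE hk p).rev

theorem hwHarmonic_eq {σ : YoungDiagram} (h2 : σ.rowLen 0 ≤ 2) (ht : σ.colLen 1 = t)
    (hd : σ.colLen 0 = d) (htn : t ≤ n) (hdn : d ≤ n) (htk : t ≤ k) (hdk : d ≤ k) :
    hwHarmonic n k σ = edgeMinor htn (lastRows htk) * edgeMinor hdn (lastRows hdk) := by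
  have htd : t ≤ d := by
    rw [← ht, ← hd]
    exact σ.colLen_anti 0 1 zero_le_one
  unfold lastRows
  rw [hwHarmonic, ← prod_cornerMinor_pow htn htk, ← prod_cornerMinor_pow hdn hdk,
    ← Finset.prod_mul_distrib]
  refine Finset.prod_congr rfl fun j _ => ?_
  rw [← pow_add]
  congr 1
  rw [rowLen_eq h2 ht hd, rowLen_eq h2 ht hd]
  split_ifs <;> omega

theorem mixed_apply (i j : Fin k) (P : Poly n k) :
    mixed i j P = polarization i j P + (if i = j then (n : ℂ) / 2 else 0) • P := by
  by_cases h : i = j <;> simp [mixed, h]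

theorem edgeMinor_mul_mem_glModule {σ : YoungDiagram} (h2 : σ.rowLen 0 ≤ 2) (ht : σ.colLen 1 = t)
    (hd : σ.colLen 0 = d) (htn : t ≤ n) (hdn : d ≤ n) (hdk : d < k) (a : Fin t → Fin k)
    (b : Fin d → Fin k) : edgeMinor htn a * edgeMinor hdn b ∈ glModule n k σ := by
  have htd : t ≤ d := by
    rw [← ht, ← hd]
    exact σ.colLen_anti 0 1 zero_le_one
  refine edgeMinor_mul_mem (fun i j P hP => ?_) htn hdn htd hdk (b₀ := lastRows hdk.le)
    (fun p q h => Fin.castLE_injective _ (Fin.rev_injective h)) ?_ a b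
  · have h := mixed_mem_glModule σ i j P hP
    rw [mixed_apply] at h
    exact (Submodule.add_mem_iff_left _ (Submodule.smul_mem _ _ hP)).mp h
  · refine Submodule.mem_sInf.mpr fun W hW => ?_
    have h := hW.1
    rwa [hwHarmonic_eq h2 ht hd htn hdn (htd.trans hdk.le) hdk.le] at h

/-- The products of two edge minors span a harmonic space that contains `δ_σ` and is stable under
all `h_{ij}`, hence contains the module generated by `δ_σ`. -/
theorem glModule_le_harmonics {σ : YoungDiagram} (h2 : σ.rowLen 0 ≤ 2)
    (hn : σ.colLen 0 + σ.colLen 1 ≤ n) (hk : σ.colLen 0 ≤ k) :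
    glModule n k σ ≤ harmonics n k := by
  have htd := σ.colLen_anti 0 1 zero_le_one
  have htn : σ.colLen 1 ≤ n := by omega
  have hdn : σ.colLen 0 ≤ n := by omega
  have hspan : Submodule.span ℂ (Set.range fun p : (Fin (σ.colLen 1) → Fin k) ×
      (Fin (σ.colLen 0) → Fin k) => edgeMinor htn p.1 * edgeMinor hdn p.2) ≤ harmonics n k := by
    rw [Submodule.span_le]
    rintro _ ⟨p, rfl⟩
    simp only [harmonics, SetLike.mem_coe, Submodule.mem_iInf, LinearMap.mem_ker]
    exact fun i j => laplace_edgeMinor_mul htn hdn hn _ _ i j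
  refine le_trans (sInf_le ⟨?_, fun i j P hP => ?_⟩) hspan
  · rw [hwHarmonic_eq h2 rfl rfl htn hdn (htd.trans hk) hk]
    exact Submodule.subset_span ⟨(_, _), rfl⟩
  · rw [mixed_apply]
    refine Submodule.add_mem _ ?_ (Submodule.smul_mem _ _ hP)
    induction hP using Submodule.span_induction with
    | mem x hx =>
      obtain ⟨p, rfl⟩ := hx
      simp only [Derivation.leibniz, polarization_edgeMinor, smul_eq_mul, Finset.mul_sum]
      refine Submodule.add_mem _ (Submodule.sum_mem _ fun q _ => ?_)
        (Submodule.sum_mem _ fun q _ => ?_)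
      · split_ifs
        · exact Submodule.subset_span ⟨(_, _), rfl⟩
        · rw [mul_zero]
          exact Submodule.zero_mem _
      · split_ifs
        · rw [mul_comm]
          exact Submodule.subset_span ⟨(_, _), rfl⟩
        · rw [mul_zero]
          exact Submodule.zero_mem _
    | zero => simp
    | add x y _ _ hx hy =>
      rw [map_add]
      exact Submodule.add_mem _ hx hy
    | smul c x _ hx =>
      rw [Derivation.map_smul]
      exact Submodule.smul_mem _ _ hx

end GlModule

/-! ### Determinants of block matrices with a zero block -/

section BlockDeterminant

variable {I J D T A : Type*} [Fintype I] [Fintype J] [Fintype D] [Fintype T] [DecidableEq I]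
  [DecidableEq J] [DecidableEq D] [DecidableEq T] [CommRing A]

theorem det_fromBlocks_submatrix (R : Matrix I J A) (Y : Matrix I T A) (Z : Matrix D J A)
    (e : J ⊕ T ≃ I ⊕ D) (α : Equiv.Perm T) (β : Equiv.Perm D) :
    ((Matrix.fromBlocks R Y Z 0).submatrix e id).det =
      ((Equiv.Perm.sign α : ℤ) : A) * ((Equiv.Perm.sign β : ℤ) : A) *
        ((Matrix.fromBlocks R (Y.submatrix id α) (Z.submatrix β id) 0).submatrix e id).det := by
  set M := (Matrix.fromBlocks R Y Z 0).submatrix e id with hM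
  set β' : Equiv.Perm (J ⊕ T) := (e.trans (Equiv.sumCongr 1 β)).trans e.symm with hβ
  set α' : Equiv.Perm (J ⊕ T) := Equiv.sumCongr 1 α with hα
  have hsα : Equiv.Perm.sign α' = Equiv.Perm.sign α := by
    rw [hα]
    exact (Equiv.Perm.sign_sumCongr 1 α).trans (by simp)
  have hsβ : Equiv.Perm.sign β' = Equiv.Perm.sign β := by
    rw [hβ, Equiv.Perm.sign_trans_trans_symm]
    exact (Equiv.Perm.sign_sumCongr 1 β).trans (by simp)
  have h : (Matrix.fromBlocks R (Y.submatrix id α) (Z.submatrix β id) 0).submatrix e id =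
      (M.submatrix β' id).submatrix id α' := by
    ext x y
    simp only [hM, hβ, Matrix.submatrix_apply, id, Equiv.trans_apply, Equiv.apply_symm_apply]
    rcases e x with i | q <;> rcases y with j | p <;> rfl
  rw [h, Matrix.det_permute', Matrix.det_permute, hsα, hsβ]
  have h1 : ((Equiv.Perm.sign α : ℤ) : A) * ((Equiv.Perm.sign α : ℤ) : A) = 1 := by
    rw [← Int.cast_mul, ← Units.val_mul, Int.units_mul_self, Units.val_one, Int.cast_one]
  have h2 : ((Equiv.Perm.sign β : ℤ) : A) * ((Equiv.Perm.sign β : ℤ) : A) = 1 := by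
    rw [← Int.cast_mul, ← Units.val_mul, Int.units_mul_self, Units.val_one, Int.cast_one]
  linear_combination (-(M.det)) * h1 - ((Equiv.Perm.sign α : ℤ) : A) *
    ((Equiv.Perm.sign α : ℤ) : A) * M.det * h2

omit [DecidableEq J] in
/-- Every permutation term, averaged over the permutations of the outer columns and rows, is a
product of entries of `R` times a minor of `Y` and a minor of `Z`. -/
theorem sum_sign_prod_fromBlocks (R : Matrix I J A) (Y : Matrix I T A) (Z : Matrix D J A)
    (N : Submonoid A) (hR : ∀ i j, R i j ∈ N) (f : J ⊕ T ≃ I ⊕ D) :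
    (∃ ρ ∈ N, ∃ (a : T → I) (b : D → J), (∑ α : Equiv.Perm T, ∑ β : Equiv.Perm D,
      ((Equiv.Perm.sign α : ℤ) : A) * ((Equiv.Perm.sign β : ℤ) : A) * ∏ x,
        Matrix.fromBlocks R (Y.submatrix id α) (Z.submatrix β id) 0 (f x) x) =
      ρ * ((Y.submatrix a id).det * (Z.submatrix id b).det)) ∨
    (∑ α : Equiv.Perm T, ∑ β : Equiv.Perm D,
      ((Equiv.Perm.sign α : ℤ) : A) * ((Equiv.Perm.sign β : ℤ) : A) * ∏ x,
        Matrix.fromBlocks R (Y.submatrix id α) (Z.submatrix β id) 0 (f x) x) = 0 := by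
  by_cases hf : ∀ p, ∃ i, f (Sum.inr p) = Sum.inl i
  · left
    have hg : ∀ q, ∃ j, f.symm (Sum.inr q) = Sum.inl j := by
      intro q
      rcases hq : f.symm (Sum.inr q) with j | p
      · exact ⟨j, rfl⟩
      · obtain ⟨i, hi⟩ := hf p
        rw [← hq, Equiv.apply_symm_apply] at hi
        cases hi
    choose a ha using hf
    choose b hb using hg
    let r : I ⊕ D → J ⊕ T → A := fun u v => Sum.elim (fun i => Sum.elim (R i) 1 v) 1 u
    refine ⟨∏ x, r (f x) x, N.prod_mem fun x _ => ?_, a, b, ?_⟩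
    · rcases f x with i | q <;> rcases x with j | p
      · exact hR i j
      · exact N.one_mem
      · exact N.one_mem
      · exact N.one_mem
    have hprod : ∀ (α : Equiv.Perm T) (β : Equiv.Perm D), ∏ x,
        Matrix.fromBlocks R (Y.submatrix id α) (Z.submatrix β id) 0 (f x) x =
        (∏ x, r (f x) x) * ((∏ p, Y (a p) (α p)) * ∏ q, Z (β q) (b q)) := by
      intro α β
      have h1 : ∏ p, Y (a p) (α p) =
          ∏ x : J ⊕ T, Sum.elim (fun _ => 1) (fun p => Y (a p) (α p)) x := by
        simp [Fintype.prod_sum_type]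
      have h2 : ∏ q, Z (β q) (b q) =
          ∏ x : J ⊕ T, Sum.elim (fun _ => 1) (fun q => Z (β q) (b q)) (f x) := by
        rw [Equiv.prod_comp f (Sum.elim (fun _ => 1) fun q => Z (β q) (b q))]
        simp [Fintype.prod_sum_type]
      rw [h1, h2, ← Finset.prod_mul_distrib, ← Finset.prod_mul_distrib]
      refine Finset.prod_congr rfl fun x _ => ?_
      rcases x with j | p
      · rcases hx : f (Sum.inl j) with i | q
        · simp [r]
        · have hj : b q = j := by
            have := hb q
            rw [← hx, Equiv.symm_apply_apply] at this
            exact (Sum.inl_injective this).symm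
          simp [r, hj]
      · rw [ha p]
        simp [r]
    simp only [hprod]
    rw [← Matrix.det_transpose, Matrix.det_apply', Matrix.det_apply', Finset.sum_mul_sum,
      Finset.mul_sum]
    refine Finset.sum_congr rfl fun α _ => ?_
    rw [Finset.mul_sum]
    refine Finset.sum_congr rfl fun β _ => ?_
    simp only [Matrix.transpose_apply, Matrix.submatrix_apply, id]
    ring
  · right
    push Not at hf
    obtain ⟨p, hp⟩ := hf
    -- An outer column is sent to an outer row, so every product has a factor in the zero block.
    refine Finset.sum_eq_zero fun α _ => Finset.sum_eq_zero fun β _ => ?_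
    rw [Finset.prod_eq_zero (Finset.mem_univ (Sum.inr p)), mul_zero]
    rcases h : f (Sum.inr p) with i | q
    · exact absurd h (hp i)
    · simp

/-- Permuting outer columns and rows changes the determinant by signs only, so the signed sum over
both groups is a positive integer multiple of it. For a fixed permutation `π` this sum collapses to
a product of a minor of `Y` and a minor of `Z`, or to zero. -/
theorem det_fromBlocks_mem [Algebra ℂ A] (R : Matrix I J A) (Y : Matrix I T A) (Z : Matrix D J A)
    (e : J ⊕ T ≃ I ⊕ D) (N : Submonoid A) (hR : ∀ i j, R i j ∈ N) (S : Submodule ℂ A)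
    (hS : ∀ ρ ∈ N, ∀ (a : T → I) (b : D → J),
      ρ * ((Y.submatrix a id).det * (Z.submatrix id b).det) ∈ S) :
    ((Matrix.fromBlocks R Y Z 0).submatrix e id).det ∈ S := by
  set M := (Matrix.fromBlocks R Y Z 0).submatrix e id with hM
  have h1 : ((Fintype.card (Equiv.Perm T) * Fintype.card (Equiv.Perm D) : ℕ) : ℂ) • M.det =
      ∑ π : Equiv.Perm (J ⊕ T), ((Equiv.Perm.sign π : ℤ) : ℂ) • ∑ α : Equiv.Perm T,
        ∑ β : Equiv.Perm D, ((Equiv.Perm.sign α : ℤ) : A) * ((Equiv.Perm.sign β : ℤ) : A) *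
          ∏ x, Matrix.fromBlocks R (Y.submatrix id α) (Z.submatrix β id) 0 (π.trans e x) x := by
    have h2 : ((Fintype.card (Equiv.Perm T) * Fintype.card (Equiv.Perm D) : ℕ) : ℂ) • M.det =
        ∑ α : Equiv.Perm T, ∑ β : Equiv.Perm D, ((Equiv.Perm.sign α : ℤ) : A) *
          ((Equiv.Perm.sign β : ℤ) : A) * ((Matrix.fromBlocks R (Y.submatrix id α)
            (Z.submatrix β id) 0).submatrix e id).det := by
      simp only [hM, ← det_fromBlocks_submatrix, Finset.sum_const, Finset.card_univ, smul_smul]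
      rw [Nat.cast_smul_eq_nsmul]
    rw [h2]
    simp only [Matrix.det_apply', Finset.smul_sum, Finset.mul_sum]
    conv_rhs => rw [Finset.sum_comm]
    refine Finset.sum_congr rfl fun α _ => ?_
    conv_lhs => rw [Finset.sum_comm]
    refine Finset.sum_congr rfl fun π _ => Finset.sum_congr rfl fun β _ => ?_
    rw [Int.cast_smul_eq_zsmul, zsmul_eq_mul]
    simp only [Matrix.submatrix_apply, id, Equiv.trans_apply]
    ring
  have h3 : ((Fintype.card (Equiv.Perm T) * Fintype.card (Equiv.Perm D) : ℕ) : ℂ) ≠ 0 :=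
    Nat.cast_ne_zero.mpr (Nat.mul_ne_zero Fintype.card_ne_zero Fintype.card_ne_zero)
  rw [← S.smul_mem_iff h3, h1]
  refine S.sum_mem fun π _ => S.smul_mem _ ?_
  rcases sum_sign_prod_fromBlocks R Y Z N hR (π.trans e) with ⟨ρ, hρ, a, b, h⟩ | h
  · rw [h]
    exact hS ρ hρ a b
  · rw [h]
    exact S.zero_mem

end BlockDeterminant

/-! ### The action of `𝔤` on `S(𝔭⁻) ⊗ 𝓟` -/

section TensorDerivations

variable {B C : Type*} [CommRing B] [Algebra ℂ B] [CommRing C] [Algebra ℂ C]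

/-- The derivation `D ⊗ 1` of `B ⊗ C`. -/
def derivationLeft (C : Type*) [CommRing C] [Algebra ℂ C] (D : Derivation ℂ B B) :
    Derivation ℂ (B ⊗[ℂ] C) (B ⊗[ℂ] C) :=
  Derivation.mk' (TensorProduct.map D.toLinearMap LinearMap.id) fun u v => by
    induction u using TensorProduct.induction_on with
    | zero => simp
    | add u u' hu hu' =>
      rw [add_mul, map_add, hu, hu', map_add]
      simp only [smul_eq_mul]
      ring
    | tmul b c =>
      induction v using TensorProduct.induction_on with
      | zero => simp
      | add v v' hv hv' =>
        rw [mul_add, map_add, hv, hv', map_add]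
        simp only [smul_eq_mul]
        ring
      | tmul b' c' => simp [TensorProduct.add_tmul, mul_comm c c']

/-- The derivation `1 ⊗ D` of `B ⊗ C`. -/
def derivationRight (B : Type*) [CommRing B] [Algebra ℂ B] (D : Derivation ℂ C C) :
    Derivation ℂ (B ⊗[ℂ] C) (B ⊗[ℂ] C) :=
  Derivation.mk' (TensorProduct.map LinearMap.id D.toLinearMap) fun u v => by
    induction u using TensorProduct.induction_on with
    | zero => simp
    | add u u' hu hu' =>
      rw [add_mul, map_add, hu, hu', map_add]
      simp only [smul_eq_mul]
      ring
    | tmul b c =>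
      induction v using TensorProduct.induction_on with
      | zero => simp
      | add v v' hv hv' =>
        rw [mul_add, map_add, hv, hv', map_add]
        simp only [smul_eq_mul]
        ring
      | tmul b' c' => simp [TensorProduct.tmul_add, mul_comm b b']

@[simp]
theorem derivationLeft_tmul (D : Derivation ℂ B B) (b : B) (c : C) :
    derivationLeft C D (b ⊗ₜ c) = D b ⊗ₜ c := rfl

@[simp]
theorem derivationRight_tmul (D : Derivation ℂ C C) (b : B) (c : C) :
    derivationRight B D (b ⊗ₜ c) = b ⊗ₜ D c := rfl

end TensorDerivations

section PolynomialVerma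

variable {n k : ℕ}

/-- The derivation `ad h_{ij} ⊗ 1 + 1 ⊗ ∑ₗ x_{il} ∂_{jl}` of `S(𝔭⁻) ⊗ 𝓟`. -/
def totalPolarization (n : ℕ) {k : ℕ} (i j : Fin k) :
    Derivation ℂ (SymPMinus k ⊗[ℂ] Poly n k) (SymPMinus k ⊗[ℂ] Poly n k) :=
  derivationLeft (Poly n k) (adMixed i j) + derivationRight (SymPMinus k) (polarization i j)

/-- The action of `Δ_{ij}` on `S(𝔭⁻) ⊗ 𝓟`, where `𝓟` is treated as if killed by `𝔭⁺`. -/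
def totalLaplace (n : ℕ) {k : ℕ} (i j : Fin k) : Module.End ℂ (SymPMinus k ⊗[ℂ] Poly n k) :=
  ∑ z : Sym2 (Fin k), TensorProduct.map (MvPolynomial.pderiv (R := ℂ) z).toLinearMap
      (lapBracket mixed i j z) +
    (1 / 2 : ℂ) • ∑ z : Sym2 (Fin k), ∑ w : Sym2 (Fin k), TensorProduct.map
      (LinearMap.mulLeft ℂ (lapBracket (fun a b => adMixed a b (MvPolynomial.X w)) i j z) ∘ₗ
        (MvPolynomial.pderiv (R := ℂ) z).toLinearMap ∘ₗ
        (MvPolynomial.pderiv (R := ℂ) w).toLinearMap) LinearMap.id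

theorem lTensor_vermaMixed (σ : YoungDiagram) (i j : Fin k)
    (u : SymPMinus k ⊗[ℂ] glModule n k σ) :
    LinearMap.lTensor (SymPMinus k) (glModule n k σ).subtype (vermaMixed σ i j u) =
      totalPolarization n i j (LinearMap.lTensor (SymPMinus k) (glModule n k σ).subtype u) +
      (if i = j then (n : ℂ) / 2 else 0) •
        LinearMap.lTensor (SymPMinus k) (glModule n k σ).subtype u := by
  induction u using TensorProduct.induction_on with
  | zero => simp
  | add u v hu hv =>
    rw [map_add, map_add, hu, hv, map_add, map_add, smul_add]
    abel
  | tmul s f =>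
    have h : ((mixedF σ i j f : glModule n k σ) : Poly n k) = mixed i j (f : Poly n k) := rfl
    simp [vermaMixed, totalPolarization, h, mixed_apply, TensorProduct.tmul_add, add_assoc]
    split_ifs <;> simp

theorem lapBracket_apply {M : Type*} [AddCommGroup M] [Module ℂ M]
    (T : Fin k → Fin k → Module.End ℂ M) (i j : Fin k) (z : Sym2 (Fin k)) (v : M) :
    lapBracket T i j z v = lapBracket (fun a b => T a b v) i j z :=
  map_lapBracket (LinearMap.applyₗ v : Module.End ℂ M →ₗ[ℂ] M).toAddMonoidHom T i j z

/-- Passing from `F` to `𝓟` makes the ambient space a commutative algebra, where determinants and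
product rules are available. The formula for the operator is the same on both spaces. -/
theorem lTensor_vermaLaplace (σ : YoungDiagram) (i j : Fin k)
    (u : SymPMinus k ⊗[ℂ] glModule n k σ) :
    LinearMap.lTensor (SymPMinus k) (glModule n k σ).subtype (vermaLaplace σ i j u) =
      totalLaplace n i j (LinearMap.lTensor (SymPMinus k) (glModule n k σ).subtype u) := by
  induction u using TensorProduct.induction_on with
  | zero => simp
  | add u v hu hv => rw [map_add, map_add, hu, hv, map_add, map_add]
  | tmul s f =>
    have h : ∀ z, ((lapBracket (mixedF σ) i j z f : glModule n k σ) : Poly n k) =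
        lapBracket mixed i j z (f : Poly n k) := fun z => by
      rw [lapBracket_apply, lapBracket_apply]
      exact map_lapBracket (glModule n k σ).subtype.toAddMonoidHom _ i j z
    simp [vermaLaplace, totalLaplace, LinearMap.sum_apply, h]

theorem lapBracket_derivation_apply {A : Type*} [CommRing A] [Algebra ℂ A]
    (T : Fin k → Fin k → Derivation ℂ A A) (i j : Fin k) (z : Sym2 (Fin k)) (v : A) :
    lapBracket T i j z v = lapBracket (fun a b => T a b v) i j z :=
  map_lapBracket ((LinearMap.applyₗ v : Module.End ℂ A →ₗ[ℂ] A).toAddMonoidHom.comp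
    (⟨⟨fun D => D.toLinearMap, rfl⟩, fun _ _ => rfl⟩ : Derivation ℂ A A →+ Module.End ℂ A)) T i j z

/-- The scalar part of the commutator `[Δ_{ij}, r_z]`. -/
def bracketConst (n : ℕ) {k : ℕ} (i j : Fin k) (z : Sym2 (Fin k)) : ℂ :=
  lapBracket (fun a b => if a = b then (n : ℂ) / 2 else 0) i j z

theorem lapBracket_mixed (i j : Fin k) (z : Sym2 (Fin k)) (P : Poly n k) :
    lapBracket mixed i j z P = lapBracket polarization i j z P + bracketConst n i j z • P := by
  rw [lapBracket_apply, lapBracket_derivation_apply, bracketConst,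
    show lapBracket (fun a b => if a = b then (n : ℂ) / 2 else 0) i j z • P =
      lapBracket (fun a b => (if a = b then (n : ℂ) / 2 else 0) • P) i j z from
      map_lapBracket ((LinearMap.toSpanSingleton ℂ (Poly n k) P).toAddMonoidHom) _ i j z,
    ← lapBracket_add]
  simp only [mixed_apply]

/-- The derivation `∂_z ⊗ 1`. -/
def symDeriv (n : ℕ) {k : ℕ} (z : Sym2 (Fin k)) :
    Derivation ℂ (SymPMinus k ⊗[ℂ] Poly n k) (SymPMinus k ⊗[ℂ] Poly n k) :=
  derivationLeft (Poly n k) (MvPolynomial.pderiv z)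

/-- The coefficients of the second order part of `Δ_{ij}`. -/
def bracketCoeff (n : ℕ) {k : ℕ} (i j : Fin k) (z w : Sym2 (Fin k)) :
    SymPMinus k ⊗[ℂ] Poly n k :=
  lapBracket (fun a b => adMixed a b (MvPolynomial.X w)) i j z ⊗ₜ 1

theorem totalLaplace_apply (i j : Fin k) (f : SymPMinus k ⊗[ℂ] Poly n k) :
    totalLaplace n i j f =
      ∑ z, (symDeriv n z (derivationRight _ (lapBracket polarization i j z) f) +
        bracketConst n i j z • symDeriv n z f) +
      (1 / 2 : ℂ) • ∑ z, ∑ w, bracketCoeff n i j z w * symDeriv n z (symDeriv n w f) := by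
  induction f using TensorProduct.induction_on with
  | zero => simp
  | add u v hu hv =>
    rw [map_add, hu, hv]
    simp only [map_add, smul_add, mul_add, Finset.sum_add_distrib]
    abel
  | tmul s f =>
    simp [totalLaplace, LinearMap.sum_apply, lapBracket_mixed, symDeriv, bracketCoeff,
      TensorProduct.tmul_add]

/-- The symbol of the second order operator `Δ_{ij}` on `S(𝔭⁻) ⊗ 𝓟`. -/
def totalSymbol (i j : Fin k) (f : SymPMinus k ⊗[ℂ] Poly n k) :
    Derivation ℂ (SymPMinus k ⊗[ℂ] Poly n k) (SymPMinus k ⊗[ℂ] Poly n k) :=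
  ∑ z, (symDeriv n z f • derivationRight _ (lapBracket polarization i j z) +
    derivationRight _ (lapBracket polarization i j z) f • symDeriv n z) +
  ∑ z, ∑ w, (bracketCoeff n i j z w * symDeriv n z f) • symDeriv n w

theorem derivation_sum_apply {ι A : Type*} [CommRing A] [Algebra ℂ A] (s : Finset ι)
    (T : ι → Derivation ℂ A A) (v : A) : (∑ z ∈ s, T z) v = ∑ z ∈ s, T z v := by
  change Derivation.coeFnAddMonoidHom (∑ z ∈ s, T z) v = _
  rw [map_sum, Finset.sum_apply]
  rfl

theorem totalSymbol_apply (i j : Fin k) (f g : SymPMinus k ⊗[ℂ] Poly n k) :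
    totalSymbol i j f g =
      ∑ z, (symDeriv n z f * derivationRight _ (lapBracket polarization i j z) g +
        derivationRight _ (lapBracket polarization i j z) f * symDeriv n z g) +
      ∑ z, ∑ w, bracketCoeff n i j z w * symDeriv n z f * symDeriv n w g := by
  simp only [totalSymbol, Derivation.add_apply, derivation_sum_apply, Derivation.smul_apply,
    smul_eq_mul]

theorem bracketCoeff_comm (i j : Fin k) (z w : Sym2 (Fin k)) :
    bracketCoeff n i j z w = bracketCoeff n i j w z := by
  rw [bracketCoeff, lapBracket_adMixed_comm, bracketCoeff]

/-- The scalar terms are derivations and do not enter the symbol. In the last sum the two mixed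
terms agree after exchanging `z` and `w`, which absorbs the factor `1 / 2`. -/
theorem totalLaplace_mul (i j : Fin k) (f g : SymPMinus k ⊗[ℂ] Poly n k) :
    totalLaplace n i j (f * g) =
      f * totalLaplace n i j g + g * totalLaplace n i j f + totalSymbol i j f g := by
  have h1 : ∀ z w, bracketCoeff n i j z w * symDeriv n z (symDeriv n w (f * g)) =
      f * (bracketCoeff n i j z w * symDeriv n z (symDeriv n w g)) +
      g * (bracketCoeff n i j z w * symDeriv n z (symDeriv n w f)) +
      (bracketCoeff n i j z w * symDeriv n z f * symDeriv n w g +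
        bracketCoeff n i j w z * symDeriv n w f * symDeriv n z g) := by
    intro z w
    rw [bracketCoeff_comm i j w z]
    simp only [Derivation.leibniz, map_add, smul_eq_mul]
    ring
  have h2 : ∀ z, symDeriv n z (derivationRight _ (lapBracket polarization i j z) (f * g)) +
        bracketConst n i j z • symDeriv n z (f * g) =
      f * (symDeriv n z (derivationRight _ (lapBracket polarization i j z) g) +
        bracketConst n i j z • symDeriv n z g) +
      g * (symDeriv n z (derivationRight _ (lapBracket polarization i j z) f) +
        bracketConst n i j z • symDeriv n z f) +
      (symDeriv n z f * derivationRight _ (lapBracket polarization i j z) g +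
        derivationRight _ (lapBracket polarization i j z) f * symDeriv n z g) := by
    intro z
    have hc : bracketConst n i j z • symDeriv n z (f * g) =
        f * (bracketConst n i j z • symDeriv n z g) +
          g * (bracketConst n i j z • symDeriv n z f) := by
      rw [Derivation.leibniz, smul_add, smul_eq_mul, smul_eq_mul, mul_smul_comm, mul_smul_comm]
    rw [hc, Derivation.leibniz, map_add]
    simp only [Derivation.leibniz, smul_eq_mul]
    ring
  have h3 : ∑ z, ∑ w, bracketCoeff n i j w z * symDeriv n w f * symDeriv n z g =
      ∑ z, ∑ w, bracketCoeff n i j z w * symDeriv n z f * symDeriv n w g := Finset.sum_comm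
  rw [totalLaplace_apply, totalLaplace_apply, totalLaplace_apply, totalSymbol_apply]
  simp only [h1, h2, Finset.sum_add_distrib, h3]
  simp only [← Finset.mul_sum, Finset.sum_add_distrib, mul_add]
  set X := ∑ z, ∑ w, bracketCoeff n i j z w * symDeriv n z f * symDeriv n w g with hX
  have h4 : (1 / 2 : ℂ) • (X + X) = X := by
    rw [← two_smul ℂ X, smul_smul]
    norm_num
  rw [smul_add, h4, smul_add, mul_smul_comm, mul_smul_comm]
  abel

theorem totalSymbol_comm (i j : Fin k) (f g : SymPMinus k ⊗[ℂ] Poly n k) :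
    totalSymbol i j f g = totalSymbol i j g f := by
  have h := totalLaplace_mul i j g f
  rw [mul_comm g f, totalLaplace_mul i j f g] at h
  linear_combination h

/-- Only the derivative in the direction of `s_{ab}` survives. What remains is the commutator
`[Δ_{ij}, r_{ab}]` without its scalar part. -/
theorem totalSymbol_symVar (i j a b : Fin k) (q : SymPMinus k) (P : Poly n k) :
    totalSymbol i j (symVar a b ⊗ₜ 1) (q ⊗ₜ P) =
      lapBracket (fun a b => totalPolarization n a b (q ⊗ₜ P)) i j s(a, b) := by
  have h1 : ∀ z, symDeriv n z (symVar a b ⊗ₜ 1) = if z = s(a, b) then 1 else 0 := by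
    intro z
    rw [symDeriv, derivationLeft_tmul, symVar, MvPolynomial.pderiv_X, Pi.single_apply]
    by_cases h : z = s(a, b)
    · rw [if_pos h, if_pos h.symm]
      rfl
    · rw [if_neg h, if_neg (Ne.symm h), TensorProduct.zero_tmul]
  have h2 : ∀ z, derivationRight (SymPMinus k) (lapBracket (polarization (n := n)) i j z)
      (symVar a b ⊗ₜ[ℂ] 1) = 0 := by
    intro z
    rw [derivationRight_tmul, Derivation.map_one_eq_zero, TensorProduct.tmul_zero]
  have h3 : ∑ w, bracketCoeff n i j s(a, b) w * symDeriv n w (q ⊗ₜ P) =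
      lapBracket (fun a b => adMixed a b q) i j s(a, b) ⊗ₜ P := by
    rw [← lapBracket_sum_pderiv, TensorProduct.sum_tmul]
    refine Finset.sum_congr rfl fun w _ => ?_
    rw [bracketCoeff, symDeriv, derivationLeft_tmul, Algebra.TensorProduct.tmul_mul_tmul, one_mul]
  rw [totalSymbol_apply]
  simp only [h1, h2, zero_mul, add_zero, ite_mul, one_mul, mul_ite, mul_one, mul_zero,
    Finset.sum_ite_eq', Finset.mem_univ, if_true]
  rw [Finset.sum_comm]
  simp only [Finset.sum_ite_eq', Finset.mem_univ, if_true, h3]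
  have e1 : lapBracket (fun a b => adMixed a b q) i j s(a, b) ⊗ₜ[ℂ] P =
      lapBracket (fun a b => adMixed a b q ⊗ₜ[ℂ] P) i j s(a, b) :=
    map_lapBracket ((TensorProduct.mk ℂ (SymPMinus k) (Poly n k)).flip P).toAddMonoidHom _ i j _
  have e2 : q ⊗ₜ[ℂ] lapBracket (fun a b => polarization a b P) i j s(a, b) =
      lapBracket (fun a b => q ⊗ₜ[ℂ] polarization a b P) i j s(a, b) :=
    map_lapBracket (TensorProduct.mk ℂ (SymPMinus k) (Poly n k) q).toAddMonoidHom _ i j _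
  rw [derivationRight_tmul, lapBracket_derivation_apply, e1, e2, ← lapBracket_add]
  congr 1
  funext a b
  exact add_comm _ _

end PolynomialVerma

/-! ### The matrix of symbols -/

section SymbolMatrix

variable {n k : ℕ}

/-- The matrix `M^{(n,k)}` with the block `J` replaced by `0`. -/
def hollowMatrix {A : Type*} [CommRing A] (r : Matrix (Fin k) (Fin k) A)
    (x : Matrix (Fin k) (Fin n) A) : Matrix (Fin k ⊕ Fin n) (Fin k ⊕ Fin n) A :=
  Matrix.fromBlocks r (Matrix.of fun i l => x i l.rev) (Matrix.of fun l i => x i l.rev) 0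

/-- The matrix of symbols over `S(𝔭⁻) ⊗ 𝓟`. -/
def symbolMatrix (n k : ℕ) :
    Matrix (Fin k ⊕ Fin n) (Fin k ⊕ Fin n) (SymPMinus k ⊗[ℂ] Poly n k) :=
  hollowMatrix (sTensor n k) (xTensorSym n k)

theorem symVar_comm (a b : Fin k) : symVar a b = symVar b a := by
  rw [symVar, Sym2.eq_swap, symVar]

theorem symbolMatrix_comm (P Q : Fin k ⊕ Fin n) :
    symbolMatrix n k P Q = symbolMatrix n k Q P := by
  rcases P with a | l <;> rcases Q with b | m <;>
    simp [symbolMatrix, hollowMatrix, sTensor, symVar_comm]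

/-- The outer indices are inert, so `h_{ij}` without its scalar part acts as one elementary
operation on rows and the same one on columns. -/
theorem totalPolarization_symbolMatrix (i j : Fin k) (P Q : Fin k ⊕ Fin n) :
    totalPolarization n i j (symbolMatrix n k P Q) =
      (if Sum.inl j = P then symbolMatrix n k (Sum.inl i) Q else 0) +
        if Sum.inl j = Q then symbolMatrix n k P (Sum.inl i) else 0 := by
  have hx : ∀ a l, totalPolarization n i j (1 ⊗ₜ MvPolynomial.X (a, l)) =
      if j = a then 1 ⊗ₜ MvPolynomial.X (i, l) else 0 := by
    intro a l
    rw [totalPolarization, Derivation.add_apply, derivationLeft_tmul, derivationRight_tmul,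
      polarization_X, Derivation.map_one_eq_zero, TensorProduct.zero_tmul, zero_add]
    simp only [@eq_comm _ a j]
    split_ifs <;> simp
  rcases P with a | l <;> rcases Q with b | m
  · simp only [symbolMatrix, hollowMatrix, Matrix.fromBlocks_apply₁₁, sTensor, Matrix.of_apply,
      Sum.inl.injEq]
    rw [totalPolarization, Derivation.add_apply, derivationLeft_tmul, derivationRight_tmul,
      Derivation.map_one_eq_zero, TensorProduct.tmul_zero, add_zero, adMixed, symVar,
      MvPolynomial.mkDerivation_X, Sym2.lift_mk, TensorProduct.add_tmul, symVar_comm a i]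
    split_ifs <;> simp
  · simp only [symbolMatrix, hollowMatrix, Matrix.fromBlocks_apply₁₂, xTensorSym, Matrix.of_apply,
      Sum.inl.injEq, reduceCtorEq, if_false, add_zero, hx]
  · simp only [symbolMatrix, hollowMatrix, Matrix.fromBlocks_apply₂₁, xTensorSym, Matrix.of_apply,
      Sum.inl.injEq, reduceCtorEq, if_false, zero_add, hx]
  · simp [symbolMatrix, hollowMatrix]

/-- The Kronecker delta of a compact index with an index of the matrix of symbols. -/
def symbolDelta (n : ℕ) {k : ℕ} (i : Fin k) (P : Fin k ⊕ Fin n) : SymPMinus k ⊗[ℂ] Poly n k :=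
  if Sum.inl i = P then 1 else 0

/-- The symbol of `Δ_{ij}` on two entries of the matrix of symbols. -/
def entryBracket (i j : Fin k) (P Q R S : Fin k ⊕ Fin n) : SymPMinus k ⊗[ℂ] Poly n k :=
  (symbolDelta n j P * symbolDelta n i R + symbolDelta n i P * symbolDelta n j R) *
      symbolMatrix n k Q S +
    (symbolDelta n j Q * symbolDelta n i S + symbolDelta n i Q * symbolDelta n j S) *
      symbolMatrix n k P R +
    symbolDelta n j P * symbolDelta n i S * symbolMatrix n k R Q +
    symbolDelta n j Q * symbolDelta n i R * symbolMatrix n k P S +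
    symbolDelta n i P * symbolDelta n j S * symbolMatrix n k R Q +
    symbolDelta n i Q * symbolDelta n j R * symbolMatrix n k P S

theorem entryBracket_comm (i j : Fin k) (P Q R S : Fin k ⊕ Fin n) :
    entryBracket i j P Q R S = entryBracket i j R S P Q := by
  unfold entryBracket
  rw [symbolMatrix_comm R P, symbolMatrix_comm S Q]
  ring

theorem totalSymbol_symVar_symbolMatrix (i j a b : Fin k) (R S : Fin k ⊕ Fin n) :
    totalSymbol i j (symVar a b ⊗ₜ 1) (symbolMatrix n k R S) =
      entryBracket i j (Sum.inl a) (Sum.inl b) R S := by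
  have h : totalSymbol i j (symVar a b ⊗ₜ 1) (symbolMatrix n k R S) =
      lapBracket (fun a b => totalPolarization n a b (symbolMatrix n k R S)) i j s(a, b) := by
    rcases R with c | l <;> rcases S with e | m
    · exact totalSymbol_symVar _ _ _ _ _ _
    · exact totalSymbol_symVar _ _ _ _ _ _
    · exact totalSymbol_symVar _ _ _ _ _ _
    · have h0 : symbolMatrix n k (Sum.inr l) (Sum.inr m) = 0 ⊗ₜ 0 := by
        simp [symbolMatrix, hollowMatrix]
      rw [h0]
      exact totalSymbol_symVar _ _ _ _ _ _
  have hP : ∀ a b : Fin k, totalPolarization n a b (symbolMatrix n k R S) =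
      symbolDelta n b R * symbolMatrix n k (Sum.inl a) S +
        symbolDelta n b S * symbolMatrix n k R (Sum.inl a) := by
    intro a b
    rw [totalPolarization_symbolMatrix, symbolDelta, symbolDelta, ite_mul, ite_mul, one_mul,
      one_mul, zero_mul, zero_mul]
  have hite : ∀ (a b : Fin k) (v : SymPMinus k ⊗[ℂ] Poly n k), (if a = b then v else 0) =
      symbolDelta n a (Sum.inl b) * v := by
    intro a b v
    simp only [symbolDelta, Sum.inl.injEq, ite_mul, one_mul, zero_mul]
  rw [h]
  simp only [lapBracket, Sym2.lift_mk, hP, hite, entryBracket]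
  rw [symbolMatrix_comm (Sum.inl a) R]
  ring

/-- The symbol vanishes on two entries from `x`, because `𝓟` is treated as killed by `𝔭⁺`, whereas
the exchange form gives the entry at two outer indices. The formula therefore needs the zero block
in place of `J`. -/
theorem totalSymbol_symbolMatrix (i j : Fin k) (P Q R S : Fin k ⊕ Fin n) :
    totalSymbol i j (symbolMatrix n k P Q) (symbolMatrix n k R S) = entryBracket i j P Q R S := by
  have hx : ∀ a b l m, totalSymbol (n := n) i j (1 ⊗ₜ MvPolynomial.X (a, l))
      (1 ⊗ₜ MvPolynomial.X (b, m)) = 0 := by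
    intro a b l m
    rw [totalSymbol_apply]
    simp [symDeriv]
  rcases P with a | l <;> rcases Q with b | m
  · exact totalSymbol_symVar_symbolMatrix i j a b R S
  all_goals rcases R with c | p <;> rcases S with e | q
  · rw [totalSymbol_comm, entryBracket_comm]
    exact totalSymbol_symVar_symbolMatrix i j c e _ _
  · simp [symbolMatrix, hollowMatrix, xTensorSym, hx, entryBracket, symbolDelta]
  · simp [symbolMatrix, hollowMatrix, xTensorSym, hx, entryBracket, symbolDelta]
  · simp [symbolMatrix, hollowMatrix, entryBracket, symbolDelta]
  · rw [totalSymbol_comm, entryBracket_comm]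
    exact totalSymbol_symVar_symbolMatrix i j c e _ _
  · simp [symbolMatrix, hollowMatrix, xTensorSym, hx, entryBracket, symbolDelta]
  · simp [symbolMatrix, hollowMatrix, xTensorSym, hx, entryBracket, symbolDelta]
  · simp [symbolMatrix, hollowMatrix, entryBracket, symbolDelta]
  · rw [totalSymbol_comm, entryBracket_comm]
    exact totalSymbol_symVar_symbolMatrix i j c e _ _
  · simp [symbolMatrix, hollowMatrix, totalSymbol_apply, entryBracket, symbolDelta]
  · simp [symbolMatrix, hollowMatrix, totalSymbol_apply, entryBracket, symbolDelta]
  · simp [symbolMatrix, hollowMatrix, totalSymbol_apply, entryBracket, symbolDelta]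

/-- The constant `n` arises from two contributions `n / 2`, the scalar parts of two diagonal
operators `h_{aa}` in the commutator. -/
theorem totalLaplace_symbolMatrix (i j : Fin k) (P Q : Fin k ⊕ Fin n) :
    totalLaplace n i j (symbolMatrix n k P Q) =
      (n : SymPMinus k ⊗[ℂ] Poly n k) * (symbolDelta n j P * symbolDelta n i Q +
        symbolDelta n i P * symbolDelta n j Q) := by
  rcases P with a | l <;> rcases Q with b | m
  · have h1 : ∀ z, symDeriv n z (symVar a b ⊗ₜ 1) = if z = s(a, b) then 1 else 0 := by
      intro z
      rw [symDeriv, derivationLeft_tmul, symVar, MvPolynomial.pderiv_X, Pi.single_apply]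
      by_cases h : z = s(a, b)
      · rw [if_pos h, if_pos h.symm]
        rfl
      · rw [if_neg h, if_neg (Ne.symm h), TensorProduct.zero_tmul]
    have h2 : ∑ z, ∑ w, bracketCoeff n i j z w * symDeriv n z (symDeriv n w (symVar a b ⊗ₜ 1)) =
        0 := by
      refine Finset.sum_eq_zero fun z _ => Finset.sum_eq_zero fun w _ => ?_
      rw [h1]
      split_ifs <;> simp
    have h3 : bracketConst n i j s(a, b) = n * ((if j = a then 1 else 0) * (if i = b then 1 else 0) +
        (if i = a then 1 else 0) * (if j = b then 1 else 0)) := by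
      simp only [bracketConst, lapBracket, Sym2.lift_mk, @eq_comm _ a, @eq_comm _ b]
      split_ifs <;> ring
    have h4 : ∀ i a : Fin k, symbolDelta n i (Sum.inl a) =
        algebraMap ℂ (SymPMinus k ⊗[ℂ] Poly n k) (if i = a then 1 else 0) := by
      intro i a
      simp only [symbolDelta, Sum.inl.injEq]
      split_ifs
      exacts [(map_one _).symm, (map_zero _).symm]
    change totalLaplace n i j (symVar a b ⊗ₜ 1) = _
    rw [totalLaplace_apply, h2, h4, h4, h4, h4, ← map_mul, ← map_mul, ← map_add,
      ← map_natCast (algebraMap ℂ (SymPMinus k ⊗[ℂ] Poly n k)), ← map_mul, ← h3]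
    simp [h1, Algebra.algebraMap_eq_smul_one]
  · simp [symbolMatrix, hollowMatrix, xTensorSym, totalLaplace_apply, symDeriv, symbolDelta]
  · simp [symbolMatrix, hollowMatrix, xTensorSym, totalLaplace_apply, symDeriv, symbolDelta]
  · simp [symbolMatrix, hollowMatrix, symbolDelta]

/-- Minors of order `n + 1` of the matrix of symbols are killed by `𝔭⁺`. -/
theorem totalLaplace_det (i j : Fin k) (ρ κ : Fin (n + 1) → Fin k ⊕ Fin n) :
    totalLaplace n i j ((symbolMatrix n k).submatrix ρ κ).det = 0 := by
  refine secondOrder_det_eq_zero (B := totalSymbol i j) (totalLaplace_mul i j) _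
    (Matrix.of fun a b => symbolMatrix n k (κ a) (κ b))
    (Matrix.of fun a b => symbolMatrix n k (ρ a) (ρ b)) (fun a b => symbolMatrix_comm _ _)
    (fun a b => symbolMatrix_comm _ _) (fun a => symbolDelta n i (ρ a))
    (fun a => symbolDelta n j (ρ a)) (fun a => symbolDelta n i (κ a))
    (fun a => symbolDelta n j (κ a)) (fun a b => ?_) (fun a b c d => ?_)
  -- Here the order matters: `(n + 1) - 1` equals the constant in `totalLaplace_symbolMatrix`.
  · simp only [Matrix.submatrix_apply, Fintype.card_fin, Nat.add_sub_cancel]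
    exact totalLaplace_symbolMatrix i j _ _
  · exact totalSymbol_symbolMatrix i j _ _ _ _

/-- The derivation `ad h_{ij}` acts on minors by a scalar when row and column `i` belong to the minor
whenever row and column `j` do. -/
theorem totalPolarization_det {N : ℕ} (i j : Fin k) {ρ κ : Fin N → Fin k ⊕ Fin n}
    (hρ : Function.Injective ρ) (hκ : Function.Injective κ)
    (hρi : Sum.inl j ∈ Set.range ρ → Sum.inl i ∈ Set.range ρ)
    (hκi : Sum.inl j ∈ Set.range κ → Sum.inl i ∈ Set.range κ) :
    totalPolarization n i j ((symbolMatrix n k).submatrix ρ κ).det =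
      (∑ a, symbolDelta n j (ρ a) * symbolDelta n i (ρ a) +
        ∑ a, symbolDelta n j (κ a) * symbolDelta n i (κ a)) *
          ((symbolMatrix n k).submatrix ρ κ).det := by
  -- The two matrices put row `i` in place of row `j`, and likewise for columns. Their traces vanish
  -- unless `i = j`.
  refine derivation_det_of_eq _ _
    (Matrix.of fun a b => symbolDelta n j (ρ a) * symbolDelta n i (ρ b))
    (Matrix.of fun a b => symbolDelta n j (κ b) * symbolDelta n i (κ a)) ?_
  ext a b : 1
  simp only [Matrix.map_apply, Matrix.submatrix_apply, totalPolarization_symbolMatrix,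
    Matrix.add_apply, Matrix.mul_apply, Matrix.of_apply]
  congr 1
  · by_cases h : Sum.inl j = ρ a
    · obtain ⟨c, hc⟩ := hρi ⟨a, h.symm⟩
      rw [if_pos h, Finset.sum_eq_single c]
      · simp [symbolDelta, hc, ← h]
      · intro c' _ hc'
        have h0 : symbolDelta n i (ρ c') = 0 := if_neg fun h' => hc' (hρ (h'.symm.trans hc.symm))
        rw [h0, mul_zero, zero_mul]
      · simp
    · simp [symbolDelta, h]
  · by_cases h : Sum.inl j = κ b
    · obtain ⟨c, hc⟩ := hκi ⟨b, h.symm⟩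
      rw [if_pos h, Finset.sum_eq_single c]
      · simp [symbolDelta, hc, ← h]
      · intro c' _ hc'
        have h0 : symbolDelta n i (κ c') = 0 := if_neg fun h' => hc' (hκ (h'.symm.trans hc.symm))
        rw [h0, mul_zero, mul_zero]
      · simp
    · simp [symbolDelta, h]

end SymbolMatrix

/-! ### Windows of the matrix of symbols -/

section Windows

variable {n : ℕ}

/-- The row (or column) indices `d + 1, …, d + n + 1` of the matrix `M^{(n,n+1)}`. -/
def windowIndex (d : Fin (n + 1)) (a : Fin (n + 1)) : Fin (n + 1) ⊕ Fin n :=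
  if h : (d : ℕ) + a < n + 1 then Sum.inl ⟨d + a, h⟩ else Sum.inr ⟨d + a - (n + 1), by omega⟩

theorem windowIndex_eq (d a : Fin (n + 1)) :
    finSumFinEquiv.symm ⟨d + a, by omega⟩ = windowIndex d a := by
  rw [Equiv.symm_apply_eq, windowIndex]
  split_ifs with h
  · rfl
  · ext
    simp
    omega

theorem windowIndex_injective (d : Fin (n + 1)) : Function.Injective (windowIndex d) := by
  intro a b h
  rw [← windowIndex_eq, ← windowIndex_eq] at h
  have := congrArg Fin.val (finSumFinEquiv.symm.injective h)
  ext
  simpa using this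

theorem inl_mem_range_windowIndex (d i : Fin (n + 1)) :
    Sum.inl i ∈ Set.range (windowIndex d) ↔ d ≤ i := by
  constructor
  · rintro ⟨a, ha⟩
    rw [windowIndex] at ha
    split_ifs at ha with h
    rw [Fin.le_def, ← Sum.inl_injective ha]
    simp
  · intro h
    rw [Fin.le_def] at h
    refine ⟨⟨i - d, by omega⟩, ?_⟩
    rw [windowIndex, dif_pos (by simp only; omega)]
    congr 1
    ext
    simp only
    omega

variable {A : Type*} [CommRing A]

theorem mul_antidiag_apply {k : ℕ} (x : Matrix (Fin k) (Fin n) A) (i : Fin k) (l : Fin n) :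
    (x * antidiag n A) i l = x i l.rev := by
  rw [Matrix.mul_apply, Finset.sum_eq_single l.rev]
  · simp [antidiag]
  · intro m _ hm
    rw [antidiag, Matrix.of_apply, if_neg, mul_zero]
    rintro rfl
    simp at hm
  · simp

theorem antidiag_mul_apply {k : ℕ} (x : Matrix (Fin n) (Fin k) A) (l : Fin n) (i : Fin k) :
    (antidiag n A * x) l i = x l.rev i := by
  rw [Matrix.mul_apply, Finset.sum_eq_single l.rev]
  · simp [antidiag]
  · intro m _ hm
    rw [antidiag, Matrix.of_apply, if_neg hm, zero_mul]
  · simp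

theorem windowMatrix_eq_submatrix (r : Matrix (Fin (n + 1)) (Fin (n + 1)) A)
    (x : Matrix (Fin (n + 1)) (Fin n) A) (d t : Fin (n + 1)) :
    windowMatrix r x d t = (Matrix.fromBlocks r (x * antidiag n A)
      (antidiag n A * x.transpose) (antidiag n A)).submatrix (windowIndex d) (windowIndex t) := by
  ext a b
  rw [Matrix.submatrix_apply, ← windowIndex_eq, ← windowIndex_eq]
  rfl

/-- The ones of `J` sit where the two zero-based indices add up to `n - 1`. In the window these
indices are below `d` and `t`, so their sum is at most `d + t - 2`. -/
theorem windowMatrix_eq_hollowMatrix (r : Matrix (Fin (n + 1)) (Fin (n + 1)) A)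
    (x : Matrix (Fin (n + 1)) (Fin n) A) {d t : Fin (n + 1)} (h : (d : ℕ) + t ≤ n) :
    windowMatrix r x d t = (hollowMatrix r x).submatrix (windowIndex d) (windowIndex t) := by
  rw [windowMatrix_eq_submatrix]
  ext a b
  rw [Matrix.submatrix_apply, Matrix.submatrix_apply, windowIndex, windowIndex, hollowMatrix]
  split_ifs with ha hb hb
  · rfl
  · simp only [Matrix.fromBlocks_apply₁₂, mul_antidiag_apply, Matrix.of_apply]
  · simp only [Matrix.fromBlocks_apply₂₁, antidiag_mul_apply, Matrix.of_apply,
      Matrix.transpose_apply]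
  · rw [Matrix.fromBlocks_apply₂₂, Matrix.fromBlocks_apply₂₂, antidiag, Matrix.of_apply, if_neg,
      Matrix.zero_apply]
    intro h'
    have := congrArg Fin.val h'
    simp only [Fin.val_rev] at this
    omega

theorem hollowMatrix_submatrix_eq_displayedMatrix (r : Matrix (Fin (n + 1)) (Fin (n + 1)) A)
    (x : Matrix (Fin (n + 1)) (Fin n) A) (d t : Fin (n + 1)) :
    (hollowMatrix r x).submatrix (windowIndex d) (windowIndex t) = displayedMatrix r x d t := by
  ext a b
  rw [Matrix.submatrix_apply, windowIndex, windowIndex, hollowMatrix, displayedMatrix,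
    Matrix.of_apply]
  split_ifs with ha hb hb <;> rfl

theorem hollowMatrix_map {k : ℕ} {A' : Type*} [CommRing A'] (f : A →+* A')
    (r : Matrix (Fin k) (Fin k) A) (x : Matrix (Fin k) (Fin n) A) :
    (hollowMatrix r x).map f = hollowMatrix (r.map f) (x.map f) := by
  ext P Q
  rcases P with a | l <;> rcases Q with b | m <;> simp [hollowMatrix]

theorem map_det_hollowMatrix {A' : Type*} [CommRing A'] (f : A →+* A')
    (r : Matrix (Fin (n + 1)) (Fin (n + 1)) A) (x : Matrix (Fin (n + 1)) (Fin n) A)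
    (ρ κ : Fin (n + 1) → Fin (n + 1) ⊕ Fin n) : f ((hollowMatrix r x).submatrix ρ κ).det =
      ((hollowMatrix (r.map f) (x.map f)).submatrix ρ κ).det := by
  rw [RingHom.map_det, RingHom.mapMatrix_apply, ← hollowMatrix_map, Matrix.submatrix_map]

/-- The splitting of the window indices into those of the two blocks of `M^{(n,n+1)}`. -/
def windowSplit (d : Fin (n + 1)) : Fin (n + 1 - d) ⊕ Fin d ≃ Fin (n + 1) :=
  finSumFinEquiv.trans (finCongr (by omega))

theorem windowIndex_windowSplit_inl (d : Fin (n + 1)) (i : Fin (n + 1 - d)) :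
    windowIndex d (windowSplit d (Sum.inl i)) = Sum.inl ⟨d + i, by omega⟩ := by
  have h : ((windowSplit d (Sum.inl i) : Fin (n + 1)) : ℕ) = i := by simp [windowSplit]
  rw [windowIndex, dif_pos (by rw [h]; omega)]
  simp only [h]

theorem windowIndex_windowSplit_inr (d : Fin (n + 1)) (q : Fin d) :
    windowIndex d (windowSplit d (Sum.inr q)) = Sum.inr (Fin.castLE (Nat.lt_succ_iff.mp d.2) q) := by
  have h : ((windowSplit d (Sum.inr q) : Fin (n + 1)) : ℕ) = n + 1 - d + q := by
    simp [windowSplit]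
  rw [windowIndex, dif_neg (by rw [h]; omega)]
  congr 1
  ext
  simp only [h, Fin.val_castLE]
  omega

theorem det_hollowMatrix_submatrix (r : Matrix (Fin (n + 1)) (Fin (n + 1)) A)
    (x : Matrix (Fin (n + 1)) (Fin n) A) (d t : Fin (n + 1)) :
    ((hollowMatrix r x).submatrix (windowIndex d) (windowIndex t)).det =
    ((Matrix.fromBlocks
      (Matrix.of fun (i : Fin (n + 1 - d)) (j : Fin (n + 1 - t)) =>
        r ⟨d + i, by omega⟩ ⟨t + j, by omega⟩)
      (Matrix.of fun (i : Fin (n + 1 - d)) (p : Fin t) =>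
        x ⟨d + i, by omega⟩ (Fin.castLE (Nat.lt_succ_iff.mp t.2) p).rev)
      (Matrix.of fun (q : Fin d) (j : Fin (n + 1 - t)) =>
        x ⟨t + j, by omega⟩ (Fin.castLE (Nat.lt_succ_iff.mp d.2) q).rev) 0).submatrix
          ((windowSplit t).trans (windowSplit d).symm) id).det := by
  rw [← Matrix.det_submatrix_equiv_self (windowSplit t)]
  congr 1
  ext u v
  obtain ⟨w, hw⟩ := (windowSplit d).surjective (windowSplit t u)
  simp only [Matrix.submatrix_apply, id, Equiv.trans_apply, ← hw, Equiv.symm_apply_apply]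
  rcases w with i | q <;> rcases v with j | p
  · rw [windowIndex_windowSplit_inl, windowIndex_windowSplit_inl]
    rfl
  · rw [windowIndex_windowSplit_inl, windowIndex_windowSplit_inr]
    rfl
  · rw [windowIndex_windowSplit_inl, windowIndex_windowSplit_inr]
    rfl
  · rw [windowIndex_windowSplit_inr, windowIndex_windowSplit_inr]
    rfl

/-- Minors of order `n + 1` of a product of matrices with inner size `n` vanish. -/
theorem det_mul_eq_zero_of_inner_lt (B : Matrix (Fin (n + 1)) (Fin n) A)
    (C : Matrix (Fin n) (Fin (n + 1)) A) : (B * C).det = 0 := by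
  -- Padding with a zero column and a zero row makes both factors square.
  have h : B * C = (Matrix.of fun i => Fin.cons 0 (B i) : Matrix (Fin (n + 1)) (Fin (n + 1)) A) *
      (Matrix.of fun i j => Fin.cases 0 (fun l => C l j) i :
        Matrix (Fin (n + 1)) (Fin (n + 1)) A) := by
    ext i j
    simp [Matrix.mul_apply, Fin.sum_univ_succ]
  rw [h, Matrix.det_mul, Matrix.det_eq_zero_of_column_eq_zero 0 (by simp), zero_mul]

/-- For these values of `r` the whole matrix `M` factors through a space of rank `n`. -/
theorem det_windowMatrix_eq_zero (x : Matrix (Fin (n + 1)) (Fin n) A) (d t : Fin (n + 1)) :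
    (windowMatrix (x * antidiag n A * x.transpose) x d t).det = 0 := by
  have h : Matrix.fromBlocks (x * antidiag n A * x.transpose) (x * antidiag n A)
      (antidiag n A * x.transpose) (antidiag n A) =
      Matrix.fromRows x 1 * (antidiag n A * Matrix.fromCols x.transpose 1) := by
    rw [Matrix.mul_fromCols, Matrix.fromRows_mul_fromCols]
    simp [Matrix.mul_assoc]
  rw [windowMatrix_eq_submatrix, h, ← Matrix.submatrix_mul_equiv _ _ _ (Equiv.refl (Fin n))]
  exact det_mul_eq_zero_of_inner_lt _ _

end Windows

/-! ### The determinants as elements of the tensor products, and their weights -/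

section Elements

variable {n : ℕ}

/-- The matrix of variables. -/
def varMatrix (n k : ℕ) : Matrix (Fin k) (Fin n) (Poly n k) :=
  Matrix.of fun i l => MvPolynomial.X (i, l)

theorem quad_eq_mul_antidiag (n k : ℕ) :
    (Matrix.of fun i j => quad i j : Matrix (Fin k) (Fin k) (Poly n k)) =
      varMatrix n k * antidiag n (Poly n k) * (varMatrix n k).transpose := by
  ext i j : 1
  rw [Matrix.mul_apply, ← Equiv.sum_comp Fin.revPerm, Matrix.of_apply, quad]
  refine Finset.sum_congr rfl fun l _ => ?_
  rw [mul_antidiag_apply]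
  simp [varMatrix]

/-- `det M_{d+1,t+1}`, formed with the generators of `S(𝔭⁻)`, is an element of `S(𝔭⁻) ⊗ F`. -/
theorem det_symbolMatrix_mem_range {σ : YoungDiagram} (h2 : σ.rowLen 0 ≤ 2) {d t : Fin (n + 1)}
    (ht : σ.colLen 1 = t) (hd : σ.colLen 0 = d) :
    ((symbolMatrix n (n + 1)).submatrix (windowIndex d) (windowIndex t)).det ∈
      LinearMap.range (LinearMap.lTensor (SymPMinus (n + 1)) (glModule n (n + 1) σ).subtype) := by
  have htn := Nat.lt_succ_iff.mp t.2
  have hdn := Nat.lt_succ_iff.mp d.2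
  rw [symbolMatrix, det_hollowMatrix_submatrix]
  refine det_fromBlocks_mem _ _ _ _ (MonoidHom.mrange
    (Algebra.TensorProduct.includeLeft (R := ℂ) (S := ℂ) (A := SymPMinus (n + 1))
      (B := Poly n (n + 1))).toRingHom.toMonoidHom) (fun i j => ⟨symVar _ _, rfl⟩) _ ?_
  rintro _ ⟨s, rfl⟩ a b
  have e1 : ∀ {m : ℕ} (hm : m ≤ n) (c : Fin m → Fin (n + 1)),
      (Matrix.of fun q p : Fin m => xTensorSym n (n + 1) (c p) (Fin.castLE hm q).rev).det =
        1 ⊗ₜ[ℂ] edgeMinor hm c := by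
    intro m hm c
    exact (AlgHom.map_det (Algebra.TensorProduct.includeRight : Poly n (n + 1) →ₐ[ℂ]
      SymPMinus (n + 1) ⊗[ℂ] Poly n (n + 1)) (edgeMatrix (n + 1) hm c)).symm
  -- With `k = n + 1` the bound `d.2` is the condition `d < k`, which provides the spare row.
  refine ⟨s ⊗ₜ ⟨_, edgeMinor_mul_mem_glModule h2 ht hd htn hdn d.2
    (fun p => ⟨d + a p, by omega⟩) (fun q => ⟨t + b q, by omega⟩)⟩, ?_⟩
  rw [← Matrix.det_transpose (Matrix.submatrix _ a id)]
  refine Eq.trans ?_ (congrArg₂ (fun u v => (s ⊗ₜ[ℂ] 1) * (u * v))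
    (e1 htn fun p => ⟨d + a p, by omega⟩) (e1 hdn fun q => ⟨t + b q, by omega⟩)).symm
  simp

theorem lTensor_subtype_injective {n k : ℕ} (σ : YoungDiagram) (B : Type*) [CommRing B]
    [Algebra ℂ B] : Function.Injective (LinearMap.lTensor B (glModule n k σ).subtype) :=
  Module.Flat.lTensor_preserves_injective_linearMap _ (Submodule.injective_subtype _)

/-- On `𝓘 ⊗ 𝓟` multiplication is an algebra homomorphism, hence commutes with determinants. -/
theorem mulMap_eq {n k : ℕ} (W : Submodule ℂ (Poly n k)) (u : invariants n k ⊗[ℂ] W) :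
    mulMap W u = Algebra.TensorProduct.productMap (invariants n k).val (AlgHom.id ℂ (Poly n k))
      (LinearMap.lTensor (invariants n k) W.subtype u) := by
  induction u using TensorProduct.induction_on with
  | zero => simp
  | add u v hu hv => rw [map_add, map_add, map_add, hu, hv]
  | tmul I f => simp [mulMap]

theorem productMap_det_eq_zero {d t : Fin (n + 1)} (h : (d : ℕ) + t ≤ n) :
    Algebra.TensorProduct.productMap (invariants n (n + 1)).val (AlgHom.id ℂ (Poly n (n + 1)))
      (windowMatrix (rTensor n (n + 1)) (xTensor n (n + 1)) d t).det = 0 := by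
  rw [windowMatrix_eq_hollowMatrix _ _ h]
  refine (map_det_hollowMatrix (A := invariants n (n + 1) ⊗[ℂ] Poly n (n + 1))
    (A' := Poly n (n + 1)) (Algebra.TensorProduct.productMap (invariants n (n + 1)).val
    (AlgHom.id ℂ (Poly n (n + 1)))).toRingHom _ _ _ _).trans ?_
  rw [← windowMatrix_eq_hollowMatrix _ _ h]
  refine Eq.trans ?_ (det_windowMatrix_eq_zero (varMatrix n (n + 1)) d t)
  rw [← quad_eq_mul_antidiag]
  congr 2
  · ext i j : 1
    simp [rTensor, quadInv]
  · ext i j : 1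
    simp [xTensor, varMatrix]

theorem lTensor_vermaProj {k : ℕ} (σ : YoungDiagram) (u : SymPMinus k ⊗[ℂ] glModule n k σ) :
    LinearMap.lTensor (invariants n k) (glModule n k σ).subtype (vermaProj σ u) =
      Algebra.TensorProduct.map (toInvariants n k) (AlgHom.id ℂ (Poly n k))
        (LinearMap.lTensor (SymPMinus k) (glModule n k σ).subtype u) := by
  induction u using TensorProduct.induction_on with
  | zero => simp
  | add u v hu hv => simp only [map_add, hu, hv]
  | tmul I f => simp [vermaProj]

theorem map_det_symbolMatrix (ρ κ : Fin (n + 1) → Fin (n + 1) ⊕ Fin n) :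
    Algebra.TensorProduct.map (toInvariants n (n + 1)) (AlgHom.id ℂ (Poly n (n + 1)))
      ((symbolMatrix n (n + 1)).submatrix ρ κ).det =
    ((hollowMatrix (rTensor n (n + 1)) (xTensor n (n + 1))).submatrix ρ κ).det := by
  refine (map_det_hollowMatrix (A := SymPMinus (n + 1) ⊗[ℂ] Poly n (n + 1))
    (A' := invariants n (n + 1) ⊗[ℂ] Poly n (n + 1)) (Algebra.TensorProduct.map (toInvariants n (n + 1))
    (AlgHom.id ℂ (Poly n (n + 1)))).toRingHom _ _ _ _).trans ?_
  congr 3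
  · ext i j : 1
    simp [sTensor, rTensor, symVar, toInvariants]
  · ext i j : 1
    simp [xTensorSym, xTensor]

/-- Equivariance of `S(𝔭⁻) → 𝓘` is checked on the generators, as `h_{ij}` acts on both algebras by
derivations. -/
theorem glAction_vermaProj {k : ℕ} (σ : YoungDiagram) (i j : Fin k)
    (u : SymPMinus k ⊗[ℂ] glModule n k σ) :
    glAction σ i j (vermaProj σ u) = vermaProj σ (vermaMixed σ i j u) := by
  have h : ∀ s : SymPMinus k, polarizationInv i j (toInvariants n k s) =
      toInvariants n k (adMixed i j s) := by
    intro s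
    induction s using MvPolynomial.induction_on with
    | C c =>
      rw [← MvPolynomial.algebraMap_eq, Derivation.map_algebraMap, map_zero, AlgHom.commutes]
      exact Subtype.ext (Derivation.map_algebraMap _ _)
    | add p q hp hq => simp only [map_add, hp, hq]
    | mul_X p z hp =>
      have hX : polarizationInv i j (toInvariants n k (MvPolynomial.X z)) =
          toInvariants n k (adMixed i j (MvPolynomial.X z)) := by
        induction z with | _ a b
        have hs : ∀ a b : Fin k, toInvariants n k (symVar a b) = quadInv a b := fun a b => by
          simp [toInvariants, symVar]
        rw [adMixed, MvPolynomial.mkDerivation_X, Sym2.lift_mk, map_add, apply_ite (toInvariants n k),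
          apply_ite (toInvariants n k), hs, hs, map_zero]
        refine Subtype.ext ?_
        rw [show toInvariants n k (MvPolynomial.X s(a, b)) = quadInv a b from hs a b]
        change polarization i j (quad a b) = _
        rw [quad, map_sum]
        simp only [Derivation.leibniz, polarization_X, smul_eq_mul, Finset.sum_add_distrib,
          Subalgebra.coe_add, apply_ite (Subtype.val), ZeroMemClass.coe_zero, quadInv]
        rw [add_comm]
        congr 1
        · by_cases hj : a = j
          · simp only [hj, if_true]
            rw [quad_comm, quad, ← Equiv.sum_comp Fin.revPerm]
            exact Finset.sum_congr rfl fun l _ => by simp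
          · simp [hj, Ne.symm hj]
        · by_cases hj : b = j
          · simp only [hj, if_true]
            rw [quad_comm, quad]
          · simp [hj, Ne.symm hj]
      have hl : ∀ P Q : invariants n k, polarizationInv i j (P * Q) =
          P * polarizationInv i j Q + Q * polarizationInv i j P := fun P Q =>
        Subtype.ext (Derivation.leibniz _ _ _)
      rw [map_mul, hl, hp, hX, Derivation.leibniz, map_add, smul_eq_mul, smul_eq_mul, map_mul,
        map_mul]
  induction u using TensorProduct.induction_on with
  | zero => simp
  | add u v hu hv => simp only [map_add, hu, hv]
  | tmul s f => simp [vermaProj, glAction, vermaMixed, h]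

theorem sum_symbolDelta_mul {k : ℕ} (i j : Fin k) {N : ℕ} {ρ : Fin N → Fin k ⊕ Fin n}
    (hρ : Function.Injective ρ) [Decidable (Sum.inl i ∈ Set.range ρ)] :
    ∑ a, symbolDelta n j (ρ a) * symbolDelta n i (ρ a) =
      if i = j ∧ Sum.inl i ∈ Set.range ρ then 1 else 0 := by
  by_cases h : i = j ∧ Sum.inl i ∈ Set.range ρ
  · obtain ⟨rfl, c, hc⟩ := h
    rw [if_pos ⟨rfl, c, hc⟩, Finset.sum_eq_single c]
    · simp [symbolDelta, hc]
    · intro a _ ha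
      rw [symbolDelta, if_neg fun h => ha (hρ (h.symm.trans hc.symm)), zero_mul]
    · simp
  · rw [if_neg h]
    refine Finset.sum_eq_zero fun a _ => ?_
    by_cases hi : Sum.inl i = ρ a
    · have hij : Sum.inl j ≠ ρ a := fun hj => h ⟨Sum.inl_injective (hi.trans hj.symm), a, hi.symm⟩
      rw [symbolDelta, if_neg hij, zero_mul]
    · rw [mul_comm, symbolDelta, if_neg hi, zero_mul]

/-- The weight of `D_σ`. -/
def determinantWeight (n : ℕ) (t d : Fin (n + 1)) : Weight (n + 1) := fun i =>
  -((n : ℚ) / 2 + (if d ≤ i then 1 else 0) + if t ≤ i then 1 else 0)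

/-- A non-zero element of `N(σ^♯)` given by the determinant is a highest weight vector. -/
theorem isSPHighestWeightVector_of_lTensor_eq_det {σ : YoungDiagram} {d t : Fin (n + 1)}
    {u : SymPMinus (n + 1) ⊗[ℂ] glModule n (n + 1) σ} (hu : u ≠ 0)
    (h : LinearMap.lTensor (SymPMinus (n + 1)) (glModule n (n + 1) σ).subtype u =
      ((symbolMatrix n (n + 1)).submatrix (windowIndex d) (windowIndex t)).det) :
    IsSPHighestWeightVector (vermaMixed σ) (vermaLaplace σ) (determinantWeight n t d) u := by
  refine ⟨⟨hu, fun i => ?_, fun i j hij => ?_⟩, fun i j => ?_⟩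
  · refine lTensor_subtype_injective σ (SymPMinus (n + 1)) ?_
    rw [map_neg, lTensor_vermaMixed, map_smul, h, totalPolarization_det i i
      (windowIndex_injective d) (windowIndex_injective t) id id]
    classical
    -- For equal indices the traces count whether `i` occurs among the rows (`d ≤ i`) and among the
    -- columns (`t ≤ i`).
    rw [sum_symbolDelta_mul i i (windowIndex_injective d),
      sum_symbolDelta_mul i i (windowIndex_injective t)]
    simp only [inl_mem_range_windowIndex, true_and, if_true, determinantWeight]
    push_cast
    refine Eq.trans (congrArg Neg.neg ?_) (neg_smul _ _).symm
    have hs : ∀ (c : ℂ) (v : SymPMinus (n + 1) ⊗[ℂ] Poly n (n + 1)),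
        c • v = algebraMap ℂ _ c * v := fun c v => Algebra.smul_def c v
    rw [hs, hs, map_add, map_add]
    split_ifs <;> simp only [Rat.cast_one, Rat.cast_zero, map_one, map_zero] <;> ring
  · refine lTensor_subtype_injective σ (SymPMinus (n + 1)) ?_
    -- Windows are closed under passing to larger indices, so the row or column `j` that replaces
    -- `i` is already present.
    have hm : ∀ c : Fin (n + 1), Sum.inl i ∈ Set.range (windowIndex c) →
        Sum.inl j ∈ Set.range (windowIndex c) := fun c hc => by
      rw [inl_mem_range_windowIndex] at hc ⊢
      exact hc.trans hij.le
    rw [lTensor_vermaMixed, map_zero, h, totalPolarization_det j i (windowIndex_injective d)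
      (windowIndex_injective t) (hm d) (hm t)]
    classical
    rw [sum_symbolDelta_mul j i (windowIndex_injective d),
      sum_symbolDelta_mul j i (windowIndex_injective t)]
    simp [hij.ne']
  · refine lTensor_subtype_injective σ (SymPMinus (n + 1)) ?_
    rw [lTensor_vermaLaplace, map_zero, h, totalLaplace_det]

end Elements

/-! ### The determinant does not vanish -/

section NonVanishing

variable {n : ℕ}

/-- Rows `e_a + √-1 e_{n+1-a}`, `a = i - d`, for `d < i ≤ n + 1 - t`, and zero rows otherwise. Their
Gram matrix for the form `J` is `2 √-1` on the diagonal. -/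
def isotropicShift (n d t : ℕ) (i : Fin (n + 1)) (l : Fin n) : ℂ :=
  if d ≤ (i : ℕ) ∧ (i : ℕ) + t < n + 1 then
    (if (l : ℕ) = i - d then 1 else 0) + Complex.I * if (l.rev : ℕ) = i - d then 1 else 0
  else 0

/-- The coefficient `√-1` serves the rows belonging to dual indices `a` and `n + 1 - a`: the two
contributions to their product are `1` and `(√-1)² = -1`. The condition `0 < d` ensures that `i - d`
is a column index. -/
theorem sum_isotropicShift {d : ℕ} (hd : 0 < d) (t : ℕ) (i j : Fin (n + 1)) :
    ∑ l, isotropicShift n d t i l * isotropicShift n d t j l.rev =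
      if i = j ∧ d ≤ (i : ℕ) ∧ (i : ℕ) + t < n + 1 then 2 * Complex.I else 0 := by
  by_cases hi : d ≤ (i : ℕ) ∧ (i : ℕ) + t < n + 1
  swap
  · rw [if_neg fun h => hi h.2]
    exact Finset.sum_eq_zero fun l _ => by rw [isotropicShift, if_neg hi, zero_mul]
  by_cases hj : d ≤ (j : ℕ) ∧ (j : ℕ) + t < n + 1
  swap
  · rw [if_neg (by rintro ⟨rfl, h⟩; exact hj h)]
    exact Finset.sum_eq_zero fun l _ => by
      rw [isotropicShift, isotropicShift, if_neg hj, mul_zero]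
  obtain ⟨a, ha⟩ : ∃ a : Fin n, (a : ℕ) = i - d := ⟨⟨i - d, by omega⟩, rfl⟩
  obtain ⟨b, hb⟩ : ∃ b : Fin n, (b : ℕ) = j - d := ⟨⟨j - d, by omega⟩, rfl⟩
  have hterm : ∀ l : Fin n, isotropicShift n d t i l * isotropicShift n d t j l.rev =
      (if l = a then (if l.rev = b then 1 else 0) + Complex.I * (if l = b then 1 else 0) else 0) +
      if l = a.rev then Complex.I * (if l.rev = b then 1 else 0) - (if l = b then 1 else 0)
        else 0 := by
    intro l
    rw [isotropicShift, isotropicShift, if_pos hi, if_pos hj, Fin.rev_rev, ← ha, ← hb]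
    simp only [← Fin.ext_iff, Fin.rev_eq_iff (i := l) (j := a)]
    have hI := Complex.I_mul_I
    split_ifs <;> first | ring1 | linear_combination hI
  rw [Finset.sum_congr rfl fun l _ => hterm l, Finset.sum_add_distrib, Finset.sum_ite_eq',
    Finset.sum_ite_eq', if_pos (Finset.mem_univ _), if_pos (Finset.mem_univ _), Fin.rev_rev]
  have hij : (i = j ∧ d ≤ (i : ℕ) ∧ (i : ℕ) + t < n + 1) ↔ a = b := by
    rw [Fin.ext_iff, Fin.ext_iff, ha, hb]
    omega
  rw [if_congr hij rfl rfl]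
  split_ifs <;> ring

/-- A `0`-`1` matrix with a single non-zero entry in each of its last columns. -/
def partialPermutation (n d t : ℕ) (i : Fin (n + 1)) (l : Fin n) : ℂ :=
  if ((l.rev : ℕ) < t ∧ (i : ℕ) + l.rev = n) ∨
    (t ≤ (l.rev : ℕ) ∧ (l.rev : ℕ) < d ∧ (i : ℕ) = l.rev) then 1 else 0

theorem det_monomial_ne_zero {N : ℕ} (M : Matrix (Fin N) (Fin N) ℂ) (f : Fin N → Fin N)
    (hf : Function.Injective f) (c : Fin N → ℂ) (hc : ∀ a, c a ≠ 0)
    (hM : ∀ a b, M a b = if b = f a then c a else 0) : M.det ≠ 0 := by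
  let e : Equiv.Perm (Fin N) := Equiv.ofBijective f (Finite.injective_iff_bijective.mp hf)
  have h : M = (Matrix.diagonal c).submatrix id e.symm := by
    ext a b
    rw [hM, Matrix.submatrix_apply, Matrix.diagonal_apply]
    refine if_congr ?_ rfl rfl
    rw [id, Equiv.eq_symm_apply]
    exact eq_comm
  rw [h, Matrix.det_permute', Matrix.det_diagonal]
  refine mul_ne_zero ?_ (Finset.prod_ne_zero_iff.mpr fun a _ => hc a)
  exact Int.cast_ne_zero.mpr (Units.ne_zero _)

/-- At these values every row and column has one non-zero entry. The diagonal `r`-entries occupy the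
columns of index `d, …, n - t`. In the last rows, the `x`-entries occupy the remaining `r`-columns:
the indices above `n - t` through the first `t` of these rows, and `t, …, d - 1` through the others.
The last `t` columns meet the rows of index above `n - t`. -/
theorem det_displayedMatrix_ne_zero {d t : Fin (n + 1)} (htd : t ≤ d) (h : (d : ℕ) + t ≤ n) :
    (displayedMatrix (Matrix.of fun i j : Fin (n + 1) =>
      if i = j ∧ (d : ℕ) ≤ (i : ℕ) ∧ (i : ℕ) + t < n + 1 then 2 * Complex.I else 0)
      (Matrix.of (partialPermutation n d t)) d t).det ≠ 0 := by
  rw [Fin.le_def] at htd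
  -- The column of the non-zero entry of row `a`. The middle formula covers both antidiagonal
  -- pieces, the `x`-entries in the upper right and those in the lower left.
  let f : ℕ → ℕ := fun a => if a + d + t < n + 1 then d - t + a else
    if a + d < n + 1 + t then 2 * n + 1 - t - d - a else a + d - (n + 1) - t
  have hf : ∀ a, a < n + 1 → f a < n + 1 := by
    intro a ha
    simp only [f]
    split_ifs <;> omega
  refine det_monomial_ne_zero _ (fun a => ⟨f a, hf a a.2⟩) ?_
    (fun a => if (a : ℕ) + d + t < n + 1 then 2 * Complex.I else 1) ?_ ?_
  · intro a b hab
    have := congrArg Fin.val hab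
    simp only [f] at this
    ext
    split_ifs at this <;> omega
  · intro a
    split_ifs <;> simp
  · intro a b
    have ha := a.2
    have hb := b.2
    simp only [displayedMatrix, Matrix.of_apply, partialPermutation, Fin.rev_rev, Fin.ext_iff, f]
    split_ifs <;> first | rfl | (exfalso; omega)

/-- The variables of the two tensor factors are independent: the `r`-entries are evaluated at one
point and the `x`-entries at another. At a common point the determinant would vanish. -/
theorem det_window_ne_zero {d t : Fin (n + 1)} (hd : 0 < (d : ℕ)) (htd : t ≤ d)
    (h : (d : ℕ) + t ≤ n) : ((hollowMatrix (rTensor n (n + 1)) (xTensor n (n + 1))).submatrix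
      (windowIndex d) (windowIndex t)).det ≠ 0 := by
  let ev : invariants n (n + 1) ⊗[ℂ] Poly n (n + 1) →ₐ[ℂ] ℂ :=
    Algebra.TensorProduct.productMap
      ((MvPolynomial.aeval fun p => isotropicShift n d t p.1 p.2).comp (invariants n (n + 1)).val)
      (MvPolynomial.aeval fun p => partialPermutation n d t p.1 p.2)
  intro h0
  have h1 := map_det_hollowMatrix (A := invariants n (n + 1) ⊗[ℂ] Poly n (n + 1)) (A' := ℂ)
    ev.toRingHom (rTensor n (n + 1)) (xTensor n (n + 1)) (windowIndex d) (windowIndex t)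
  rw [h0, map_zero, hollowMatrix_submatrix_eq_displayedMatrix] at h1
  refine det_displayedMatrix_ne_zero htd h (Eq.trans ?_ h1.symm)
  congr 2
  · ext i j
    rw [Matrix.of_apply, ← sum_isotropicShift hd]
    simp [ev, rTensor, quadInv, quad]
  · ext i l
    simp [ev, xTensor]

end NonVanishing

/-! ### The weight `λ'_{(n+1)}(σ)` -/

section Weights

theorem eps_apply {k : ℕ} (i j : Fin k) : (eps i : Weight k) j = if j = i then 1 else 0 :=
  Pi.single_apply i 1 j

theorem eps_dotProduct {k : ℕ} (i : Fin k) (x : Weight k) : eps i ⬝ᵥ x = x i := by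
  simp [eps]

theorem rho_apply {k : ℕ} (i : Fin k) : rho k i = k - i := by
  have h1 : ∑ a : Fin k, ∑ b : Fin k, (if a < b then (eps a i : ℚ) - eps b i else 0) =
      (k - 1 - i) - i := by
    have e : ∀ a b : Fin k, (if a < b then (eps a i : ℚ) - eps b i else 0) =
        (if i = a then if a < b then 1 else 0 else 0) -
          if i = b then if a < b then 1 else 0 else 0 := by
      intro a b
      simp only [eps_apply]
      split_ifs <;> simp
    simp only [e, Finset.sum_sub_distrib]
    rw [Finset.sum_comm]
    simp only [Finset.sum_ite_eq, Finset.mem_univ, if_true, Finset.sum_boole]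
    rw [show (Finset.univ.filter fun b => i < b) = Finset.Ioi i by ext; simp,
      show (Finset.univ.filter fun b => b < i) = Finset.Iio i by ext; simp, Fin.card_Ioi,
      Fin.card_Iio, Nat.sub_sub, Nat.cast_sub (by omega)]
    push_cast
    ring
  have h2 : ∑ a : Fin k, ∑ b : Fin k, (if a ≤ b then (eps a i : ℚ) + eps b i else 0) =
      (k - i) + (i + 1) := by
    have e : ∀ a b : Fin k, (if a ≤ b then (eps a i : ℚ) + eps b i else 0) =
        (if i = a then if a ≤ b then 1 else 0 else 0) +
          if i = b then if a ≤ b then 1 else 0 else 0 := by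
      intro a b
      simp only [eps_apply]
      split_ifs <;> simp
    simp only [e, Finset.sum_add_distrib]
    rw [Finset.sum_comm]
    simp only [Finset.sum_ite_eq, Finset.mem_univ, if_true, Finset.sum_boole]
    rw [show (Finset.univ.filter fun b => i ≤ b) = Finset.Ici i by ext; simp,
      show (Finset.univ.filter fun b => b ≤ i) = Finset.Iic i by ext; simp, Fin.card_Ici,
      Fin.card_Iic, Nat.cast_sub (by omega)]
    simp
  rw [rho, Pi.smul_apply, Pi.add_apply, Finset.sum_apply, Finset.sum_apply, Finset.sum_filter,
    Finset.sum_filter, Fintype.sum_prod_type, Fintype.sum_prod_type]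
  simp only [Pi.sub_apply, Pi.add_apply]
  rw [h1, h2, smul_eq_mul]
  ring

/-- `n / 2` plus the coordinates of `σ^♯ + ρ` for `σ` of type `(t, d)` and `k = n + 1`. -/
def shiftedIndex {n : ℕ} (t d i : Fin (n + 1)) : ℤ :=
  n + 1 - (i : ℕ) - (if n < (i : ℕ) + t then 1 else 0) - if n < (i : ℕ) + d then 1 else 0

theorem sharp_add_rho_apply {n : ℕ} {σ : YoungDiagram} (h2 : σ.rowLen 0 ≤ 2) {t d : Fin (n + 1)}
    (ht : σ.colLen 1 = t) (hd : σ.colLen 0 = d) (i : Fin (n + 1)) :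
    (sharp n (n + 1) σ + rho (n + 1)) i = shiftedIndex t d i - (n : ℚ) / 2 := by
  have h3 : ∀ c : Fin (n + 1), (i.rev : ℕ) < c ↔ n < (i : ℕ) + c := fun c => by
    rw [Fin.val_rev]
    omega
  rw [Pi.add_apply, sharp, rho_apply, rowLen_eq h2 ht hd, shiftedIndex]
  simp only [h3]
  push_cast
  ring

/-! ### The set `Γ` and the reflected weight -/

section Gamma

variable {n : ℕ} {t d w : Fin (n + 1)}

/-- The values of `shiftedIndex` are the integers from `-1` to `n + 1` except `t - 1` and `d`. So a
position lacks a partner only if its value is `n + 1 - t`, attained at `t`, or `n - d`, attained at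
`w`. If `2 d = n`, the latter value is the missing `d` itself, and `w = t`. -/
theorem exists_shiftedIndex_add (htd : (t : ℕ) ≤ d) (h : (d : ℕ) + t ≤ n)
    (hw : (w : ℕ) = if 2 * (d : ℕ) = n then (t : ℕ) else if n < 2 * (d : ℕ) then d else d + 1)
    {i : Fin (n + 1)} (hit : i ≠ t) (hiw : i ≠ w) :
    ∃ j, shiftedIndex t d i + shiftedIndex t d j = n := by
  rw [Ne, Fin.ext_iff] at hit hiw
  have hi := i.2
  obtain ⟨y, hy⟩ : ∃ y : ℤ, y = n - shiftedIndex t d i := ⟨_, rfl⟩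
  have hb : -1 ≤ y ∧ y ≤ n + 1 ∧ y ≠ t - 1 ∧ y ≠ d := by
    simp only [shiftedIndex] at hy
    split_ifs at hy hw <;> omega
  -- The preimage of `y` in each of the three runs of consecutive values.
  refine ⟨⟨(if y ≤ (t : ℕ) - 2 then n - 1 - y else if y ≤ (d : ℕ) - 1 then n - y else
    n + 1 - y).toNat, by split_ifs <;> omega⟩, ?_⟩
  have : shiftedIndex t d ⟨(if y ≤ (t : ℕ) - 2 then n - 1 - y else if y ≤ (d : ℕ) - 1 then n - y
      else n + 1 - y).toNat, by split_ifs <;> omega⟩ = y := by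
    simp only [shiftedIndex]
    by_cases h1 : y ≤ (t : ℕ) - 2
    · simp only [h1, if_true]
      split_ifs <;> omega
    · by_cases h2 : y ≤ (d : ℕ) - 1
      · simp only [h1, h2, if_true, if_false]
        split_ifs <;> omega
      · simp only [h1, h2, if_false]
        split_ifs <;> omega
  omega

theorem ne_of_shiftedIndex_add (htd : (t : ℕ) ≤ d) (h : (d : ℕ) + t ≤ n)
    (hw : (w : ℕ) = if 2 * (d : ℕ) = n then (t : ℕ) else if n < 2 * (d : ℕ) then d else d + 1)
    {i j : Fin (n + 1)} (hij : shiftedIndex t d i + shiftedIndex t d j = n) : i ≠ t ∧ i ≠ w := by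
  rw [Ne, Ne, Fin.ext_iff, Fin.ext_iff]
  have hi := i.2
  have hj := j.2
  simp only [shiftedIndex] at hij
  constructor
  · intro hit
    split_ifs at hij <;> omega
  · intro hiw
    split_ifs at hij hw <;> omega

theorem shiftedIndex_injective (htd : (t : ℕ) ≤ d) : Function.Injective (shiftedIndex t d) := by
  intro i j hij
  ext
  simp only [shiftedIndex] at hij
  split_ifs at hij <;> omega

theorem shiftedIndex_first (h : (d : ℕ) + t ≤ n) (htd : (t : ℕ) ≤ d) :
    shiftedIndex t d t = n + 1 - (t : ℕ) := by
  simp only [shiftedIndex]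
  split_ifs <;> omega

theorem shiftedIndex_second (htd : (t : ℕ) ≤ d) (h : (d : ℕ) + t ≤ n) (hd : 2 * (d : ℕ) ≠ n)
    (hw : (w : ℕ) = if 2 * (d : ℕ) = n then (t : ℕ) else if n < 2 * (d : ℕ) then d else d + 1) :
    shiftedIndex t d w = n - (d : ℕ) := by
  simp only [shiftedIndex]
  split_ifs at hw ⊢ <;> omega

/-- For even `n` the midpoint `n / 2` is a value unless it equals `d`; its position is its own
partner, which yields a long root in `Ψ`. -/
theorem exists_shiftedIndex_eq (htd : (t : ℕ) ≤ d) (h : (d : ℕ) + t ≤ n) {m : ℕ} (hm : 2 * m = n)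
    (hd : 2 * (d : ℕ) ≠ n) : ∃ i, 2 * shiftedIndex t d i = n := by
  have hd' := d.2
  refine ⟨⟨if m < d then m else m + 1, by split_ifs <;> omega⟩, ?_⟩
  simp only [shiftedIndex]
  by_cases hmd : m < (d : ℕ)
  · simp only [hmd, if_true]
    split_ifs <;> omega
  · simp only [hmd, if_false]
    split_ifs <;> omega

variable {lam : Weight (n + 1)}

theorem eps_add_mem_singularRoots
    (hv : ∀ i, (lam + rho (n + 1)) i = shiftedIndex t d i - (n : ℚ) / 2) {i j : Fin (n + 1)}
    (hij : shiftedIndex t d i + shiftedIndex t d j = n) : eps i + eps j ∈ singularRoots lam := by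
  constructor
  · left
    right
    rcases le_total i j with h | h
    · exact ⟨i, j, h, rfl⟩
    · exact ⟨j, i, h, add_comm _ _⟩
  · rw [add_dotProduct, eps_dotProduct, eps_dotProduct, hv, hv]
    have : (shiftedIndex t d i : ℚ) + shiftedIndex t d j = n := by exact_mod_cast hij
    linarith

/-- Roots orthogonal to `λ + ρ` are, up to sign, sums `ε_i + ε_j` with opposite coordinates. -/
theorem exists_of_mem_singularRoots (htd : (t : ℕ) ≤ d)
    (hv : ∀ i, (lam + rho (n + 1)) i = shiftedIndex t d i - (n : ℚ) / 2) {β : Weight (n + 1)}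
    (hβ : β ∈ singularRoots lam) : ∃ i j, shiftedIndex t d i + shiftedIndex t d j = n ∧
      (β = eps i + eps j ∨ β = -(eps i + eps j)) := by
  have key : ∀ β ∈ posRoots (n + 1), β ⬝ᵥ (lam + rho (n + 1)) = 0 →
      ∃ i j, shiftedIndex t d i + shiftedIndex t d j = n ∧ β = eps i + eps j := by
    rintro β (⟨i, j, hij, rfl⟩ | ⟨i, j, -, rfl⟩) h0
    · exfalso
      rw [sub_dotProduct, eps_dotProduct, eps_dotProduct, hv, hv] at h0
      have : (shiftedIndex t d i : ℚ) = shiftedIndex t d j := by linarith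
      exact hij.ne (shiftedIndex_injective htd (by exact_mod_cast this))
    · refine ⟨i, j, ?_, rfl⟩
      rw [add_dotProduct, eps_dotProduct, eps_dotProduct, hv, hv] at h0
      have : (shiftedIndex t d i : ℚ) + shiftedIndex t d j = n := by linarith
      exact_mod_cast this
  obtain ⟨hr | hr, h0⟩ := hβ
  · obtain ⟨i, j, h1, h2⟩ := key β hr h0
    exact ⟨i, j, h1, Or.inl h2⟩
  · obtain ⟨i, j, h1, h2⟩ := key (-β) hr (by rw [neg_dotProduct, h0, neg_zero])
    exact ⟨i, j, h1, Or.inr (by rw [← h2, neg_neg])⟩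

theorem eps_add_dotProduct_eps_add {k : ℕ} (a b i j : Fin k) :
    (eps a + eps b) ⬝ᵥ (eps i + eps j : Weight k) =
      ((if a = i then 1 else 0) + if a = j then 1 else 0) +
        ((if b = i then 1 else 0) + if b = j then 1 else 0) := by
  rw [add_dotProduct, eps_dotProduct, eps_dotProduct, Pi.add_apply, Pi.add_apply, eps_apply,
    eps_apply, eps_apply, eps_apply]

/-- The pairing with the coroot is `(n + 1 - t) + (n - d) - n` for a short root, and `(n + 1 - t) -
n / 2` for the long root occurring when `2 d = n`. In the long case `n / 2 = d` is a missing value,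
so `Ψ` has no long root. -/
theorem eps_add_eps_mem_gammaSet (htd : (t : ℕ) ≤ d) (h : (d : ℕ) + t ≤ n)
    (hw : (w : ℕ) = if 2 * (d : ℕ) = n then (t : ℕ) else if n < 2 * (d : ℕ) then d else d + 1)
    (hv : ∀ i, (lam + rho (n + 1)) i = shiftedIndex t d i - (n : ℚ) / 2) :
    eps t + eps w ∈ gammaSet lam := by
  have h1 := shiftedIndex_first h htd
  refine ⟨⟨t, w, ?_, rfl⟩, ?_, ?_, ?_⟩
  · rw [Fin.le_def, hw]
    split_ifs <;> omega
  · rw [corootPairing, eps_add_dotProduct_eps_add, dotProduct_comm, add_dotProduct, eps_dotProduct,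
      eps_dotProduct, hv, hv, h1]
    by_cases hd : 2 * (d : ℕ) = n
    · have hwt : w = t := Fin.ext (by rw [hw, if_pos hd])
      refine ⟨d + 1 - t, by omega, ?_⟩
      have hdq : (n : ℚ) = 2 * (d : ℕ) := by exact_mod_cast hd.symm
      rw [hwt, h1, Nat.cast_sub (by omega)]
      simp only [if_true]
      push_cast
      rw [hdq]
      ring
    · have hwt : t ≠ w := by
        rw [Ne, Fin.ext_iff, hw]
        split_ifs <;> omega
      refine ⟨n + 1 - t - d, by omega, ?_⟩
      rw [shiftedIndex_second htd h hd hw, Nat.sub_sub, Nat.cast_sub (by omega)]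
      simp only [if_true, if_neg hwt, if_neg hwt.symm]
      push_cast
      ring
  · intro β hβ
    obtain ⟨i, j, hij, hβ⟩ := exists_of_mem_singularRoots htd hv hβ
    have hi := ne_of_shiftedIndex_add htd h hw hij
    have hj := ne_of_shiftedIndex_add htd h hw ((add_comm _ _).trans hij)
    have h0 : (eps t + eps w) ⬝ᵥ (eps i + eps j : Weight (n + 1)) = 0 := by
      rw [eps_add_dotProduct_eps_add, if_neg hi.1.symm, if_neg hi.2.symm, if_neg hj.1.symm,
        if_neg hj.2.symm]
      norm_num
    rcases hβ with rfl | rfl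
    · exact h0
    · rw [dotProduct_neg, h0, neg_zero]
  · rintro ⟨β, hβ, h4⟩
    by_cases hd : 2 * (d : ℕ) = n
    · exfalso
      obtain ⟨i, j, hij, hβ⟩ := exists_of_mem_singularRoots htd hv hβ
      have h5 : (eps i + eps j) ⬝ᵥ (eps i + eps j : Weight (n + 1)) = 4 := by
        rcases hβ with rfl | rfl
        · exact h4
        · rwa [neg_dotProduct, dotProduct_neg, neg_neg] at h4
      have hieq : i = j := by
        by_contra hne
        rw [eps_add_dotProduct_eps_add, if_pos rfl, if_pos rfl, if_neg hne,
          if_neg (Ne.symm hne)] at h5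
        norm_num at h5
      subst hieq
      simp only [shiftedIndex] at hij
      split_ifs at hij <;> omega
    · have hwt : t ≠ w := by
        rw [Ne, Fin.ext_iff, hw]
        split_ifs <;> omega
      rw [eps_add_dotProduct_eps_add, if_pos rfl, if_pos rfl, if_neg hwt, if_neg hwt.symm]
      norm_num

/-- Orthogonality to `Ψ` excludes every position that has a partner. Of the roots supported on `t`
and `w`, the long ones are excluded for `2 d ≠ n`, by integrality if `n` is odd and by condition
(iii) if `n` is even. -/
theorem eq_of_mem_gammaSet (htd : (t : ℕ) ≤ d) (h : (d : ℕ) + t ≤ n)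
    (hw : (w : ℕ) = if 2 * (d : ℕ) = n then (t : ℕ) else if n < 2 * (d : ℕ) then d else d + 1)
    (hv : ∀ i, (lam + rho (n + 1)) i = shiftedIndex t d i - (n : ℚ) / 2) {α : Weight (n + 1)}
    (hα : α ∈ gammaSet lam) : α = eps t + eps w := by
  obtain ⟨⟨i, j, hij, rfl⟩, ⟨m, -, hm⟩, horth, hshort⟩ := hα
  have hmem : ∀ a b : Fin (n + 1), (∀ β ∈ singularRoots lam, (eps a + eps b) ⬝ᵥ β = 0) →
      a = t ∨ a = w := by
    intro a b hab
    by_contra! hne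
    obtain ⟨c, hc⟩ := exists_shiftedIndex_add htd h hw hne.1 hne.2
    have h0 := hab _ (eps_add_mem_singularRoots hv hc)
    rw [eps_add_dotProduct_eps_add, if_pos rfl] at h0
    have hnn : ∀ (p : Prop) [Decidable p], (0 : ℚ) ≤ if p then 1 else 0 := fun p _ => by
      split_ifs <;> norm_num
    linarith [hnn (a = c), hnn (b = a), hnn (b = c)]
  have hlong : i = j → 2 * (d : ℕ) = n := by
    rintro rfl
    by_contra hd
    have e4 : (eps i + eps i) ⬝ᵥ (eps i + eps i : Weight (n + 1)) = 4 := by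
      rw [eps_add_dotProduct_eps_add, if_pos rfl]
      norm_num
    have hpair : (shiftedIndex t d i : ℚ) - n / 2 = m := by
      rw [← hm, corootPairing, e4, dotProduct_comm, add_dotProduct, eps_dotProduct, hv]
      ring
    have hpair' : 2 * shiftedIndex t d i - n = 2 * m := by
      have : 2 * (shiftedIndex t d i : ℚ) - n = 2 * m := by linarith
      exact_mod_cast this
    -- Integrality of the pairing with a long root makes `n` even, so the midpoint `n / 2` is
    -- available.
    obtain ⟨c, hc⟩ := exists_shiftedIndex_eq htd h (m := n / 2) (by omega) hd
    have h2 := hshort ⟨_, eps_add_mem_singularRoots hv (by rw [← two_mul]; exact hc), by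
      rw [eps_add_dotProduct_eps_add, if_pos rfl]
      norm_num⟩
    rw [e4] at h2
    norm_num at h2
  have hi := hmem i j horth
  have hj := hmem j i fun β hβ => by rw [add_comm (eps j), horth β hβ]
  by_cases hwt : w = t
  · rw [hwt, or_self] at hi hj
    rw [hi, hj, hwt]
  · have hd : 2 * (d : ℕ) ≠ n := fun hd => hwt (Fin.ext (by rw [hw, if_pos hd]))
    have hlt : t < w := by
      rw [Fin.lt_def, hw]
      split_ifs <;> omega
    rcases hi with hi | hi <;> rcases hj with hj | hj
    · exact absurd (hlong (hi.trans hj.symm)) hd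
    · rw [hi, hj]
    · rw [hi, hj] at hij
      exact absurd hij hlt.not_ge
    · exact absurd (hlong (hi.trans hj.symm)) hd

theorem dominantRep_eq_of_perm {k : ℕ} {μ f : Weight k} (e : Equiv.Perm (Fin k))
    (hμ : μ = f ∘ e) (hf : Antitone f) : dominantRep μ = f := by
  have h1 : (-μ) ∘ Tuple.sort (-μ) = -f := by
    have h2 : -μ = (-f) ∘ e := by rw [hμ]; rfl
    rw [h2, Tuple.comp_perm_comp_sort_eq_comp_sort,
      (Tuple.sort_eq_refl_iff_monotone (f := -f)).mpr hf.neg]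
    rfl
  funext i
  have := congrFun h1 i
  simp only [Function.comp_apply, Pi.neg_apply, neg_inj] at this
  exact this

/-- Write `μ` for `λ + ρ`. The reflection sends `μ_t, μ_w` to `-μ_w, -μ_t`, and the other
coordinates occur in opposite pairs. Hence the reflected weight is a permutation of `-μ`, whose
decreasing rearrangement is `-μ` read backwards. -/
theorem dominantRep_reflect (htd : (t : ℕ) ≤ d) (h : (d : ℕ) + t ≤ n)
    (hw : (w : ℕ) = if 2 * (d : ℕ) = n then (t : ℕ) else if n < 2 * (d : ℕ) then d else d + 1)
    (hv : ∀ i, (lam + rho (n + 1)) i = shiftedIndex t d i - (n : ℚ) / 2) :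
    dominantRep (reflect (eps t + eps w) (lam + rho (n + 1))) =
      determinantWeight n t d + rho (n + 1) := by
  have hex : ∀ i, ∃ j, (i = t → j = w) ∧ (i = w → j = t) ∧
      (i ≠ t → i ≠ w → shiftedIndex t d i + shiftedIndex t d j = n) := by
    intro i
    by_cases h1 : i = t
    · exact ⟨w, fun _ => rfl, fun h2 => h2 ▸ h1, fun h2 => absurd h1 h2⟩
    by_cases h2 : i = w
    · exact ⟨t, fun h3 => absurd h3 h1, fun _ => rfl, fun _ h3 => absurd h2 h3⟩
    obtain ⟨j, hj⟩ := exists_shiftedIndex_add htd h hw h1 h2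
    exact ⟨j, fun h3 => absurd h3 h1, fun h3 => absurd h3 h2, fun _ _ => hj⟩
  choose τ hτt hτw hτ using hex
  have hτinj : Function.Injective τ := by
    have hpivot : ∀ i j, (i = t ∨ i = w) → τ i = τ j → i = j := by
      intro i j hi hij
      by_cases hj : j = t ∨ j = w
      · rcases hi with hi | hi <;> rcases hj with hj | hj
        · rw [hi, hj]
        · rw [hτt i hi, hτw j hj] at hij
          rw [hi, hj, hij]
        · rw [hτw i hi, hτt j hj] at hij
          rw [hi, hj, hij]
        · rw [hi, hj]
      · push Not at hj
        have h1 := ne_of_shiftedIndex_add htd h hw ((add_comm _ _).trans (hτ j hj.1 hj.2))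
        rw [← hij] at h1
        rcases hi with hi | hi
        · exact absurd (hτt i hi) h1.2
        · exact absurd (hτw i hi) h1.1
    intro i j hij
    by_cases hi : i = t ∨ i = w
    · exact hpivot i j hi hij
    by_cases hj : j = t ∨ j = w
    · exact (hpivot j i hj hij.symm).symm
    push Not at hi hj
    have h1 := hτ i hi.1 hi.2
    have h2 := hτ j hj.1 hj.2
    rw [hij] at h1
    exact shiftedIndex_injective htd (by linarith)
  -- The map `τ` exchanges `t` with `w` and sends every other position to its partner, so coordinate
  -- `i` of the reflected weight is `-μ_{τ i}`. The reversal accounts for the sorted order.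
  let e : Equiv.Perm (Fin (n + 1)) :=
    (Equiv.ofBijective τ (Finite.injective_iff_bijective.mp hτinj)).trans Fin.revPerm
  have hf : ∀ i : Fin (n + 1), (determinantWeight n t d + rho (n + 1)) i =
      (n : ℚ) / 2 - shiftedIndex t d i.rev := by
    intro i
    have h3 : ∀ c : Fin (n + 1), (n < (i.rev : ℕ) + c) ↔ ¬ c ≤ i := fun c => by
      rw [Fin.val_rev, Fin.le_def]
      omega
    have h4 : ((i.rev : ℕ) : ℚ) = n - (i : ℕ) := by
      rw [Fin.val_rev, Nat.cast_sub (by omega)]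
      push_cast
      ring
    rw [Pi.add_apply, determinantWeight, rho_apply, shiftedIndex]
    simp only [h3]
    push_cast
    rw [h4]
    split_ifs <;> first | contradiction | ring
  refine dominantRep_eq_of_perm e ?_ ?_
  · funext i
    have hrev : (e i).rev = τ i := by simp [e]
    rw [Function.comp_apply, hf, hrev, reflect, Pi.sub_apply, Pi.smul_apply, hv, Pi.add_apply,
      eps_apply, eps_apply, corootPairing, eps_add_dotProduct_eps_add, dotProduct_comm,
      add_dotProduct, eps_dotProduct, eps_dotProduct, hv, hv, smul_eq_mul]
    by_cases hwt : w = t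
    · by_cases hi : i = t
      · rw [hτt i hi, hi, hwt]
        simp only [if_true]
        ring
      · have h1 : (shiftedIndex t d i : ℚ) + shiftedIndex t d (τ i) = n := by
          exact_mod_cast hτ i hi (hwt ▸ hi)
        rw [hwt, if_neg hi]
        linear_combination h1
    · simp only [if_true, if_neg hwt, if_neg (Ne.symm hwt)]
      by_cases hi : i = t
      · rw [hτt i hi, hi, if_pos rfl, if_neg (Ne.symm hwt)]
        ring
      by_cases hi' : i = w
      · rw [hτw i hi', hi', if_pos rfl, if_neg hwt]
        ring
      · have h1 : (shiftedIndex t d i : ℚ) + shiftedIndex t d (τ i) = n := by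
          exact_mod_cast hτ i hi hi'
        rw [if_neg hi, if_neg hi']
        linear_combination h1
  · intro i j hij
    rw [hf, hf]
    have : shiftedIndex t d i.rev ≤ shiftedIndex t d j.rev := by
      rw [Fin.le_def] at hij
      simp only [shiftedIndex, Fin.val_rev]
      split_ifs <;> omega
    have : (shiftedIndex t d i.rev : ℚ) ≤ shiftedIndex t d j.rev := by exact_mod_cast this
    linarith

theorem isLambdaPrime_determinantWeight {σ : YoungDiagram} (h2 : σ.rowLen 0 ≤ 2)
    (ht : σ.colLen 1 = t) (hd : σ.colLen 0 = d) (h : (d : ℕ) + t ≤ n) :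
    IsLambdaPrime n (n + 1) σ (determinantWeight n t d) := by
  have htd : (t : ℕ) ≤ d := by
    rw [← ht, ← hd]
    exact σ.colLen_anti 0 1 zero_le_one
  have hv := sharp_add_rho_apply h2 ht hd
  obtain ⟨w, hw⟩ : ∃ w : Fin (n + 1), (w : ℕ) =
      if 2 * (d : ℕ) = n then (t : ℕ) else if n < 2 * (d : ℕ) then d else d + 1 := by
    refine ⟨⟨if 2 * (d : ℕ) = n then (t : ℕ) else if n < 2 * (d : ℕ) then d else d + 1, ?_⟩, rfl⟩
    split_ifs <;> omega
  refine ⟨eps t + eps w, ⟨eps_add_eps_mem_gammaSet htd h hw hv, fun β hβ => ?_⟩, ?_⟩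
  -- As `Γ` has a single element, minimality only asks that `0` be a sum of positive roots.
  · rw [eq_of_mem_gammaSet htd h hw hv hβ, sub_self]
    exact AddSubmonoid.zero_mem _
  · rw [dominantRep_reflect htd h hw hv, add_sub_cancel_right]

end Gamma

end Weights

end SeparationOfVariables

end

/-! ### The theorem -/

open SeparationOfVariables in
theorem mainTheorem2 (n : ℕ) (σ : YoungDiagram) (hσ : σ ∈ narrowDiagrams n (n + 1))
    (t d : Fin (n + 1)) (ht : σ.colLen 1 = t) (hd : σ.colLen 0 = d) (hpos : 0 < (d : ℕ)) :
    windowMatrix (rTensor n (n + 1)) (xTensor n (n + 1)) d t =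
      displayedMatrix (rTensor n (n + 1)) (xTensor n (n + 1)) d t ∧
    glModule n (n + 1) σ ≤ harmonics n (n + 1) ∧
    ∃ ν : Weight (n + 1), IsLambdaPrime n (n + 1) σ ν ∧
    ∃ D : invariants n (n + 1) ⊗[ℂ] glModule n (n + 1) σ,
      LinearMap.lTensor (invariants n (n + 1)) (glModule n (n + 1) σ).subtype D =
        (windowMatrix (rTensor n (n + 1)) (xTensor n (n + 1)) d t).det ∧
      D ∈ LinearMap.ker (mulMap (glModule n (n + 1) σ)) ∧
      IsGLHighestWeightVector (glAction σ) ν D ∧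
      ∃ D' : SymPMinus (n + 1) ⊗[ℂ] glModule n (n + 1) σ,
        LinearMap.lTensor (SymPMinus (n + 1)) (glModule n (n + 1) σ).subtype D' =
          (windowMatrix (sTensor n (n + 1)) (xTensorSym n (n + 1)) d t).det ∧
        vermaProj σ D' = D ∧
        IsSPHighestWeightVector (vermaMixed σ) (vermaLaplace σ) ν D' := by
  obtain ⟨⟨-, hn⟩, h2, -⟩ := hσ
  have hdt : (d : ℕ) + t ≤ n := by rwa [← hd, ← ht]
  have htd : t ≤ d := by
    rw [Fin.le_def, ← ht, ← hd]
    exact σ.colLen_anti 0 1 zero_le_one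
  -- The element of the Verma module is constructed first and `D` is its image. Non-vanishing is
  -- proved for `D` and lifts to `D'`; weight and raising conditions descend from `D'` to `D`.
  obtain ⟨D', hD'⟩ := det_symbolMatrix_mem_range h2 ht hd
  have hD := lTensor_vermaProj σ D'
  rw [hD', map_det_symbolMatrix] at hD
  have hDne : vermaProj σ D' ≠ 0 := by
    intro h0
    rw [h0, map_zero] at hD
    exact det_window_ne_zero hpos htd hdt hD.symm
  have hsp := isSPHighestWeightVector_of_lTensor_eq_det
    (fun h0 => hDne (by rw [h0, map_zero])) hD'
  refine ⟨?_, glModule_le_harmonics h2 hn (by omega), determinantWeight n t d,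
    isLambdaPrime_determinantWeight h2 ht hd hdt, vermaProj σ D', ?_, ?_, ⟨hDne, fun i => ?_,
    fun i j hij => ?_⟩, D', ?_, rfl, hsp⟩
  · rw [windowMatrix_eq_hollowMatrix _ _ hdt, hollowMatrix_submatrix_eq_displayedMatrix]
  · rw [hD, windowMatrix_eq_hollowMatrix _ _ hdt]
  · rw [LinearMap.mem_ker, mulMap_eq, hD, ← windowMatrix_eq_hollowMatrix _ _ hdt,
      productMap_det_eq_zero hdt]
  · rw [glAction_vermaProj, ← map_neg, hsp.gl.weight, map_smul]
  · rw [glAction_vermaProj, hsp.gl.raising i j hij, map_zero]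
  · rw [hD', symbolMatrix, windowMatrix_eq_hollowMatrix _ _ hdt]
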